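/- Let $M$ be a closed 3-manifold with a triangulation $T$, that is, $M$ is obtained, up to homeomorphism, from finitely many 3-simplices by gluing their faces in pairs by affine isomorphisms (faces, edges or vertices of the same simplex may be identified; for instance, one-vertex triangulations are allowed). An *angle structure* on a 3-simplex with vertices $v_1,\dots,v_4$ is an assignment of a dihedral angle $x_{ij}=x_{ji}\in(0,\pi)$ to each edge $v_iv_j$ such that $x_{ij}+x_{ik}+x_{il}>\pi$ and $x_{ij}+x_{ik}-x_{il}<\pi$ whenever $\{i,j,k,l\}=\{1,2,3,4\}$; the set of these is $AS(3)\subset\mathbb R^6$. Its face angles $y^i_{jk}\in(0,\pi)$ and edge lengths $l_{ij}\in\mathbb R$ are defined by $$\cos y^i_{jk}=\frac{\cos x_{il}+\cos x_{ij}\cos x_{ik}}{\sin x_{ij}\sin x_{ik}},\qquad f(l_{ij})=\frac{\cos y^k_{ij}+\cos y^i_{jk}\cos y^j_{ik}}{\sin y^i_{jk}\sin y^j_{ik}},$$ where $f:\mathbb R\to\mathbb R$ is the bijection with $f(z)=\cosh z$ for $z\le 0$, $f(z)=\cos z$ for $0\le z\le\pi$, and $f(z)=-\cosh(z-\pi)$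 for $z\ge\pi$ (the value $l_{ij}$ is the same for both choices of $k$). The volume of $x\in AS(3)$ is $V(x)=\int_a^x\frac12\sum_{i<j}l_{ij}\,dx_{ij}$, integrated along the straight segment from the point $a$ all of whose coordinates are $\arccos(1/3)$. An angle structure on a 3-simplex is *classical* if its angles are the dihedral angles of a non-degenerate tetrahedron in $S^3$, $E^3$ or $H^3$. Let $AS(M,T)$ be the set of all assignments of an angle structure to each 3-simplex of $T$ such that the sum of the dihedral angles at each edge of $T$ is $2\pi$. It is an open subset of an affine space, and the volume of an element of $AS(M,T)$ is the sum of the volumes of its 3-simplices. A *normal surface* in $T$ is a subset of $M$ that meets each 3-simplex in finitely many pairwise disjoint normal disks (normal triangles and normal quadrilaterals). **Proposition 7.1.** Let $p\in AS(M,T)$ be a critical point of the volume function on $AS(M,T)$, and suppose that the angle structure of at least one 3-simplex in $p$ is not classical. Then there is a normal surface $S$ in $T$ such that - $S$ meets each 3-simplex of $T$ in the empty set or in exactly one normal disk; - for each edge of each 3-simplex of $T$: $S$ meets this edge in exactly one point if the length of the edge in $p$ is at least $\pi$, and does not meet it otherwise; - the Euler characteristic of $S$ is positive. -/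

import Mathlib

noncomputable section

/-! ### Möbius lengths in two-dimensional angle structures -/

/-- The function `f = cos ∘ φ : ℝ → ℝ`: it is `cosh z` for `z ≤ 0`, `cos z` on `[0, π]` and
`-cosh (z - π)` for `z ≥ π`. It is a decreasing bijection of the real line. -/
def extCos (z : ℝ) : ℝ :=
  if z ≤ 0 then Real.cosh z else if z ≤ Real.pi then Real.cos z else -Real.cosh (z - Real.pi)

/-- The inverse function of `extCos`. -/
def extArccos (c : ℝ) : ℝ :=
  if 1 < c then -Real.arcosh c
  else if c < -1 then Real.pi + Real.arcosh (-c)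
  else Real.arccos c

theorem extCos_extArccos (c : ℝ) : extCos (extArccos c) = c := by
  unfold extArccos
  split_ifs with h1 h2
  · have h := Real.cosh_arcosh h1.le
    have h0 := Real.arcosh_nonneg h1.le
    simp [extCos, h0, h]
  · have h := Real.cosh_arcosh (x := -c) (by linarith)
    have h0 : 0 < Real.arcosh (-c) := Real.arcosh_pos (by linarith)
    have hp := Real.pi_pos
    rw [extCos, if_neg (by linarith), if_neg (by linarith)]
    simp [h]
  · have h := Real.cos_arccos (x := c) (by linarith) (by linarith)
    by_cases hz : Real.arccos c ≤ 0
    · have h0 : Real.arccos c = 0 := le_antisymm hz (Real.arccos_nonneg c)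
      rw [h0, Real.cos_zero] at h
      simp [extCos, h0, h]
    · rw [extCos, if_neg hz, if_pos (Real.arccos_le_pi c), h]

theorem extArccos_extCos (z : ℝ) : extArccos (extCos z) = z := by
  unfold extCos
  split_ifs with h1 h2
  · rcases eq_or_lt_of_le h1 with rfl | h
    · simp [extArccos]
    · have hc : 1 < Real.cosh z := Real.one_lt_cosh.mpr h.ne
      rw [extArccos, if_pos hc, ← Real.cosh_neg, Real.arcosh_cosh (by linarith)]
      ring
  · have ha := Real.cos_le_one z
    have hb := Real.neg_one_le_cos z
    rw [extArccos, if_neg (by linarith), if_neg (by linarith),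
      Real.arccos_cos (by linarith) h2]
  · have hc : 1 < Real.cosh (z - Real.pi) := Real.one_lt_cosh.mpr (by intro h; linarith)
    rw [extArccos, if_neg (by linarith), if_pos (by linarith), neg_neg,
      Real.arcosh_cosh (by linarith)]
    ring

/-- The right-hand side of the Cosine Law: the (cosine of the) edge opposite to the angle `a` in
a triangle with inner angles `a, b, c`. -/
def cosLaw (a b c : ℝ) : ℝ :=
  (Real.cos a + Real.cos b * Real.cos c) / (Real.sin b * Real.sin c)

/-- The Möbius length of the edge opposite to the angle `a` in a triangle with inner angles
`a, b, c` in `(0, π)`. -/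
def moebiusLength (a b c : ℝ) : ℝ := extArccos (cosLaw a b c)

/-! ### Angle structures on a tetrahedron -/

/-- The set `AS(3)` of angle structures on the 3-simplex with vertices `0, 1, 2, 3`: the dihedral
angle at the edge `ij` is `x i j = x j i`, and the diagonal, which carries no information,
is zero. The dihedral angles at the three edges that share a vertex are the inner angles of
a spherical triangle. -/
def AngleStructures3 : Set (Fin 4 → Fin 4 → ℝ) :=
  {x | (∀ i, x i i = 0) ∧ (∀ i j, x i j = x j i) ∧
    (∀ i j, i ≠ j → 0 < x i j ∧ x i j < Real.pi) ∧
    ∀ i j k l : Fin 4, [i, j, k, l].Nodup →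
      Real.pi < x i j + x i k + x i l ∧ x i j + x i k - x i l < Real.pi}

/-- The face angle at the vertex `i` of the face `ijk`, where `l` is the fourth vertex: the length
of the edge opposite to the angle `x i l` in the spherical triangle with angles
`x i j`, `x i k`, `x i l`. -/
def faceAngle (x : Fin 4 → Fin 4 → ℝ) (i j k l : Fin 4) : ℝ :=
  Real.arccos (cosLaw (x i l) (x i j) (x i k))

/-- The smallest vertex different from `i` and `j`. -/
def thirdVertex (i j : Fin 4) : Fin 4 :=
  if i ≠ 0 ∧ j ≠ 0 then 0 else if i ≠ 1 ∧ j ≠ 1 then 1 else 2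

/-- The largest vertex different from `i` and `j`. -/
def fourthVertex (i j : Fin 4) : Fin 4 :=
  if i ≠ 3 ∧ j ≠ 3 then 3 else if i ≠ 2 ∧ j ≠ 2 then 2 else 1

theorem nodup_thirdVertex_fourthVertex :
    ∀ i j : Fin 4, i ≠ j → [i, j, thirdVertex i j, fourthVertex i j].Nodup := by
  decide

/-- The length `l_ij` of the edge `ij` in the angle structure `x`: its Möbius length in the face
`ijk`. (On `AS(3)` it does not matter which one of the two faces at `ij` is taken.) -/
def edgeLength (x : Fin 4 → Fin 4 → ℝ) (i j : Fin 4) : ℝ :=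
  let k := thirdVertex i j
  let l := fourthVertex i j
  moebiusLength (faceAngle x k i j l) (faceAngle x i j k l) (faceAngle x j i k l)

/-- The dihedral angles of the regular Euclidean tetrahedron. -/
def regularAngles : Fin 4 → Fin 4 → ℝ := fun i j => if i = j then 0 else Real.arccos (1 / 3)

/-- The Schläfli 1-form `ω = (1/2) ∑_{i < j} l_ij dx_ij` at `x`, evaluated at the vector `w`. -/
def schlaefliForm (x w : Fin 4 → Fin 4 → ℝ) : ℝ :=
  (1 / 2) * ∑ i, ∑ j ∈ Finset.Ioi i, edgeLength x i j * w i j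

/-- The volume `V(x) = ∫_a^x ω` of an angle structure, where `a` is the regular Euclidean
tetrahedron; the integral is taken along the straight segment in the convex set `AS(3)`. -/
def tetVolume (x : Fin 4 → Fin 4 → ℝ) : ℝ :=
  ∫ t in (0 : ℝ)..1, schlaefliForm (regularAngles + t • (x - regularAngles)) (x - regularAngles)

/-! ### Classical geometric tetrahedra -/

/-- The complete simply connected 3-space of curvature `κ ∈ {1, 0, -1}`: the unit sphere in `ℝ⁴`
for `κ = 1`, the affine hyperplane `v₀ = 1` for `κ = 0`, the upper sheet of the hyperboloid
`v₀² - v₁² - v₂² - v₃² = 1` for `κ = -1`. -/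
def spaceForm (κ : ℝ) : Set (Fin 4 → ℝ) :=
  {v | v 0 ^ 2 + κ * (v 1 ^ 2 + v 2 ^ 2 + v 3 ^ 2) = 1 ∧ (κ ≤ 0 → 0 < v 0)}

/-- The inner product of covectors. A covector `n` with `normalForm κ n n = 1` cuts out of
`spaceForm κ` the half-space `{v | n ⬝ᵥ v ≤ 0}`, whose unit outward normal it represents;
`normalForm κ` is the inner product of the unit normals of two planes (at a common point). -/
def normalForm (κ : ℝ) (m n : Fin 4 → ℝ) : ℝ :=
  κ * (m 0 * n 0) + m 1 * n 1 + m 2 * n 2 + m 3 * n 3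

/-- The numbers `x i j` are the dihedral angles of a non-degenerate tetrahedron, with vertices
`v 0, v 1, v 2, v 3`, in the space of constant curvature `κ`. Here `n k` is the outward unit
normal of the face opposite to the vertex `k`; the faces that meet along the edge `ij` are those
opposite to the two other vertices `k` and `l`, and the dihedral angle at this edge is `π` minus
the angle between their outward normals. The conditions on the signs make the vertices linearly
independent. -/
def IsGeometricTetrahedron (κ : ℝ) (x : Fin 4 → Fin 4 → ℝ) : Prop :=
  x ∈ AngleStructures3 ∧
  ∃ v n : Fin 4 → Fin 4 → ℝ,
    (∀ i, v i ∈ spaceForm κ) ∧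
    (∀ k, normalForm κ (n k) (n k) = 1) ∧
    (∀ i k, i ≠ k → n k ⬝ᵥ v i = 0) ∧
    (∀ k, n k ⬝ᵥ v k < 0) ∧
    ∀ i j k l : Fin 4, [i, j, k, l].Nodup → Real.cos (x i j) = -normalForm κ (n k) (n l)

/-- Classical geometric tetrahedra: spherical, Euclidean or hyperbolic ones. -/
def IsClassicalTetrahedron (x : Fin 4 → Fin 4 → ℝ) : Prop :=
  IsGeometricTetrahedron 1 x ∨ IsGeometricTetrahedron 0 x ∨ IsGeometricTetrahedron (-1) x

/-! ### Triangulated closed 3-manifolds -/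

/-- The geometric 3-simplex. -/
abbrev Simplex3 : Type := stdSimplex ℝ (Fin 4)

/-- A closed face gluing of a family of 3-simplices indexed by `ι`: the face opposite to the
vertex `f` of the simplex `σ` is glued to the face opposite to the vertex `perm σ f f` of the
simplex `nbr σ f`; a vertex `i ≠ f` goes to the vertex `perm σ f i`. -/
structure FaceGluing (ι : Type*) where
  nbr : ι → Fin 4 → ι
  perm : ι → Fin 4 → Equiv.Perm (Fin 4)
  nbr_nbr : ∀ σ f, nbr (nbr σ f) (perm σ f f) = σ
  perm_perm : ∀ σ f, perm (nbr σ f) (perm σ f f) = (perm σ f)⁻¹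
  not_self : ∀ σ f, ¬ (nbr σ f = σ ∧ perm σ f f = f)

/-- The six edges of the 3-simplex, each one given as a pair `i < j` of vertices. -/
abbrev TetEdge : Type := {e : Fin 4 × Fin 4 // e.1 < e.2}

namespace FaceGluing

variable {ι : Type*}

/-- A point of a face of a simplex is glued to the corresponding point of the adjacent simplex. -/
def Glued (G : FaceGluing ι) (a b : Σ _ : ι, Simplex3) : Prop :=
  ∃ f : Fin 4, a.2 f = 0 ∧ b.1 = G.nbr a.1 f ∧ ∀ i, b.2 (G.perm a.1 f i) = a.2 i

/-- The quotient space of the disjoint union of the simplices by the gluing. -/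
def Realization (G : FaceGluing ι) : Type _ := Quot G.Glued

instance (G : FaceGluing ι) : TopologicalSpace G.Realization :=
  inferInstanceAs (TopologicalSpace (Quot G.Glued))

/-- An edge of a simplex is glued to the corresponding edge of the adjacent simplex. -/
def EdgeGlued (G : FaceGluing ι) (a b : ι × TetEdge) : Prop :=
  ∃ f : Fin 4, f ≠ a.2.1.1 ∧ f ≠ a.2.1.2 ∧ b.1 = G.nbr a.1 f ∧
    s(b.2.1.1, b.2.1.2) = s(G.perm a.1 f a.2.1.1, G.perm a.1 f a.2.1.2)

/-- The edges of the quotient. -/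
def Edge (G : FaceGluing ι) : Type _ := Quot G.EdgeGlued

end FaceGluing

/-- A triangulation of `M` by 3-simplices indexed by `ι` (different faces, edges or vertices of one
simplex may be identified, so one-vertex triangulations are included). -/
structure Triangulation (ι : Type*) (M : Type*) [TopologicalSpace M] extends FaceGluing ι where
  homeo : toFaceGluing.Realization ≃ₜ M

namespace Triangulation

variable {ι : Type*} {M : Type*} [TopologicalSpace M]

open Classical in
/-- The space `AS(M, T)` of angle structures: an angle structure on each simplex such that the sum
of the dihedral angles at each edge of the triangulation is `2π`. -/
def angleStructures [Fintype ι] (T : Triangulation ι M) : Set (ι → Fin 4 → Fin 4 → ℝ) :=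
  {p | (∀ σ, p σ ∈ AngleStructures3) ∧
    ∀ e : T.toFaceGluing.Edge,
      (∑ a : ι × TetEdge,
        if (Quot.mk _ a : T.toFaceGluing.Edge) = e then p a.1 a.2.1.1 a.2.1.2 else 0)
        = 2 * Real.pi}

/-- The volume of an angle structure on a triangulated manifold. -/
def volume [Fintype ι] (_T : Triangulation ι M) (p : ι → Fin 4 → Fin 4 → ℝ) : ℝ :=
  ∑ σ, tetVolume (p σ)

/-- `p` is a critical point of the volume function on `AS(M, T)`, which is an open subset of an
affine space: the derivative at `p` of the function restricted to `AS(M, T)` is zero. -/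
def IsCriticalPoint [Fintype ι] (T : Triangulation ι M) (p : ι → Fin 4 → Fin 4 → ℝ) : Prop :=
  p ∈ T.angleStructures ∧ HasFDerivWithinAt T.volume
    (0 : (ι → Fin 4 → Fin 4 → ℝ) →L[ℝ] ℝ) T.angleStructures p

/-- The characteristic map of the simplex `σ`. -/
def charMap (T : Triangulation ι M) (σ : ι) (x : Simplex3) : M := T.homeo (Quot.mk _ ⟨σ, x⟩)

end Triangulation

/-! ### Normal surfaces -/

/-- The face of the 3-simplex spanned by a set of vertices. -/
def simplexFace (A : Finset (Fin 4)) : Set Simplex3 := {x | ∀ i, i ∉ A → x i = 0}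

/-- The standard normal disk that separates the vertices in `A` from the other ones: a triangle if
`A` has one element, a quadrilateral if it has two. -/
def standardDisk (A : Finset (Fin 4)) : Set Simplex3 := {x | ∑ i ∈ A, x i = 1 / 2}

/-- Normal disks, that is, normal triangles and normal quadrilaterals: the images of the standard
ones under the homeomorphisms of the 3-simplex that map each face to itself. -/
def IsNormalDisk (D : Set Simplex3) : Prop :=
  ∃ A : Finset (Fin 4), (A.card = 1 ∨ A.card = 2) ∧
    ∃ h : Simplex3 ≃ₜ Simplex3, (∀ x i, h x i = 0 ↔ x i = 0) ∧ D = h '' standardDisk A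

namespace Triangulation

variable {ι : Type*} {M : Type*} [TopologicalSpace M]

/-- The intersection of a subset of `M` with the simplex `σ`, seen in the model simplex. -/
def slice (T : Triangulation ι M) (S : Set M) (σ : ι) : Set Simplex3 := T.charMap σ ⁻¹' S

/-- Normal surfaces: their intersection with each simplex is the union of finitely many pairwise
disjoint normal disks. -/
def IsNormalSurface (T : Triangulation ι M) (S : Set M) : Prop :=
  ∀ σ, ∃ 𝒟 : Set (Set Simplex3), 𝒟.Finite ∧ 𝒟.Pairwise Disjoint ∧
    (∀ D ∈ 𝒟, IsNormalDisk D) ∧ T.slice S σ = ⋃₀ 𝒟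

/-- The closed `k`-cells, for `k = 0, 1, 2`, of the cell decomposition of a normal surface into its
normal disks: the images in `M` of the connected components of its intersections with the
`(k + 1)`-dimensional faces of the simplices. So the 2-cells are the normal disks, the 1-cells
are the normal arcs in the triangles, and the 0-cells are the points on the edges. A cell that is
seen in several simplices is one element of this set. -/
def cells (T : Triangulation ι M) (S : Set M) (k : ℕ) : Set (Set M) :=
  {c | ∃ (σ : ι) (A : Finset (Fin 4)), A.card = k + 2 ∧ ∃ x ∈ T.slice S σ ∩ simplexFace A,
    c = T.charMap σ '' connectedComponentIn (T.slice S σ ∩ simplexFace A) x}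

/-- The Euler characteristic of a normal surface, computed from its cell decomposition into
normal disks. -/
def eulerChar (T : Triangulation ι M) (S : Set M) : ℤ :=
  ((T.cells S 0).ncard : ℤ) - (T.cells S 1).ncard + (T.cells S 2).ncard

end Triangulation

end

noncomputable section

/-! ### The function `extArccos` -/

/-! Call an edge long if its length is at least `π`. The surface `S` is built from the cuts that the
long edges make in the simplices.

One simplex. Let `G` be the Gram matrix of the face normals, with off-diagonal entries minus the
cosines of the dihedral angles. Its principal 3×3 minors (`vertexGram`) are positive, and the length
of an edge is `extArccos` of the cofactor at the edge (`edgeCofactor`) divided by the root of two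
such minors. Jacobi's identities for minors of the adjugate do the rest. If `det G > 0`, no edge is
long. If `det G ≤ 0`, an edge is long exactly when its cofactor is negative, and the product of the
three cofactors of a face is positive, so each face has an even number of long edges. Hence the long
edges are those joining the two sides of a partition of the vertices
(`pi_le_edgeLength_iff_cutSet`). If there are none, the sign of `det G` and the positive cofactors
give a spherical, Euclidean or hyperbolic tetrahedron (`isGeometricTetrahedron`). So a non-classical
simplex contributes a nontrivial partition, hence a normal triangle or quadrilateral.

Gluing. At a critical point, glued edges have equal lengths (`edgeLength_eq_of_mk_eq`): shift a
little angle from one to the other and use `dV = ω`, the Schläfli form. So the partitions match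
across faces and the disks form a surface. The analytic core is `dV = ω` on all of `AS(3)`
(`hasFDerivAt_tetVolume`), including the hypersurface `det G = 0`, where the lengths are only
continuous. Off it, `ω` is closed because the Jacobian of the lengths is symmetric. On it, all
lengths are locally constant, `0` or `π`, and it is regular. A Stokes argument with a cutoff shows
that such a form is locally exact; integration along rays then gives a primitive.

Euler characteristic. Give each disk the dihedral angles at its corners. A triangle has angle sum
greater than `π` by the definition of an angle structure, and a quadrilateral with corners on long
edges has angle sum greater than `2π` (`two_pi_lt_quad`, from Delambre's analogies). The angles
around each corner of the surface add up to `2π`, so combinatorial Gauss–Bonnet makes the Euler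
characteristic positive (`eulerChar_pos`). -/

theorem pi_le_extArccos_iff (c : ℝ) : Real.pi ≤ extArccos c ↔ c ≤ -1 := by
  have hp := Real.pi_pos
  unfold extArccos
  split_ifs with h1 h2
  · have h0 := Real.arcosh_nonneg h1.le
    constructor <;> intro h <;> linarith
  · have h0 : 0 < Real.arcosh (-c) := Real.arcosh_pos (by linarith)
    constructor <;> intro h <;> linarith
  · rw [← Real.arccos_eq_pi]
    exact ⟨fun h => le_antisymm (Real.arccos_le_pi c) h, fun h => h.ge⟩

/-- Clamping the arguments of `arcosh` at `1` turns the three branches into one sum of continuous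
functions. -/
theorem extArccos_eq (c : ℝ) :
    extArccos c = Real.arccos c - Real.arcosh (max c 1) + Real.arcosh (max (-c) 1) := by
  unfold extArccos
  split_ifs with h1 h2
  · rw [Real.arccos_eq_zero.2 h1.le, max_eq_left h1.le, max_eq_right (by linarith)]
    simp
  · rw [Real.arccos_eq_pi.2 h2.le, max_eq_right (by linarith), max_eq_left (by linarith)]
    simp
  · rw [max_eq_right (by linarith), max_eq_right (by linarith)]
    simp

theorem continuous_extArccos : Continuous extArccos := by
  have h : ∀ g : ℝ → ℝ, Continuous g → Continuous fun c => Real.arcosh (max (g c) 1) := fun g hg =>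
    Real.continuousOn_arcosh.comp_continuous (hg.max continuous_const) fun c => Set.mem_Ici.2 (le_max_right _ _)
  rw [funext extArccos_eq]
  exact (Real.continuous_arccos.sub (h _ continuous_id)).add (h _ continuous_neg)

open Topology in
-- The absolute value merges the three branches into one formula, so the differentials of the
-- lengths need no case distinction on the sign of the Gram determinant.
theorem extArccos_contDiffAt_and_hasDerivAt {c : ℝ} (h1 : c ≠ 1) (h2 : c ≠ -1) :
    ContDiffAt ℝ 1 extArccos c ∧ HasDerivAt extArccos (-(√|1 - c ^ 2|)⁻¹) c := by
  rcases lt_or_gt_of_ne h1 with h | h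
  · rcases lt_or_gt_of_ne h2 with h' | h'
    · have he : extArccos =ᶠ[𝓝 c] fun c => Real.pi + Real.arcosh (-c) := by
        filter_upwards [Iio_mem_nhds h'] with y hy
        rw [Set.mem_Iio] at hy
        rw [extArccos, if_neg (by linarith), if_pos hy]
      have hc : -c ∈ Set.Ioi (1 : ℝ) := by simp; linarith
      refine ⟨ContDiffAt.congr_of_eventuallyEq ?_ he, HasDerivAt.congr_of_eventuallyEq ?_ he⟩
      · exact contDiffAt_const.add ((Real.contDiffAt_arcosh hc).comp c contDiffAt_id.neg)
      · refine (((Real.hasDerivAt_arcosh hc).comp c (hasDerivAt_neg c)).const_add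
          Real.pi).congr_deriv ?_
        rw [abs_of_neg (by nlinarith)]
        ring_nf
    · have he : extArccos =ᶠ[𝓝 c] Real.arccos := by
        filter_upwards [Iio_mem_nhds h, Ioi_mem_nhds h'] with y hy hy'
        rw [Set.mem_Iio] at hy
        rw [Set.mem_Ioi] at hy'
        rw [extArccos, if_neg (by linarith), if_neg (by linarith)]
      refine ⟨ContDiffAt.congr_of_eventuallyEq ?_ he, HasDerivAt.congr_of_eventuallyEq ?_ he⟩
      · exact Real.contDiffAt_arccos h2 h1
      · refine (Real.hasDerivAt_arccos h2 h1).congr_deriv ?_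
        rw [abs_of_pos (by nlinarith)]
        simp
  · have he : extArccos =ᶠ[𝓝 c] fun c => -Real.arcosh c := by
      filter_upwards [Ioi_mem_nhds h] with y hy
      rw [Set.mem_Ioi] at hy
      rw [extArccos, if_pos hy]
    have hc : c ∈ Set.Ioi (1 : ℝ) := h
    refine ⟨ContDiffAt.congr_of_eventuallyEq ?_ he, HasDerivAt.congr_of_eventuallyEq ?_ he⟩
    · exact (Real.contDiffAt_arcosh hc).neg
    · refine (Real.hasDerivAt_arcosh hc).neg.congr_deriv ?_
      rw [abs_of_neg (by nlinarith)]
      ring_nf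

/-! ### Cofactors of the Gram matrix -/

/-- The determinant of the Gram matrix of a spherical triangle with angles `a, b, c`. -/
def vertexGram (a b c : ℝ) : ℝ :=
  1 - Real.cos a ^ 2 - Real.cos b ^ 2 - Real.cos c ^ 2 - 2 * Real.cos a * Real.cos b * Real.cos c

/-- The off-diagonal cofactor, at the edge with dihedral angle `a`, of the Gram matrix of a
tetrahedron with three pairs of opposite dihedral angles `a, a'`, `b, b'` and `c, c'`; the edges
with angles `a, b, c` share a vertex. -/
def edgeCofactor (a a' b b' c c' : ℝ) : ℝ :=
  Real.sin a ^ 2 * (Real.cos a' + Real.cos b * Real.cos c') +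
    (Real.cos c + Real.cos a * Real.cos b) * (Real.cos b' + Real.cos a * Real.cos c')

/-- The determinant of the Gram matrix of a tetrahedron; the arguments are as in
`edgeCofactor`. -/
def gramPoly (a a' b b' c c' : ℝ) : ℝ :=
  1 - (Real.cos a ^ 2 + Real.cos a' ^ 2 + Real.cos b ^ 2 + Real.cos b' ^ 2 + Real.cos c ^ 2 +
      Real.cos c' ^ 2) -
    2 * (Real.cos a * Real.cos b * Real.cos c + Real.cos a * Real.cos c' * Real.cos b' +
      Real.cos b * Real.cos c' * Real.cos a' + Real.cos c * Real.cos b' * Real.cos a') +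
    (Real.cos a ^ 2 * Real.cos a' ^ 2 + Real.cos b ^ 2 * Real.cos b' ^ 2 +
      Real.cos c ^ 2 * Real.cos c' ^ 2) -
    2 * (Real.cos a * Real.cos a' * Real.cos b * Real.cos b' +
      Real.cos a * Real.cos a' * Real.cos c * Real.cos c' +
      Real.cos b * Real.cos b' * Real.cos c * Real.cos c')

/-- Jacobi's identity for a 2×2 minor of the adjugate: it equals the determinant times the
complementary minor, which is `sin a ^ 2`. -/
theorem edgeCofactor_sq (a a' b b' c c' : ℝ) :
    edgeCofactor a a' b b' c c' ^ 2 + gramPoly a a' b b' c c' * Real.sin a ^ 2 =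
      vertexGram a b c * vertexGram a c' b' := by
  simp only [edgeCofactor, gramPoly, vertexGram, Real.sin_sq]
  ring

/-- Jacobi's identity for the 3×3 minor of the adjugate at three vertices: its value is the square
of the determinant, because the complementary entry is `1`. The squares of the cofactors have been
eliminated by `edgeCofactor_sq`. -/
theorem edgeCofactor_mul (a a' b b' c c' : ℝ) :
    2 * (edgeCofactor a a' b b' c c' * edgeCofactor b b' a a' c c' *
      edgeCofactor c' c a a' b' b) =
    gramPoly a a' b b' c c' ^ 2 + 2 * (vertexGram a b c * vertexGram a c' b' * vertexGram b c' a') -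
      gramPoly a a' b b' c c' * (vertexGram a b c * Real.sin c' ^ 2 +
        vertexGram a c' b' * Real.sin b ^ 2 + vertexGram b c' a' * Real.sin a ^ 2) := by
  simp only [edgeCofactor, gramPoly, vertexGram, Real.sin_sq]
  ring

theorem edgeCofactor_swap (a a' b b' c c' : ℝ) :
    edgeCofactor a a' b b' c c' = edgeCofactor a a' c c' b b' := by
  simp only [edgeCofactor, Real.sin_sq]
  ring

theorem edgeCofactor_swap' (a a' b b' c c' : ℝ) :
    edgeCofactor a a' b b' c c' = edgeCofactor a a' b' b c' c := by
  simp only [edgeCofactor, Real.sin_sq]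
  ring

theorem vertexGram_swap (a b c : ℝ) : vertexGram a b c = vertexGram a c b := by
  simp only [vertexGram]
  ring

theorem vertexGram_swap' (a b c : ℝ) : vertexGram a b c = vertexGram b a c := by
  simp only [vertexGram]
  ring

theorem vertexGram_eq_sub (a b c : ℝ) :
    vertexGram a b c = Real.sin b ^ 2 * Real.sin c ^ 2 -
      (Real.cos a + Real.cos b * Real.cos c) ^ 2 := by
  simp only [vertexGram, Real.sin_sq]
  ring

/-- The determinant factors into two differences of cosines, and the inequalities of a spherical
triangle say that both are positive. -/
theorem vertexGram_pos {a b c : ℝ} (ha : 0 < a) (haπ : a < Real.pi) (h : Real.pi < a + b + c)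
    (h1 : a + b - c < Real.pi) (h2 : a + c - b < Real.pi) (h3 : b + c - a < Real.pi) :
    0 < vertexGram a b c := by
  have e : vertexGram a b c =
      (Real.cos (b + c - Real.pi) - Real.cos a) * (Real.cos (b - c) - Real.cos (Real.pi - a)) := by
    rw [vertexGram_eq_sub, Real.cos_sub_pi, Real.cos_pi_sub, Real.cos_add, Real.cos_sub]
    ring
  rw [e]
  apply mul_pos <;> rw [sub_pos]
  · rw [← Real.cos_abs (b + c - _)]
    refine Real.cos_lt_cos_of_nonneg_of_le_pi (abs_nonneg _) haπ.le ?_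
    rw [abs_lt]; constructor <;> linarith
  · rw [← Real.cos_abs (b - c)]
    refine Real.cos_lt_cos_of_nonneg_of_le_pi (abs_nonneg _) (by linarith) ?_
    rw [abs_lt]; constructor <;> linarith

end

noncomputable section

/-! ### Trigonometry of spherical and Möbius triangles -/

theorem neg_one_lt_cosLaw_lt_one {a b c : ℝ} (hb : 0 < Real.sin b) (hc : 0 < Real.sin c)
    (h : 0 < vertexGram a b c) : -1 < cosLaw a b c ∧ cosLaw a b c < 1 := by
  rw [vertexGram_eq_sub] at h
  have h2 : (Real.cos a + Real.cos b * Real.cos c) ^ 2 < (Real.sin b * Real.sin c) ^ 2 := by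
    rw [mul_pow]; linarith
  have h3 := abs_lt_of_sq_lt_sq h2 (by positivity)
  rw [abs_lt] at h3
  rw [cosLaw, lt_div_iff₀ (by positivity), div_lt_iff₀ (by positivity)]
  exact ⟨by linarith, by linarith⟩

theorem cos_arccos_cosLaw {a b c : ℝ} (hb : 0 < Real.sin b) (hc : 0 < Real.sin c)
    (h : 0 < vertexGram a b c) : Real.cos (Real.arccos (cosLaw a b c)) = cosLaw a b c :=
  Real.cos_arccos (neg_one_lt_cosLaw_lt_one hb hc h).1.le (neg_one_lt_cosLaw_lt_one hb hc h).2.le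

theorem sin_arccos_cosLaw {a b c : ℝ} (hb : 0 < Real.sin b) (hc : 0 < Real.sin c) :
    Real.sin (Real.arccos (cosLaw a b c)) = √(vertexGram a b c) / (Real.sin b * Real.sin c) := by
  rw [Real.sin_arccos, eq_div_iff (by positivity),
    ← Real.sqrt_sq (by positivity : 0 ≤ Real.sin b * Real.sin c), ← Real.sqrt_mul' _ (by positivity)]
  congr 1
  rw [vertexGram_eq_sub, cosLaw]
  field_simp

theorem arccos_mem_Ioo {c : ℝ} (h : -1 < c ∧ c < 1) :
    0 < Real.arccos c ∧ Real.arccos c < Real.pi := by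
  refine ⟨Real.arccos_pos.2 h.2, lt_of_le_of_ne (Real.arccos_le_pi c) fun e => ?_⟩
  rw [Real.arccos_eq_pi] at e
  linarith [h.1]

/-- Cleared of denominators, the hypothesis is `cos β ≤ -cos (α - γ) = cos (π - |α - γ|)`, and the
cosine decreases on `[0, π]`. -/
theorem pi_le_add_abs_sub_of_cosLaw_le {α β γ : ℝ} (hα : 0 < α) (hα' : α < Real.pi)
    (hβ : 0 < β) (hγ : 0 < γ) (hγ' : γ < Real.pi)
    (h : cosLaw β α γ ≤ -1) : Real.pi ≤ β + |α - γ| := by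
  have h1 := Real.sin_pos_of_pos_of_lt_pi hα hα'
  have h2 := Real.sin_pos_of_pos_of_lt_pi hγ hγ'
  rw [cosLaw, div_le_iff₀ (by positivity)] at h
  by_contra hc
  have h3 : Real.cos (Real.pi - |α - γ|) < Real.cos β := by
    refine Real.cos_lt_cos_of_nonneg_of_le_pi hβ.le (by linarith [abs_nonneg (α - γ)]) (by linarith)
  rw [Real.cos_pi_sub, Real.cos_abs, Real.cos_sub] at h3
  linarith

/-- In a Möbius triangle two of whose edges have length at least `π`, the two inner angles at the
third edge have a sum larger than `π`. -/
theorem pi_lt_add_of_cosLaw_le {α β γ : ℝ} (hα : 0 < α) (hα' : α < Real.pi)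
    (hβ : 0 < β) (hβ' : β < Real.pi) (hγ : 0 < γ) (hγ' : γ < Real.pi)
    (h : cosLaw β α γ ≤ -1) (h' : cosLaw α β γ ≤ -1) : Real.pi < α + β := by
  have h1 := pi_le_add_abs_sub_of_cosLaw_le hα hα' hβ hγ hγ' h
  have h2 := pi_le_add_abs_sub_of_cosLaw_le hβ hβ' hα hγ hγ' h'
  rcases abs_cases (α - γ) with ⟨e1, _⟩ | ⟨e1, _⟩ <;>
    rcases abs_cases (β - γ) with ⟨e2, _⟩ | ⟨e2, _⟩ <;> rw [e1] at h1 <;> rw [e2] at h2 <;> linarith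

/-- One of Delambre's analogies of spherical trigonometry. Both sides are positive, so it suffices
to compare squares, to which the half-angle formulas and the cosine law apply. -/
theorem sin_half_add_mul_cos_half {A B C : ℝ} (hA : 0 < A) (hA' : A < Real.pi) (hB : 0 < B)
    (hB' : B < Real.pi) (hC : 0 < C) (hC' : C < Real.pi) (hG : 0 < vertexGram A B C) :
    Real.sin ((A + B) / 2) * Real.cos (Real.arccos (cosLaw C A B) / 2) =
      Real.cos ((Real.arccos (cosLaw A B C) - Real.arccos (cosLaw B A C)) / 2) *
        Real.cos (C / 2) := by
  have sA := Real.sin_pos_of_pos_of_lt_pi hA hA'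
  have sB := Real.sin_pos_of_pos_of_lt_pi hB hB'
  have sC := Real.sin_pos_of_pos_of_lt_pi hC hC'
  have hG1 : vertexGram B A C = vertexGram A B C := vertexGram_swap' _ _ _
  have hG2 : vertexGram C A B = vertexGram A B C := by
    rw [vertexGram_swap', vertexGram_swap]
  have ca := cos_arccos_cosLaw sB sC hG
  have cb := cos_arccos_cosLaw sA sC (hG1 ▸ hG)
  have cc := cos_arccos_cosLaw sA sB (hG2 ▸ hG)
  have sa := sin_arccos_cosLaw (a := A) sB sC
  have sb := sin_arccos_cosLaw (a := B) sA sC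
  have ia := arccos_mem_Ioo (neg_one_lt_cosLaw_lt_one sB sC hG)
  have ib := arccos_mem_Ioo (neg_one_lt_cosLaw_lt_one sA sC (hG1 ▸ hG))
  have ic := arccos_mem_Ioo (neg_one_lt_cosLaw_lt_one sA sB (hG2 ▸ hG))
  rw [hG1] at sb
  set a := Real.arccos (cosLaw A B C)
  set b := Real.arccos (cosLaw B A C)
  set c := Real.arccos (cosLaw C A B)
  have p1 : 0 < Real.sin ((A + B) / 2) :=
    Real.sin_pos_of_pos_of_lt_pi (by linarith) (by linarith)
  have p2 : 0 < Real.cos (c / 2) := Real.cos_pos_of_mem_Ioo ⟨by linarith, by linarith⟩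
  have p3 : 0 < Real.cos ((a - b) / 2) := Real.cos_pos_of_mem_Ioo ⟨by linarith, by linarith⟩
  have p4 : 0 < Real.cos (C / 2) := Real.cos_pos_of_mem_Ioo ⟨by linarith, by linarith⟩
  rw [← sq_eq_sq₀ (by positivity) (by positivity), mul_pow, mul_pow, Real.sin_sq, Real.cos_sq,
    Real.cos_sq (c / 2), Real.cos_sq ((a - b) / 2), Real.cos_sq (C / 2)]
  simp only [mul_div_cancel₀ _ (two_ne_zero' ℝ)]
  rw [Real.cos_add, Real.cos_sub, ca, cb, cc, sa, sb]
  have hr : √(vertexGram A B C) ^ 2 = vertexGram A B C := Real.sq_sqrt hG.le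
  have hsA := Real.sin_sq_add_cos_sq A
  have hsB := Real.sin_sq_add_cos_sq B
  have hsC := Real.sin_sq_add_cos_sq C
  have e : √(vertexGram A B C) / (Real.sin B * Real.sin C) *
      (√(vertexGram A B C) / (Real.sin A * Real.sin C)) =
      vertexGram A B C / (Real.sin A * Real.sin B * Real.sin C ^ 2) := by
    rw [div_mul_div_comm, ← sq, hr]; ring_nf
  rw [e]
  simp only [cosLaw, vertexGram]
  generalize Real.sin A = u at *
  generalize Real.sin B = v at *
  generalize Real.sin C = w at *
  generalize Real.cos A = U at *
  generalize Real.cos B = V at *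
  generalize Real.cos C = W at *
  field_simp
  have h1 : w ^ 2 = 1 - W ^ 2 := by linarith
  have h2 : (u * v) ^ 2 = (1 - U ^ 2) * (1 - V ^ 2) := by
    linear_combination v ^ 2 * hsA + (1 - U ^ 2) * hsB
  linear_combination ((1 - U * V + u * v) * (u * v + W + U * V) - u * v * (1 + W)) * h1 +
    (1 - W ^ 2) * h2

/-- A second analogy of Delambre. Its sides may be negative, so squares do not suffice. Multiplied
by the positive side of the first analogy, it becomes `sin (A + B) * (1 + cos c) = (cos a + cos b) *
sin C`. -/
theorem cos_half_add_mul_cos_half {A B C : ℝ} (hA : 0 < A) (hA' : A < Real.pi) (hB : 0 < B)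
    (hB' : B < Real.pi) (hC : 0 < C) (hC' : C < Real.pi) (hG : 0 < vertexGram A B C) :
    Real.cos ((A + B) / 2) * Real.cos (Real.arccos (cosLaw C A B) / 2) =
      Real.cos ((Real.arccos (cosLaw A B C) + Real.arccos (cosLaw B A C)) / 2) *
        Real.sin (C / 2) := by
  have sA := Real.sin_pos_of_pos_of_lt_pi hA hA'
  have sB := Real.sin_pos_of_pos_of_lt_pi hB hB'
  have sC := Real.sin_pos_of_pos_of_lt_pi hC hC'
  have hG1 : vertexGram B A C = vertexGram A B C := vertexGram_swap' _ _ _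
  have hG2 : vertexGram C A B = vertexGram A B C := by
    rw [vertexGram_swap', vertexGram_swap]
  have ca := cos_arccos_cosLaw sB sC hG
  have cb := cos_arccos_cosLaw sA sC (hG1 ▸ hG)
  have cc := cos_arccos_cosLaw sA sB (hG2 ▸ hG)
  have ic := arccos_mem_Ioo (neg_one_lt_cosLaw_lt_one sA sB (hG2 ▸ hG))
  have h := sin_half_add_mul_cos_half hA hA' hB hB' hC hC' hG
  set a := Real.arccos (cosLaw A B C)
  set b := Real.arccos (cosLaw B A C)
  set c := Real.arccos (cosLaw C A B)
  have p1 : 0 < Real.sin ((A + B) / 2) :=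
    Real.sin_pos_of_pos_of_lt_pi (by linarith) (by linarith)
  have p2 : 0 < Real.cos (c / 2) := Real.cos_pos_of_mem_Ioo ⟨by linarith, by linarith⟩
  refine mul_left_cancel₀ (mul_pos p1 p2).ne' ?_
  have e1 : 2 * Real.sin ((A + B) / 2) * Real.cos ((A + B) / 2) = Real.sin (A + B) := by
    rw [← Real.sin_two_mul]; ring_nf
  have e2 : 2 * Real.cos (c / 2) ^ 2 = 1 + Real.cos c := by
    rw [Real.cos_sq]; ring_nf
  have e3 : 2 * Real.cos ((a + b) / 2) * Real.cos ((a - b) / 2) = Real.cos a + Real.cos b := by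
    rw [Real.cos_add_cos]
  have e4 : 2 * Real.sin (C / 2) * Real.cos (C / 2) = Real.sin C := by
    rw [← Real.sin_two_mul]; ring_nf
  have e5 : Real.sin (A + B) * (1 + Real.cos c) = (Real.cos a + Real.cos b) * Real.sin C := by
    rw [ca, cb, cc, Real.sin_add]
    simp only [cosLaw]
    field_simp
    have h1 := Real.sin_sq A
    have h2 := Real.sin_sq B
    generalize Real.sin A = u at *
    generalize Real.sin B = v at *
    generalize Real.cos A = U at *
    generalize Real.cos B = V at *
    generalize Real.cos C = W at *
    linear_combination (v * V) * h1 + (u * U) * h2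
  calc _ = (2 * Real.sin ((A + B) / 2) * Real.cos ((A + B) / 2)) * (2 * Real.cos (c / 2) ^ 2) / 4 := by
        ring
    _ = (2 * Real.cos ((a + b) / 2) * Real.cos ((a - b) / 2)) *
          (2 * Real.sin (C / 2) * Real.cos (C / 2)) / 4 := by
        rw [e1, e2, e3, e4, e5]
    _ = _ := by rw [h]; ring

/-- Two spherical triangles with an angle `C` in common. -/
theorem two_pi_lt_add_of_pi_lt_add {A B A' B' C : ℝ} (hA : 0 < A) (hA1 : A < Real.pi) (hB : 0 < B)
    (hB1 : B < Real.pi) (hA' : 0 < A') (hA1' : A' < Real.pi) (hB' : 0 < B') (hB1' : B' < Real.pi)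
    (hC : 0 < C) (hC1 : C < Real.pi) (hG : 0 < vertexGram A B C) (hG' : 0 < vertexGram A' B' C)
    (h1 : Real.pi < Real.arccos (cosLaw A B C) + Real.arccos (cosLaw A' B' C))
    (h2 : Real.pi < Real.arccos (cosLaw B A C) + Real.arccos (cosLaw B' A' C)) :
    2 * Real.pi < A + B + A' + B' := by
  have key : ∀ {A B : ℝ}, 0 < A → A < Real.pi → 0 < B → B < Real.pi → 0 < vertexGram A B C →
      (0 < Real.arccos (cosLaw A B C) ∧ Real.arccos (cosLaw A B C) < Real.pi) ∧
      (0 < Real.arccos (cosLaw B A C) ∧ Real.arccos (cosLaw B A C) < Real.pi) ∧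
      0 < Real.cos (Real.arccos (cosLaw C A B) / 2) := by
    intro A B hA hA1 hB hB1 hG
    have sA := Real.sin_pos_of_pos_of_lt_pi hA hA1
    have sB := Real.sin_pos_of_pos_of_lt_pi hB hB1
    have sC := Real.sin_pos_of_pos_of_lt_pi hC hC1
    have hG1 : vertexGram B A C = vertexGram A B C := vertexGram_swap' _ _ _
    have hG2 : vertexGram C A B = vertexGram A B C := by
      rw [vertexGram_swap', vertexGram_swap]
    refine ⟨arccos_mem_Ioo (neg_one_lt_cosLaw_lt_one sB sC hG),
      arccos_mem_Ioo (neg_one_lt_cosLaw_lt_one sA sC (hG1 ▸ hG)), ?_⟩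
    have ic := arccos_mem_Ioo (neg_one_lt_cosLaw_lt_one sA sB (hG2 ▸ hG))
    exact Real.cos_pos_of_mem_Ioo ⟨by linarith, by linarith⟩
  have s1 := sin_half_add_mul_cos_half hA hA1 hB hB1 hC hC1 hG
  have s2 := sin_half_add_mul_cos_half hA' hA1' hB' hB1' hC hC1 hG'
  have c1 := cos_half_add_mul_cos_half hA hA1 hB hB1 hC hC1 hG
  have c2 := cos_half_add_mul_cos_half hA' hA1' hB' hB1' hC hC1 hG'
  obtain ⟨ia, ib, ic⟩ := key hA hA1 hB hB1 hG
  obtain ⟨ia', ib', ic'⟩ := key hA' hA1' hB' hB1' hG'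
  set a := Real.arccos (cosLaw A B C)
  set b := Real.arccos (cosLaw B A C)
  set a' := Real.arccos (cosLaw A' B' C)
  set b' := Real.arccos (cosLaw B' A' C)
  set d := Real.cos (Real.arccos (cosLaw C A B) / 2)
  set d' := Real.cos (Real.arccos (cosLaw C A' B') / 2)
  -- This regroups the sides: the pairs belonging to one triangle are traded for the pairs `a, a'`
  -- and `b, b'`, about which something is assumed.
  have e : Real.cos ((a - b) / 2) * Real.cos ((a' + b') / 2) +
      Real.cos ((a + b) / 2) * Real.cos ((a' - b') / 2) =
      Real.cos ((a + a') / 2) * Real.cos ((b - b') / 2) +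
      Real.cos ((b + b') / 2) * Real.cos ((a - a') / 2) := by
    simp only [add_div, sub_div, Real.cos_add, Real.cos_sub]
    ring
  have pC : 0 < Real.cos (C / 2) := Real.cos_pos_of_mem_Ioo ⟨by linarith, by linarith⟩
  have pS : 0 < Real.sin (C / 2) := Real.sin_pos_of_pos_of_lt_pi (by linarith) (by linarith)
  have n1 : Real.cos ((a + a') / 2) < 0 :=
    Real.cos_neg_of_pi_div_two_lt_of_lt (by linarith) (by linarith)
  have n2 : Real.cos ((b + b') / 2) < 0 :=
    Real.cos_neg_of_pi_div_two_lt_of_lt (by linarith) (by linarith)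
  have n3 : 0 < Real.cos ((b - b') / 2) := Real.cos_pos_of_mem_Ioo ⟨by linarith, by linarith⟩
  have n4 : 0 < Real.cos ((a - a') / 2) := Real.cos_pos_of_mem_Ioo ⟨by linarith, by linarith⟩
  -- The sine of half the angle sum, expanded by the addition formula and the four analogies, is
  -- negative. The half sum is positive, so it has to exceed `π`.
  have hs : Real.sin ((A + B + A' + B') / 2) * (d * d') < 0 := by
    have : Real.sin ((A + B + A' + B') / 2) * (d * d') =
        (Real.cos (C / 2) * Real.sin (C / 2)) * (Real.cos ((a + a') / 2) * Real.cos ((b - b') / 2) +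
      Real.cos ((b + b') / 2) * Real.cos ((a - a') / 2)) := by
      rw [← e, show (A + B + A' + B') / 2 = (A + B) / 2 + (A' + B') / 2 by ring, Real.sin_add]
      linear_combination s1 * (Real.cos ((A' + B') / 2) * d') +
        (Real.cos ((a - b) / 2) * Real.cos (C / 2)) * c2 + c1 * (Real.sin ((A' + B') / 2) * d') +
        (Real.cos ((a + b) / 2) * Real.sin (C / 2)) * s2
    rw [this]
    have := mul_neg_of_neg_of_pos n1 n3
    have := mul_neg_of_neg_of_pos n2 n4
    exact mul_neg_of_pos_of_neg (by positivity) (by linarith)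
  by_contra hcon
  have : 0 ≤ Real.sin ((A + B + A' + B') / 2) :=
    Real.sin_nonneg_of_nonneg_of_le_pi (by linarith) (by linarith)
  have := mul_nonneg this (mul_pos ic ic').le
  linarith

/-! ### Angle structures on a tetrahedron -/

theorem nodup_swap_fst {i j k l : Fin 4} (h : [i, j, k, l].Nodup) : [j, i, k, l].Nodup :=
  (List.Perm.swap j i [k, l]).nodup h

theorem nodup_swap_mid {i j k l : Fin 4} (h : [i, j, k, l].Nodup) : [i, k, j, l].Nodup :=
  ((List.Perm.swap k j [l]).cons i).nodup h

theorem nodup_swap_last {i j k l : Fin 4} (h : [i, j, k, l].Nodup) : [i, j, l, k].Nodup :=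
  (((List.Perm.swap l k []).cons j).cons i).nodup h

theorem thirdVertex_fourthVertex_eq : ∀ i j k l : Fin 4, [i, j, k, l].Nodup →
    (thirdVertex i j = k ∧ fourthVertex i j = l) ∨
      (thirdVertex i j = l ∧ fourthVertex i j = k) := by
  decide

namespace AngleStructures3

variable {x : Fin 4 → Fin 4 → ℝ}

theorem ne_of_nodup {i j k l : Fin 4} (h : [i, j, k, l].Nodup) : i ≠ j := by
  rintro rfl
  simp at h

theorem sin_pos (hx : x ∈ AngleStructures3) {i j : Fin 4} (h : i ≠ j) : 0 < Real.sin (x i j) :=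
  Real.sin_pos_of_pos_of_lt_pi (hx.2.2.1 i j h).1 (hx.2.2.1 i j h).2

theorem vertexGram_pos (hx : x ∈ AngleStructures3) {i j k l : Fin 4} (h : [i, j, k, l].Nodup) :
    0 < vertexGram (x i j) (x i k) (x i l) := by
  have h2 := nodup_swap_last h
  have h3 := nodup_swap_last (nodup_swap_mid h)
  obtain ⟨p1, p2⟩ := hx.2.2.1 i j (ne_of_nodup h)
  have q1 := hx.2.2.2 _ _ _ _ h
  have q2 := hx.2.2.2 _ _ _ _ h2
  have q3 := hx.2.2.2 _ _ _ _ h3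
  exact _root_.vertexGram_pos p1 p2 q1.1 q1.2 q2.2 q3.2

theorem faceAngle_swap (i j k l : Fin 4) :
    faceAngle x i j k l = faceAngle x i k j l := by
  simp only [faceAngle, cosLaw]
  congr 2 <;> ring

theorem faceAngle_mem (hx : x ∈ AngleStructures3) {i j k l : Fin 4} (h : [i, j, k, l].Nodup) :
    (0 < faceAngle x i j k l ∧ faceAngle x i j k l < Real.pi) ∧
    Real.cos (faceAngle x i j k l) =
      (Real.cos (x i l) + Real.cos (x i j) * Real.cos (x i k)) /
        (Real.sin (x i j) * Real.sin (x i k)) ∧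
    Real.sin (faceAngle x i j k l) =
      √(vertexGram (x i j) (x i k) (x i l)) / (Real.sin (x i j) * Real.sin (x i k)) := by
  have s1 := sin_pos hx (ne_of_nodup h)
  have s2 := sin_pos hx (ne_of_nodup (nodup_swap_mid h))
  have g := vertexGram_pos hx (nodup_swap_mid (nodup_swap_last h))
  refine ⟨arccos_mem_Ioo (neg_one_lt_cosLaw_lt_one s1 s2 g), cos_arccos_cosLaw s1 s2 g, ?_⟩
  rw [faceAngle, sin_arccos_cosLaw s1 s2, _root_.vertexGram_swap', _root_.vertexGram_swap]

/-- The argument of `extArccos` in the length of the edge `ij`. -/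
def edgeCos (x : Fin 4 → Fin 4 → ℝ) (i j k l : Fin 4) : ℝ :=
  edgeCofactor (x i j) (x k l) (x i k) (x j l) (x i l) (x j k) /
    √(vertexGram (x i j) (x i k) (x i l) * vertexGram (x i j) (x j k) (x j l))

theorem edgeCos_swap_last (x : Fin 4 → Fin 4 → ℝ) (hx : x ∈ AngleStructures3) (i j k l : Fin 4) :
    edgeCos x i j l k = edgeCos x i j k l := by
  rw [edgeCos, edgeCos, edgeCofactor_swap, vertexGram_swap, vertexGram_swap (x i j) (x j l),
    hx.2.1 l k]

theorem edgeCos_swap_fst (x : Fin 4 → Fin 4 → ℝ) (hx : x ∈ AngleStructures3) (i j k l : Fin 4) :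
    edgeCos x j i k l = edgeCos x i j k l := by
  rw [edgeCos, edgeCos, edgeCofactor_swap', vertexGram_swap (x i j) (x j k), hx.2.1 j i,
    vertexGram_swap (x i j) (x j l), mul_comm (vertexGram _ _ _), edgeCofactor_swap]

/-- Inserting the cosine law of the vertex links into that of the face leaves a cofactor over the
root of two principal minors. This does not change under swapping `k` and `l` (`edgeCos_swap_last`),
so both faces at an edge give it the same length. -/
theorem cosLaw_faceAngle (hx : x ∈ AngleStructures3) {i j k l : Fin 4} (h : [i, j, k, l].Nodup) :
    cosLaw (faceAngle x k i j l) (faceAngle x i j k l) (faceAngle x j i k l) =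
      edgeCos x i j k l := by
  have hji := nodup_swap_fst h
  have hki : [k, i, j, l].Nodup := nodup_swap_fst (nodup_swap_mid h)
  have g1 := vertexGram_pos hx h
  have g2 := vertexGram_pos hx hji
  have s1 := sin_pos hx (ne_of_nodup h)
  have s2 := sin_pos hx (ne_of_nodup (nodup_swap_mid h))
  have s3 := sin_pos hx (ne_of_nodup (nodup_swap_mid hji))
  obtain ⟨-, c1, e1⟩ := faceAngle_mem hx h
  obtain ⟨-, c2, e2⟩ := faceAngle_mem hx hji
  obtain ⟨-, c3, -⟩ := faceAngle_mem hx hki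
  rw [cosLaw, c1, c2, c3, e1, e2, edgeCos, edgeCofactor]
  rw [hx.2.1 j i] at g2 ⊢
  rw [hx.2.1 k i, hx.2.1 k j, Real.sqrt_mul g1.le]
  have r1 := Real.sqrt_pos.2 g1
  have r2 := Real.sqrt_pos.2 g2
  field_simp

theorem edgeLength_eq (hx : x ∈ AngleStructures3) {i j k l : Fin 4} (h : [i, j, k, l].Nodup) :
    edgeLength x i j = extArccos (edgeCos x i j k l) := by
  have h' := nodup_thirdVertex_fourthVertex i j (ne_of_nodup h)
  rw [edgeLength]
  simp only [moebiusLength]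
  rw [cosLaw_faceAngle hx h']
  rcases thirdVertex_fourthVertex_eq i j k l h with ⟨e1, e2⟩ | ⟨e1, e2⟩ <;> rw [e1, e2]
  rw [edgeCos_swap_last x hx]

theorem pi_le_edgeLength_iff (hx : x ∈ AngleStructures3) {i j k l : Fin 4}
    (h : [i, j, k, l].Nodup) : Real.pi ≤ edgeLength x i j ↔ edgeCos x i j k l ≤ -1 := by
  rw [edgeLength_eq hx h, pi_le_extArccos_iff]

theorem edgeLength_swap (hx : x ∈ AngleStructures3) {i j : Fin 4} (h : i ≠ j) :
    edgeLength x j i = edgeLength x i j := by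
  have h' := nodup_thirdVertex_fourthVertex i j h
  rw [edgeLength_eq hx h', edgeLength_eq hx (nodup_swap_fst h'), edgeCos_swap_fst x hx]

/-- In the face `ijk`, if the edges `ik` and `jk` have length at least `π`, then the inner angles at
`i` and `j` have a sum larger than `π`. -/
theorem pi_lt_faceAngle_add (hx : x ∈ AngleStructures3) {i j k l : Fin 4}
    (h : [i, j, k, l].Nodup) (h1 : Real.pi ≤ edgeLength x i k) (h2 : Real.pi ≤ edgeLength x j k) :
    Real.pi < faceAngle x i j k l + faceAngle x j i k l := by
  have hji := nodup_swap_fst h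
  have hki : [k, i, j, l].Nodup := nodup_swap_fst (nodup_swap_mid h)
  rw [pi_le_edgeLength_iff hx (nodup_swap_mid h), ← cosLaw_faceAngle hx (nodup_swap_mid h)] at h1
  rw [pi_le_edgeLength_iff hx (nodup_swap_mid hji),
    ← cosLaw_faceAngle hx (nodup_swap_mid hji)] at h2
  obtain ⟨⟨a1, a2⟩, -⟩ := faceAngle_mem hx h
  obtain ⟨⟨b1, b2⟩, -⟩ := faceAngle_mem hx hji
  obtain ⟨⟨c1, c2⟩, -⟩ := faceAngle_mem hx hki
  refine pi_lt_add_of_cosLaw_le a1 a2 b1 b2 c1 c2 ?_ ?_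
  · rwa [faceAngle_swap i k j l] at h1
  · rwa [faceAngle_swap j k i l, faceAngle_swap k j i l] at h2

/-- The sum of the dihedral angles at the vertices of a quadrilateral whose vertices lie on edges of
length at least `π`. -/
theorem two_pi_lt_quad (hx : x ∈ AngleStructures3) {i j k l : Fin 4} (h : [i, j, k, l].Nodup)
    (hik : Real.pi ≤ edgeLength x i k) (hil : Real.pi ≤ edgeLength x i l)
    (hjk : Real.pi ≤ edgeLength x j k) (hjl : Real.pi ≤ edgeLength x j l) :
    2 * Real.pi < x i k + x i l + x j k + x j l := by
  have hji := nodup_swap_fst h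
  have h1 := pi_lt_faceAngle_add hx h hik hjk
  have h2 := pi_lt_faceAngle_add hx (nodup_swap_last h) hil hjl
  obtain ⟨p1, p2⟩ := hx.2.2.1 i j (ne_of_nodup h)
  obtain ⟨q1, q2⟩ := hx.2.2.1 i k (ne_of_nodup (nodup_swap_mid h))
  obtain ⟨r1, r2⟩ := hx.2.2.1 i l (ne_of_nodup (nodup_swap_mid (nodup_swap_last h)))
  obtain ⟨q1', q2'⟩ := hx.2.2.1 j k (ne_of_nodup (nodup_swap_mid hji))
  obtain ⟨r1', r2'⟩ := hx.2.2.1 j l (ne_of_nodup (nodup_swap_mid (nodup_swap_last hji)))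
  have g1 := vertexGram_pos hx (nodup_swap_last (nodup_swap_mid h))
  have g2 := vertexGram_pos hx (nodup_swap_last (nodup_swap_mid hji))
  rw [hx.2.1 j i] at g2
  simp only [faceAngle, hx.2.1 j i] at h1 h2
  have e : ∀ a b c, cosLaw a b c = cosLaw a c b := fun a b c => by
    simp only [cosLaw]; congr 1 <;> ring
  -- The links of `i` and `j` share the angle `x i j`. In them, the sides opposite to `x i k` and `x
  -- j k` are the angles of the face `ijl`, and those opposite to `x i l` and `x j l` are the angles
  -- of the face `ijk`.
  refine two_pi_lt_add_of_pi_lt_add q1 q2 r1 r2 q1' q2' r1' r2' p1 p2 g1 g2 ?_ ?_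
  · rwa [e (x i k), e (x j k)]
  · rwa [e (x i l), e (x j l)]

end AngleStructures3

end

noncomputable section

/-! ### The set of long edges is a cut -/

/-- The determinant of the Gram matrix of the outward normals of the faces. -/
def gramDet (x : Fin 4 → Fin 4 → ℝ) : ℝ :=
  gramPoly (x 0 1) (x 2 3) (x 0 2) (x 1 3) (x 0 3) (x 1 2)

namespace AngleStructures3

variable {x : Fin 4 → Fin 4 → ℝ}

theorem gramPoly_eq_gramDet (hx : x ∈ AngleStructures3) :
    ∀ i j k l : Fin 4, [i, j, k, l].Nodup →
      gramPoly (x i j) (x k l) (x i k) (x j l) (x i l) (x j k) = gramDet x := by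
  have h10 := hx.2.1 1 0
  have h20 := hx.2.1 2 0
  have h30 := hx.2.1 3 0
  have h21 := hx.2.1 2 1
  have h31 := hx.2.1 3 1
  have h32 := hx.2.1 3 2
  intro i j k l h
  fin_cases i <;> fin_cases j <;> try (exfalso; revert h; decide)
  all_goals fin_cases k <;> fin_cases l <;> first
    | (exfalso; revert h; decide)
    | (simp only [gramDet, gramPoly, Fin.mk_zero, Fin.mk_one, Fin.reduceFinMk,
        h10, h20, h30, h21, h31, h32] <;> ring)

theorem edgeCofactor_sq_add (hx : x ∈ AngleStructures3) {i j k l : Fin 4}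
    (h : [i, j, k, l].Nodup) :
    edgeCofactor (x i j) (x k l) (x i k) (x j l) (x i l) (x j k) ^ 2 +
      gramDet x * Real.sin (x i j) ^ 2 =
    vertexGram (x i j) (x i k) (x i l) * vertexGram (x i j) (x j k) (x j l) := by
  rw [← gramPoly_eq_gramDet hx i j k l h, edgeCofactor_sq]

theorem vertexGram_mul_pos (hx : x ∈ AngleStructures3) {i j k l : Fin 4}
    (h : [i, j, k, l].Nodup) :
    0 < vertexGram (x i j) (x i k) (x i l) * vertexGram (x i j) (x j k) (x j l) := by
  have g2 := vertexGram_pos hx (nodup_swap_fst h)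
  rw [hx.2.1 j i] at g2
  exact mul_pos (vertexGram_pos hx h) g2

/-- Normalised form of `edgeCofactor_sq`: the sign of `gramDet x` alone decides, for all six edges
at once, whether `|edgeCos|` is below, equal to or above `1`. -/
theorem one_sub_edgeCos_sq (hx : x ∈ AngleStructures3) {i j k l : Fin 4}
    (h : [i, j, k, l].Nodup) :
    1 - edgeCos x i j k l ^ 2 = gramDet x * Real.sin (x i j) ^ 2 /
      (vertexGram (x i j) (x i k) (x i l) * vertexGram (x i j) (x j k) (x j l)) := by
  have g := vertexGram_mul_pos hx h
  rw [edgeCos, div_pow, Real.sq_sqrt g.le, eq_div_iff g.ne', sub_mul, div_mul_cancel₀ _ g.ne',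
    ← edgeCofactor_sq_add hx h]
  ring

theorem not_pi_le_edgeLength (hx : x ∈ AngleStructures3) (hD : 0 < gramDet x) {i j : Fin 4}
    (hij : i ≠ j) : ¬ Real.pi ≤ edgeLength x i j := by
  have h := nodup_thirdVertex_fourthVertex i j hij
  rw [pi_le_edgeLength_iff hx h]
  intro hc
  have h1 := one_sub_edgeCos_sq hx h
  have h2 : 0 < 1 - edgeCos x i j (thirdVertex i j) (fourthVertex i j) ^ 2 := by
    rw [h1]
    have := sin_pos hx hij
    have := vertexGram_mul_pos hx h
    positivity
  nlinarith

/-- Here `|edgeCos| ≥ 1`, so being at most `-1` only depends on the sign of the numerator. -/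
theorem pi_le_edgeLength_iff_neg (hx : x ∈ AngleStructures3) (hD : gramDet x ≤ 0)
    {i j k l : Fin 4} (h : [i, j, k, l].Nodup) :
    Real.pi ≤ edgeLength x i j ↔
      edgeCofactor (x i j) (x k l) (x i k) (x j l) (x i l) (x j k) < 0 := by
  have g := vertexGram_mul_pos hx h
  have g' := Real.sqrt_pos.2 g
  have e := Real.sq_sqrt g.le
  have h1 := edgeCofactor_sq_add hx h
  rw [pi_le_edgeLength_iff hx h, edgeCos, div_le_iff₀ g']
  have h3 : gramDet x * Real.sin (x i j) ^ 2 ≤ 0 := mul_nonpos_of_nonpos_of_nonneg hD (sq_nonneg _)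
  constructor <;> intro h2
  · linarith
  · have := abs_le_of_sq_le_sq (a := -edgeCofactor (x i j) (x k l) (x i k) (x j l) (x i l) (x j k))
      (b := √(vertexGram (x i j) (x i k) (x i l) * vertexGram (x i j) (x j k) (x j l)))
    by_contra hc
    push Not at hc
    nlinarith

/-- For `gramDet x ≤ 0`, every term on the right of `edgeCofactor_mul` is nonnegative, and the
product of the vertex minors is positive. -/
theorem edgeCofactor_mul_pos (hx : x ∈ AngleStructures3) (hD : gramDet x ≤ 0)
    {i j k l : Fin 4} (h : [i, j, k, l].Nodup) :
    0 < edgeCofactor (x i j) (x k l) (x i k) (x j l) (x i l) (x j k) *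
      edgeCofactor (x i k) (x j l) (x i j) (x k l) (x i l) (x k j) *
      edgeCofactor (x j k) (x i l) (x j i) (x k l) (x j l) (x k i) := by
  have e := edgeCofactor_mul (x i j) (x k l) (x i k) (x j l) (x i l) (x j k)
  rw [gramPoly_eq_gramDet hx i j k l h] at e
  rw [hx.2.1 k j, hx.2.1 j i, hx.2.1 k i]
  have g1 := vertexGram_pos hx h
  have g2 := vertexGram_pos hx (nodup_swap_fst h)
  have g3 := vertexGram_pos hx (nodup_swap_fst (nodup_swap_mid h))
  rw [hx.2.1 j i] at g2
  rw [hx.2.1 k i, hx.2.1 k j] at g3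
  have h1 : 0 ≤ -gramDet x * (vertexGram (x i j) (x i k) (x i l) * Real.sin (x j k) ^ 2 +
      vertexGram (x i j) (x j k) (x j l) * Real.sin (x i k) ^ 2 +
      vertexGram (x i k) (x j k) (x k l) * Real.sin (x i j) ^ 2) :=
    mul_nonneg (by linarith) (by positivity)
  have h2 : 0 < vertexGram (x i j) (x i k) (x i l) * vertexGram (x i j) (x j k) (x j l) *
    vertexGram (x i k) (x j k) (x k l) := by positivity
  linarith [sq_nonneg (gramDet x)]

theorem edgeCofactor_ne_zero (hx : x ∈ AngleStructures3) (hD : gramDet x ≤ 0)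
    {i j k l : Fin 4} (h : [i, j, k, l].Nodup) :
    edgeCofactor (x i j) (x k l) (x i k) (x j l) (x i l) (x j k) ≠ 0 := fun e => by
  have := edgeCofactor_mul_pos hx hD h
  rw [e, zero_mul, zero_mul] at this
  exact this.false

/-- In a triangle, an even number of edges has length at least `π`. -/
theorem pi_le_edgeLength_triangle (hx : x ∈ AngleStructures3) {i j k l : Fin 4}
    (h : [i, j, k, l].Nodup) :
    Real.pi ≤ edgeLength x j k ↔ ¬ (Real.pi ≤ edgeLength x i j ↔ Real.pi ≤ edgeLength x i k) := by
  have hik := nodup_swap_mid h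
  have hjk := nodup_swap_mid (nodup_swap_fst h)
  rcases lt_or_ge 0 (gramDet x) with hD | hD
  · simp [not_pi_le_edgeLength hx hD (ne_of_nodup h), not_pi_le_edgeLength hx hD (ne_of_nodup hik),
      not_pi_le_edgeLength hx hD (ne_of_nodup hjk)]
  · rw [pi_le_edgeLength_iff_neg hx hD h, pi_le_edgeLength_iff_neg hx hD hik,
      pi_le_edgeLength_iff_neg hx hD hjk]
    have p := edgeCofactor_mul_pos hx hD h
    generalize edgeCofactor (x i j) (x k l) (x i k) (x j l) (x i l) (x j k) = a at *
    generalize edgeCofactor (x i k) (x j l) (x i j) (x k l) (x i l) (x k j) = b at *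
    generalize edgeCofactor (x j k) (x i l) (x j i) (x k l) (x j l) (x k i) = c at *
    have hab : a * b ≠ 0 := fun e => by simp [e] at p
    rcases lt_or_gt_of_ne (left_ne_zero_of_mul hab) with ha | ha <;>
      rcases lt_or_gt_of_ne (right_ne_zero_of_mul hab) with hb | hb
    · have := pos_of_mul_pos_right p (mul_pos_of_neg_of_neg ha hb).le
      simp [ha, hb, this.le]
    · have := neg_of_mul_pos_right p (mul_neg_of_neg_of_pos ha hb).le
      simp [ha, hb.le, this]
    · have := neg_of_mul_pos_right p (mul_neg_of_pos_of_neg ha hb).le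
      simp [ha.le, hb, this]
    · have := pos_of_mul_pos_right p (mul_pos ha hb).le
      simp [not_lt.2 ha.le, not_lt.2 hb.le, not_lt.2 this.le]

open Classical in
/-- The vertices that are separated from the vertex `0` by the long edges. -/
def cutSet (x : Fin 4 → Fin 4 → ℝ) : Finset (Fin 4) :=
  Finset.univ.filter fun j => j ≠ 0 ∧ Real.pi ≤ edgeLength x 0 j

theorem zero_notMem_cutSet (x : Fin 4 → Fin 4 → ℝ) : (0 : Fin 4) ∉ cutSet x := by
  simp [cutSet]

theorem exists_fourth : ∀ i j k : Fin 4, i ≠ j → i ≠ k → j ≠ k → ∃ l, [i, j, k, l].Nodup := by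
  decide

theorem pi_le_edgeLength_iff_cutSet (hx : x ∈ AngleStructures3) {i j : Fin 4} (hij : i ≠ j) :
    Real.pi ≤ edgeLength x i j ↔ ¬ (i ∈ cutSet x ↔ j ∈ cutSet x) := by
  by_cases hi : i = 0
  · subst hi
    simp [cutSet, hij.symm]
  by_cases hj : j = 0
  · subst hj
    simp [cutSet, hij, edgeLength_swap hx hij]
  -- An edge away from the vertex `0` is compared with the other two edges of the face `0ij` by
  -- parity.
  obtain ⟨l, h⟩ := exists_fourth 0 i j (Ne.symm hi) (Ne.symm hj) hij
  rw [pi_le_edgeLength_triangle hx h]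
  simp [cutSet, hi, hj]

end AngleStructures3

end

noncomputable section

/-! ### Classical tetrahedra -/

theorem exists_pos_mul_sq_eq_one {Q : ℝ} (hQ : 0 < Q) : ∃ c, 0 < c ∧ c ^ 2 * Q = 1 := by
  refine ⟨(√Q)⁻¹, inv_pos.2 (Real.sqrt_pos.2 hQ), ?_⟩
  rw [inv_pow, Real.sq_sqrt hQ.le, inv_mul_cancel₀ hQ.ne']

namespace AngleStructures3

variable {x : Fin 4 → Fin 4 → ℝ}

/-- The normals are obtained from a Cholesky decomposition of the Gram matrix. -/
theorem isGeometricTetrahedron (hx : x ∈ AngleStructures3) {κ d : ℝ} (hd : d < 0)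
    (hD : κ * d ^ 2 * vertexGram (x 0 3) (x 1 3) (x 2 3) = gramDet x)
    (hpos : κ ≤ 0 → 0 < edgeCofactor (x 0 3) (x 1 2) (x 0 1) (x 2 3) (x 0 2) (x 1 3) ∧
      0 < edgeCofactor (x 1 3) (x 0 2) (x 0 1) (x 2 3) (x 1 2) (x 0 3) ∧
      0 < edgeCofactor (x 2 3) (x 0 1) (x 0 2) (x 1 3) (x 1 2) (x 0 3)) :
    IsGeometricTetrahedron κ x := by
  have h10 := hx.2.1 1 0
  have h20 := hx.2.1 2 0
  have h30 := hx.2.1 3 0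
  have h21 := hx.2.1 2 1
  have h31 := hx.2.1 3 1
  have h32 := hx.2.1 3 2
  have G0 := vertexGram_pos hx (show [(0 : Fin 4), 1, 2, 3].Nodup by decide)
  have G1 := vertexGram_pos hx (show [(1 : Fin 4), 0, 2, 3].Nodup by decide)
  have G2 := vertexGram_pos hx (show [(2 : Fin 4), 0, 1, 3].Nodup by decide)
  have G3 := vertexGram_pos hx (show [(3 : Fin 4), 0, 1, 2].Nodup by decide)
  obtain ⟨q, hq, hq1⟩ : ∃ q, 0 < q ∧ q ^ 2 + Real.cos (x 2 3) ^ 2 = 1 :=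
    ⟨_, sin_pos hx (show (2 : Fin 4) ≠ 3 by decide), Real.sin_sq_add_cos_sq (x 2 3)⟩
  simp only [h10, h20, h30, h21, h31, h32, vertexGram, gramDet, gramPoly, edgeCofactor,
    Real.sin_sq] at G0 G1 G2 G3 hD hpos
  obtain ⟨s, hs⟩ : ∃ s, q * s = -Real.cos (x 0 3) - Real.cos (x 2 3) * Real.cos (x 1 3) :=
    ⟨(-Real.cos (x 0 3) - Real.cos (x 2 3) * Real.cos (x 1 3)) / q, by field_simp⟩
  -- Multiplied by `q ^ 2`, this is the Gram determinant of the three faces that meet at the vertex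
  -- `3`.
  have ht' : 0 < 1 - Real.cos (x 1 3) ^ 2 - s ^ 2 := by
    have : 0 < q ^ 2 * (1 - Real.cos (x 1 3) ^ 2 - s ^ 2) := by
      convert G3 using 1
      grind
    exact pos_of_mul_pos_right this (sq_nonneg q)
  obtain ⟨t, ht, ht1⟩ : ∃ t, 0 < t ∧ t ^ 2 = 1 - Real.cos (x 1 3) ^ 2 - s ^ 2 :=
    ⟨_, Real.sqrt_pos.2 ht', Real.sq_sqrt ht'.le⟩
  obtain ⟨v, hv⟩ : ∃ v, q * v = -Real.cos (x 0 2) - Real.cos (x 2 3) * Real.cos (x 1 2) :=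
    ⟨(-Real.cos (x 0 2) - Real.cos (x 2 3) * Real.cos (x 1 2)) / q, by field_simp⟩
  obtain ⟨w, hw⟩ : ∃ w, t * w = -Real.cos (x 0 1) - Real.cos (x 1 3) * Real.cos (x 1 2) - s * v :=
    ⟨(-Real.cos (x 0 1) - Real.cos (x 1 3) * Real.cos (x 1 2) - s * v) / t, by field_simp⟩
  clear ht'
  have c01 : Real.cos (x 0 1) = -(Real.cos (x 1 3) * Real.cos (x 1 2)) - s * v - t * w := by
    linarith
  have c02 : Real.cos (x 0 2) = -(Real.cos (x 2 3) * Real.cos (x 1 2)) - q * v := by linarith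
  have c03 : Real.cos (x 0 3) = -(Real.cos (x 2 3) * Real.cos (x 1 3)) - q * s := by linarith
  clear hs hv hw
  obtain ⟨P, hP⟩ : ∃ P, Real.cos (x 2 3) = P := ⟨_, rfl⟩
  obtain ⟨R, hR⟩ : ∃ R, Real.cos (x 1 3) = R := ⟨_, rfl⟩
  obtain ⟨U, hU⟩ : ∃ U, Real.cos (x 1 2) = U := ⟨_, rfl⟩
  rw [hR, hU] at c01
  rw [hP, hU] at c02
  rw [hP, hR] at c03
  rw [c01, c02, c03, hP, hR, hU] at hpos
  rw [c01, c02, c03, hP, hR, hU] at hD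
  rw [c01, c02, c03] at G0
  rw [c01, hU, hR] at G1
  rw [c02, hU, hP] at G2
  rw [hP] at hq1
  rw [hR] at ht1
  clear G3
  -- The full Gram determinant is the minor `q ^ 2 * t ^ 2` times `1 - U ^ 2 - v ^ 2 - w ^ 2`. So
  -- `d` is the coordinate that makes the last normal a unit vector.
  have hκ : κ * d ^ 2 = 1 - U ^ 2 - v ^ 2 - w ^ 2 := by
    have h : (κ * d ^ 2 - (1 - U ^ 2 - v ^ 2 - w ^ 2)) * (q ^ 2 * t ^ 2) = 0 := by
      grind
    rcases mul_eq_zero.1 h with h | h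
    · linarith
    · have : 0 < q ^ 2 * t ^ 2 := by positivity
      linarith
  clear hD
  -- `Q2`, `Q1` and `Q0` are the square norms of the unscaled vertices; up to a positive factor they
  -- are the Gram determinants at these vertices.
  have Q2 : 0 < w ^ 2 + κ * d ^ 2 := by
    have : 0 < q ^ 2 * (w ^ 2 + κ * d ^ 2) := by
      convert G2 using 1
      grind
    exact pos_of_mul_pos_right this (sq_nonneg q)
  have Q1 : 0 < (w * s - v * t) ^ 2 + κ * d ^ 2 * (t ^ 2 + s ^ 2) := by
    convert G1 using 1
    grind
  have Q0 : 0 < (U * q * t - v * P * t - w * (R * q - s * P)) ^ 2 +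
      κ * d ^ 2 * ((q * t) ^ 2 + (P * t) ^ 2 + (R * q - s * P) ^ 2) := by
    convert G0 using 1
    grind
  -- Up to positive factors, the first coordinates of the vertices `0`, `1`, `2` are the cofactors
  -- of the edges that join them to the vertex `3`.
  have hpos' : κ ≤ 0 → 0 < U * q * t - v * P * t - w * (R * q - s * P) ∧
      0 < w * s - v * t ∧ 0 < -w := by
    intro h
    obtain ⟨p0, p1, p2⟩ := hpos h
    refine ⟨pos_of_mul_pos_right (a := q * t) ?_ (by positivity),
      pos_of_mul_pos_right (a := q * t) ?_ (by positivity),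
      pos_of_mul_pos_right (a := q ^ 2 * t) ?_ (by positivity)⟩
    · exact p0.trans_eq (by grind)
    · exact p1.trans_eq (by grind)
    · exact p2.trans_eq (by grind)
  obtain ⟨l0, l0p, l0Q⟩ := exists_pos_mul_sq_eq_one Q0
  obtain ⟨l1, l1p, l1Q⟩ := exists_pos_mul_sq_eq_one Q1
  obtain ⟨l2, l2p, l2Q⟩ := exists_pos_mul_sq_eq_one Q2
  -- Each vertex spans the line annihilated by the three normals of the faces through it; `l0`,
  -- `l1`, `l2` normalise it. The vertex `3` is the base point of the model.
  refine ⟨hx, ![![l0 * (U * q * t - v * P * t - w * (R * q - s * P)), l0 * (q * t * d),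
    l0 * (P * t * d), l0 * ((R * q - s * P) * d)], ![l1 * (w * s - v * t), 0, l1 * (t * d),
    -l1 * (s * d)], ![-l2 * w, 0, 0, l2 * d], ![1, 0, 0, 0]],
    ![![0, 1, 0, 0], ![0, -P, q, 0], ![0, -R, s, t], ![d, -U, v, w]], ?_, ?_, ?_, ?_, ?_⟩
  · intro i
    fin_cases i <;> simp [spaceForm]
    · exact ⟨by rw [← l0Q]; ring, fun h => mul_pos l0p (hpos' h).1⟩
    · exact ⟨by rw [← l1Q]; ring, fun h => mul_pos l1p (hpos' h).2.1⟩
    · exact ⟨by rw [← l2Q]; ring, fun h => by have := mul_pos l2p (hpos' h).2.2; linarith⟩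
  · intro k
    fin_cases k <;> simp [normalForm] <;> grind
  · intro i k h
    fin_cases i <;> fin_cases k <;> simp [dotProduct, Fin.sum_univ_four] at h ⊢ <;> ring
  · intro k
    fin_cases k <;> simp [dotProduct, Fin.sum_univ_four]
    · have : 0 < l0 * (q * t) * -d := by have := neg_pos.2 hd; positivity
      linarith
    · have : 0 < l1 * (q * t) * -d := by have := neg_pos.2 hd; positivity
      linarith
    · have : 0 < l2 * t * -d := by have := neg_pos.2 hd; positivity
      linarith
    · exact hd
  · intro i j k l h
    fin_cases i <;> fin_cases j <;> try (exfalso; revert h; decide)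
    all_goals fin_cases k <;> fin_cases l <;> first
      | (exfalso; revert h; decide)
      | (simp [normalForm, h10, h20, h30, h21, h31, h32, c01, c02, c03, hP, hR, hU]
         try ring)

/-- A non-classical tetrahedron has an edge of length at least `π`. -/
theorem cutSet_nonempty_of_not_isClassical (hx : x ∈ AngleStructures3)
    (h : ¬ IsClassicalTetrahedron x) : (cutSet x).Nonempty := by
  by_contra hne
  rw [Finset.not_nonempty_iff_eq_empty] at hne
  have hlt : ∀ {i j : Fin 4}, i ≠ j → ¬ Real.pi ≤ edgeLength x i j := fun hij => by
    rw [pi_le_edgeLength_iff_cutSet hx hij, hne]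
    simp
  have G3 := vertexGram_pos hx (show [(3 : Fin 4), 0, 1, 2].Nodup by decide)
  rw [hx.2.1 3 0, hx.2.1 3 1, hx.2.1 3 2] at G3
  have hpos : gramDet x ≤ 0 → ∀ i j k l : Fin 4, [i, j, k, l].Nodup →
      0 < edgeCofactor (x i j) (x k l) (x i k) (x j l) (x i l) (x j k) := fun hD i j k l hn => by
    have h1 := hlt (ne_of_nodup hn)
    rw [pi_le_edgeLength_iff_neg hx hD hn, not_lt] at h1
    exact lt_of_le_of_ne h1 (edgeCofactor_ne_zero hx hD hn).symm
  have hpos' : gramDet x ≤ 0 →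
      0 < edgeCofactor (x 0 3) (x 1 2) (x 0 1) (x 2 3) (x 0 2) (x 1 3) ∧
      0 < edgeCofactor (x 1 3) (x 0 2) (x 0 1) (x 2 3) (x 1 2) (x 0 3) ∧
      0 < edgeCofactor (x 2 3) (x 0 1) (x 0 2) (x 1 3) (x 1 2) (x 0 3) := fun hD => by
    have h0 := hpos hD 0 3 1 2 (by decide)
    have h1 := hpos hD 1 3 0 2 (by decide)
    have h2 := hpos hD 2 3 0 1 (by decide)
    rw [hx.2.1 3 2, hx.2.1 3 1] at h0
    rw [hx.2.1 3 2, hx.2.1 3 0, hx.2.1 1 0] at h1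
    rw [hx.2.1 3 1, hx.2.1 3 0, hx.2.1 2 0, hx.2.1 2 1] at h2
    exact ⟨h0, h1, h2⟩
  refine h ?_
  -- The curvature is the sign of the determinant. For curvature zero, `d` is a free scale, and `-1`
  -- is as good as any negative number.
  rcases lt_trichotomy (gramDet x) 0 with hD | hD | hD
  · have hd : 0 < √(-gramDet x / vertexGram (x 0 3) (x 1 3) (x 2 3)) :=
      Real.sqrt_pos.2 (div_pos (by linarith) G3)
    refine Or.inr (Or.inr (isGeometricTetrahedron hx (neg_lt_zero.2 hd) ?_ fun _ => hpos' hD.le))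
    rw [neg_sq, Real.sq_sqrt (div_pos (by linarith) G3).le]
    field_simp
  · exact Or.inr (Or.inl (isGeometricTetrahedron hx (neg_lt_zero.2 one_pos) (by simp [hD])
      fun _ => hpos' hD.le))
  · have hd : 0 < √(gramDet x / vertexGram (x 0 3) (x 1 3) (x 2 3)) :=
      Real.sqrt_pos.2 (div_pos hD G3)
    refine Or.inl (isGeometricTetrahedron hx (neg_lt_zero.2 hd) ?_ fun h => by norm_num at h)
    rw [neg_sq, Real.sq_sqrt (div_pos hD G3).le]
    field_simp

end AngleStructures3

end

noncomputable section

namespace AngleStructures3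

variable {x : Fin 4 → Fin 4 → ℝ}

/-! ### The angles of a normal disk -/

/-- The edge `e` of the 3-simplex has its end points on different sides of the partition defined by
the set `A` of vertices. -/
def IsCutEdge (A : Finset (Fin 4)) (e : TetEdge) : Prop := ¬ (e.1.1 ∈ A ↔ e.1.2 ∈ A)

/-- The face opposite to `f` has vertices on both sides of the partition. -/
def IsCutFace (A : Finset (Fin 4)) (f : Fin 4) : Prop :=
  ∃ i j, i ≠ f ∧ j ≠ f ∧ i ∈ A ∧ j ∉ A

instance (A : Finset (Fin 4)) : DecidablePred (IsCutEdge A) := fun _ =>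
  inferInstanceAs (Decidable (¬ _))

instance (A : Finset (Fin 4)) : DecidablePred (IsCutFace A) := fun f =>
  inferInstanceAs (Decidable (∃ i j, i ≠ f ∧ j ≠ f ∧ i ∈ A ∧ j ∉ A))

theorem sum_tetEdge (g : Fin 4 → Fin 4 → ℝ) :
    ∑ e : TetEdge, g e.1.1 e.1.2 = g 0 1 + g 0 2 + g 0 3 + g 1 2 + g 1 3 + g 2 3 := by
  have h : (Finset.univ : Finset TetEdge) = {⟨(0, 1), by decide⟩, ⟨(0, 2), by decide⟩,
      ⟨(0, 3), by decide⟩, ⟨(1, 2), by decide⟩, ⟨(1, 3), by decide⟩, ⟨(2, 3), by decide⟩} := by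
    decide
  rw [h]
  repeat rw [Finset.sum_insert (by decide)]
  rw [Finset.sum_singleton]
  ring


/-- The disk has one side in each cut face and one corner on each cut edge, so this says that its
angle sum exceeds that of a Euclidean polygon. Triangles are covered by the definition of
`AngleStructures3`, quadrilaterals by `two_pi_lt_quad`. -/
theorem angle_sum_of_isCut (hx : x ∈ AngleStructures3) {A : Finset (Fin 4)} (hA : A.Nonempty)
    (hA0 : 0 ∉ A)
    (hcut : ∀ i j, i ≠ j → (Real.pi ≤ edgeLength x i j ↔ ¬ (i ∈ A ↔ j ∈ A))) :
    (((Finset.univ.filter (IsCutFace A)).card : ℝ) - 2) * Real.pi <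
      ∑ e : TetEdge, if IsCutEdge A e then x e.1.1 e.1.2 else 0 := by
  have h10 := hx.2.1 1 0
  have h20 := hx.2.1 2 0
  have h30 := hx.2.1 3 0
  have h21 := hx.2.1 2 1
  have h31 := hx.2.1 3 1
  have h32 := hx.2.1 3 2
  -- Requiring `0 ∉ A` selects one side of each partition: four triangles and three quadrilaterals
  -- remain.
  have hlist : ∀ A : Finset (Fin 4), A.Nonempty → 0 ∉ A →
      (A = {1} ∨ A = {2} ∨ A = {3} ∨ A = {1, 2, 3} ∨ A = {1, 2} ∨ A = {1, 3} ∨ A = {2, 3}) := by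
    decide
  have h3 : ∀ {A : Finset (Fin 4)} (i j k l : Fin 4), [i, j, k, l].Nodup →
      (Finset.univ.filter (IsCutFace A)).card = 3 →
      (((Finset.univ.filter (IsCutFace A)).card : ℝ) - 2) * Real.pi < x i j + x i k + x i l := by
    intro A i j k l h e
    rw [e]
    have := (hx.2.2.2 i j k l h).1
    push_cast
    linarith
  have h4 : ∀ {A : Finset (Fin 4)} (i j k l : Fin 4), [i, j, k, l].Nodup →
      (∀ i j, i ≠ j → (Real.pi ≤ edgeLength x i j ↔ ¬ (i ∈ A ↔ j ∈ A))) →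
      ¬ (i ∈ A ↔ k ∈ A) → ¬ (i ∈ A ↔ l ∈ A) → ¬ (j ∈ A ↔ k ∈ A) → ¬ (j ∈ A ↔ l ∈ A) →
      (Finset.univ.filter (IsCutFace A)).card = 4 →
      (((Finset.univ.filter (IsCutFace A)).card : ℝ) - 2) * Real.pi <
        x i k + x i l + x j k + x j l := by
    intro A i j k l h hc a1 a2 a3 a4 e
    rw [e]
    have hji := nodup_swap_fst h
    have := two_pi_lt_quad hx h ((hc _ _ (ne_of_nodup (nodup_swap_mid h))).2 a1)
      ((hc _ _ (ne_of_nodup (nodup_swap_mid (nodup_swap_last h)))).2 a2)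
      ((hc _ _ (ne_of_nodup (nodup_swap_mid hji))).2 a3)
      ((hc _ _ (ne_of_nodup (nodup_swap_mid (nodup_swap_last hji)))).2 a4)
    push_cast
    linarith
  have hs := sum_tetEdge fun i j => if ¬ (i ∈ A ↔ j ∈ A) then x i j else 0
  rw [← (Finset.sum_congr rfl fun e _ => if_congr Iff.rfl rfl rfl :
    (∑ e : TetEdge, if ¬ (e.1.1 ∈ A ↔ e.1.2 ∈ A) then x e.1.1 e.1.2 else 0) =
      ∑ e : TetEdge, if IsCutEdge A e then x e.1.1 e.1.2 else 0), hs]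
  rcases hlist A hA hA0 with rfl | rfl | rfl | rfl | rfl | rfl | rfl
  · have := h3 (A := {1}) 1 0 2 3 (by decide) (by decide)
    refine this.trans_eq ?_
    simp [h10]
  · have := h3 (A := {2}) 2 0 1 3 (by decide) (by decide)
    refine this.trans_eq ?_
    simp [h20, h21]
  · have := h3 (A := {3}) 3 0 1 2 (by decide) (by decide)
    refine this.trans_eq ?_
    simp [h30, h31, h32]
  · have := h3 (A := {1, 2, 3}) 0 1 2 3 (by decide) (by decide)
    refine this.trans_eq ?_
    simp
  · have := h4 (A := {1, 2}) 0 3 1 2 (by decide) hcut (by decide) (by decide) (by decide)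
      (by decide) (by decide)
    refine this.trans_eq ?_
    simp [h31, h32]
  · have := h4 (A := {1, 3}) 0 2 1 3 (by decide) hcut (by decide) (by decide) (by decide)
      (by decide) (by decide)
    refine this.trans_eq ?_
    simp [h21]
  · have := h4 (A := {2, 3}) 0 1 2 3 (by decide) hcut (by decide) (by decide) (by decide)
      (by decide) (by decide)
    refine this.trans_eq ?_
    simp

end AngleStructures3

end

noncomputable section

/-! ### Primitives of closed 1-forms that are not differentiable along a hypersurface -/

section Primitive

open Set MeasureTheory Filter Topology

variable {E : Type*} [NormedAddCommGroup E] [NormedSpace ℝ E]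

/-- The boundary integral of a 1-form over a triangle, expressed by its exterior derivative. -/
theorem integral_segment_sub_integral_segment {θ : E → E →L[ℝ] ℝ} {B : Set E} (hBo : IsOpen B)
    (hBc : Convex ℝ B) (hθ : ContDiffOn ℝ 1 θ B) {b x w : E} (hb : b ∈ B) (hx : x ∈ B)
    (hxw : x + w ∈ B) :
    (∫ t in (0 : ℝ)..1, θ (b + t • (x + w - b)) (x + w - b)) -
        (∫ t in (0 : ℝ)..1, θ (b + t • (x - b)) (x - b)) - ∫ s in (0 : ℝ)..1, θ (x + s • w) w =
      ∫ s in (0 : ℝ)..1, ∫ t in (0 : ℝ)..1,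
        t * (fderiv ℝ θ (b + t • (x + s • w - b)) w (x + s • w - b) -
          fderiv ℝ θ (b + t • (x + s • w - b)) (x + s • w - b) w) := by
  have hxs : ∀ s ∈ Icc (0 : ℝ) 1, x + s • w ∈ B := fun s hs => by
    simpa using hBc.add_smul_sub_mem hx hxw hs
  have hH : ∀ s ∈ Icc (0 : ℝ) 1, ∀ t ∈ Icc (0 : ℝ) 1, b + t • (x + s • w - b) ∈ B :=
    fun s hs t ht => hBc.add_smul_sub_mem hb (hxs s hs) ht
  have hHm : MapsTo (fun q : ℝ × ℝ => b + q.2 • (x + q.1 • w - b)) (Icc 0 1 ×ˢ Icc 0 1) B :=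
    fun q hq => hH _ hq.1 _ hq.2
  have cH : Continuous fun q : ℝ × ℝ => b + q.2 • (x + q.1 • w - b) := by fun_prop
  have cθ : ContinuousOn (fun q : ℝ × ℝ => θ (b + q.2 • (x + q.1 • w - b)))
      (Icc 0 1 ×ˢ Icc 0 1) := hθ.continuousOn.comp cH.continuousOn hHm
  have cdθ : ContinuousOn (fun q : ℝ × ℝ => fderiv ℝ θ (b + q.2 • (x + q.1 • w - b)))
      (Icc 0 1 ×ˢ Icc 0 1) :=
    (hθ.continuousOn_fderiv_of_isOpen hBo le_rfl).comp cH.continuousOn hHm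
  have hd : ∀ y ∈ B, HasFDerivAt θ (fderiv ℝ θ y) y := fun y hy =>
    ((hθ.contDiffAt (hBo.mem_nhds hy)).differentiableAt one_ne_zero).hasFDerivAt
  -- The triangle is parametrised as a cone over the segment. `G₁` is the `s`-derivative of the
  -- integrand on the rays, `G₂` the `t`-derivative of `t * θ (…) w`; their difference is the
  -- exterior derivative of `θ` in these coordinates.
  set G₁ : ℝ → ℝ → ℝ := fun s t => t * fderiv ℝ θ (b + t • (x + s • w - b)) w (x + s • w - b) +
    θ (b + t • (x + s • w - b)) w with hG₁
  set G₂ : ℝ → ℝ → ℝ := fun s t => θ (b + t • (x + s • w - b)) w +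
    t * fderiv ℝ θ (b + t • (x + s • w - b)) (x + s • w - b) w with hG₂
  have c₁ : ContinuousOn (Function.uncurry G₁) (Icc 0 1 ×ˢ Icc 0 1) := by
    refine ContinuousOn.add (ContinuousOn.mul (by fun_prop) ?_) (cθ.clm_apply (by fun_prop))
    exact (cdθ.clm_apply continuousOn_const).clm_apply (by fun_prop)
  have c₂ : ContinuousOn (Function.uncurry G₂) (Icc 0 1 ×ˢ Icc 0 1) := by
    refine ContinuousOn.add (cθ.clm_apply (by fun_prop)) (ContinuousOn.mul (by fun_prop) ?_)
    exact (cdθ.clm_apply (by fun_prop)).clm_apply (by fun_prop)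
  have sec₁ : ∀ {G : ℝ → ℝ → ℝ}, ContinuousOn (Function.uncurry G) (Icc 0 1 ×ˢ Icc 0 1) →
      ∀ t ∈ Icc (0 : ℝ) 1, IntervalIntegrable (fun s => G s t) volume 0 1 := fun hG t ht =>
    (hG.comp (f := fun s : ℝ => (s, t)) (s := Icc 0 1) (by fun_prop)
      fun s hs => ⟨hs, ht⟩).intervalIntegrable_of_Icc zero_le_one
  have sec₂ : ∀ {G : ℝ → ℝ → ℝ}, ContinuousOn (Function.uncurry G) (Icc 0 1 ×ˢ Icc 0 1) →
      ∀ s ∈ Icc (0 : ℝ) 1, IntervalIntegrable (fun t => G s t) volume 0 1 := fun hG s hs =>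
    (hG.comp (f := fun t : ℝ => (s, t)) (s := Icc 0 1) (by fun_prop)
      fun t ht => ⟨hs, ht⟩).intervalIntegrable_of_Icc zero_le_one
  have int₂ : ∀ {G : ℝ → ℝ → ℝ}, ContinuousOn (Function.uncurry G) (Icc 0 1 ×ˢ Icc 0 1) →
      IntervalIntegrable (fun s => ∫ t in (0 : ℝ)..1, G s t) volume 0 1 := fun {G} hG => by
    have h : IntegrableOn (Function.uncurry G) (Icc 0 1 ×ˢ Icc 0 1) :=
      hG.integrableOn_compact (isCompact_Icc.prod isCompact_Icc)
    rw [intervalIntegrable_iff_integrableOn_Ioc_of_le zero_le_one]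
    have h' := h.mono_set (prod_mono Ioc_subset_Icc_self Ioc_subset_Icc_self)
    rw [IntegrableOn, Measure.volume_eq_prod, ← Measure.prod_restrict] at h'
    refine h'.integral_prod_left.congr (ae_of_all _ fun s => ?_)
    exact (intervalIntegral.integral_of_le zero_le_one).symm
  have hcont : ∀ y ∈ B, ContinuousOn (fun t : ℝ => θ (b + t • (y - b)) (y - b)) (Icc 0 1) :=
    fun y hy => (hθ.continuousOn.comp (f := fun t : ℝ => b + t • (y - b)) (s := Icc 0 1)
      (by fun_prop) fun t ht => hBc.add_smul_sub_mem hb hy ht).clm_apply continuousOn_const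
  have e₁ : ∀ t ∈ Icc (0 : ℝ) 1, θ (b + t • (x + w - b)) (x + w - b) -
      θ (b + t • (x - b)) (x - b) = ∫ s in (0 : ℝ)..1, G₁ s t := by
    intro t ht
    rw [intervalIntegral.integral_eq_sub_of_hasDerivAt
      (f := fun s : ℝ => θ (b + t • (x + s • w - b)) (x + s • w - b)) _ (sec₁ c₁ t ht)]
    · simp
    · intro s hs
      rw [uIcc_of_le zero_le_one] at hs
      have hy : HasDerivAt (fun s : ℝ => x + s • w - b) w s := by
        simpa using (((hasDerivAt_id s).smul_const w).const_add x).sub_const b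
      have h1 := (hd _ (hH s hs t ht)).comp_hasDerivAt s ((hy.const_smul t).const_add b)
      refine (h1.clm_apply hy).congr_deriv ?_
      simp [hG₁]
  have e₂ : ∀ s ∈ Icc (0 : ℝ) 1, θ (x + s • w) w = ∫ t in (0 : ℝ)..1, G₂ s t := by
    intro s hs
    rw [intervalIntegral.integral_eq_sub_of_hasDerivAt
      (f := fun t : ℝ => t * θ (b + t • (x + s • w - b)) w) _ (sec₂ c₂ s hs)]
    · simp
    · intro t ht
      rw [uIcc_of_le zero_le_one] at ht
      have hy : HasDerivAt (fun t : ℝ => b + t • (x + s • w - b)) (x + s • w - b) t := by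
        simpa using ((hasDerivAt_id t).smul_const (x + s • w - b)).const_add b
      have h1 := (hd _ (hH s hs t ht)).comp_hasDerivAt t hy
      refine ((hasDerivAt_id t).mul (h1.clm_apply (hasDerivAt_const t w))).congr_deriv ?_
      simp [hG₂]
  have hswap : ∫ t in (0 : ℝ)..1, ∫ s in (0 : ℝ)..1, G₁ s t =
      ∫ s in (0 : ℝ)..1, ∫ t in (0 : ℝ)..1, G₁ s t := by
    refine (intervalIntegral_intervalIntegral_swap ?_).symm
    simp only [uIoc_of_le zero_le_one]
    exact (c₁.integrableOn_compact (isCompact_Icc.prod isCompact_Icc)).mono_set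
      (prod_mono Ioc_subset_Icc_self Ioc_subset_Icc_self)
  rw [← intervalIntegral.integral_sub ((hcont _ hxw).intervalIntegrable_of_Icc zero_le_one)
    ((hcont _ hx).intervalIntegrable_of_Icc zero_le_one)]
  rw [intervalIntegral.integral_congr (g := fun t => ∫ s in (0 : ℝ)..1, G₁ s t)
      fun t ht => e₁ t (by rwa [uIcc_of_le zero_le_one] at ht),
    intervalIntegral.integral_congr (g := fun s => ∫ t in (0 : ℝ)..1, G₂ s t)
      fun s hs => e₂ s (by rwa [uIcc_of_le zero_le_one] at hs), hswap,
    ← intervalIntegral.integral_sub (int₂ c₁) (int₂ c₂)]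
  refine intervalIntegral.integral_congr fun s hs => ?_
  rw [uIcc_of_le zero_le_one] at hs
  rw [← intervalIntegral.integral_sub (sec₂ c₁ s hs) (sec₂ c₂ s hs)]
  refine intervalIntegral.integral_congr fun t _ => ?_
  simp only [hG₁, hG₂]
  ring

end Primitive

end

/-! ### Stokes' formula for a form cut off near a hypersurface -/

noncomputable section

section Primitive

open Set MeasureTheory Filter Topology

variable {E : Type*} [NormedAddCommGroup E] [NormedSpace ℝ E]

/-- A 1-form that vanishes where `D ≤ 0`, multiplied by a cutoff function. -/
def cutoffForm (n : ℝ) (D : E → ℝ) (η : E → E →L[ℝ] ℝ) (y : E) : E →L[ℝ] ℝ :=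
  Real.smoothTransition (n * D y - 1) • η y

theorem smoothTransition_hasDerivAt (x : ℝ) :
    HasDerivAt Real.smoothTransition (deriv Real.smoothTransition x) x :=
  ((Real.smoothTransition.contDiff (n := 1)).differentiable one_ne_zero x).hasDerivAt

theorem deriv_smoothTransition_nonneg (x : ℝ) : 0 ≤ deriv Real.smoothTransition x :=
  Real.smoothTransition.monotone.deriv_nonneg

theorem deriv_smoothTransition_eq_zero {x : ℝ} (hx : 1 < x) : deriv Real.smoothTransition x = 0 := by
  have : Real.smoothTransition =ᶠ[𝓝 x] fun _ => 1 := by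
    filter_upwards [Ioi_mem_nhds hx] with y hy using Real.smoothTransition.one_of_one_le hy.le
  rw [this.deriv_eq, deriv_const]

/-- Near a point with `D ≤ 0` the argument `n * D - 1` is negative and the form vanishes
identically, so smoothness of `η` matters only where `D > 0`. -/
theorem contDiffOn_cutoffForm {η : E → E →L[ℝ] ℝ} {D : E → ℝ} {B : Set E} (hBo : IsOpen B)
    (hD : ContDiffOn ℝ 1 D B) (h1 : ∀ x ∈ B, 0 < D x → ContDiffAt ℝ 1 η x) (n : ℝ) (hn : 0 < n) : ContDiffOn ℝ 1 (cutoffForm n D η) B := by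
  intro y hy
  refine ContDiffAt.contDiffWithinAt ?_
  have hDy := hD.contDiffAt (hBo.mem_nhds hy)
  rcases lt_or_ge 0 (D y) with h | h
  · exact ((Real.smoothTransition.contDiff.contDiffAt).comp y
      ((contDiffAt_const.mul hDy).sub contDiffAt_const)).smul (h1 y hy h)
  · have hev : cutoffForm n D η =ᶠ[𝓝 y] fun _ => 0 := by
      have hlt : n * D y - 1 < 0 := by nlinarith
      have hc : ContinuousAt (fun y => n * D y - 1) y :=
        (continuousAt_const.mul hDy.continuousAt).sub continuousAt_const
      filter_upwards [hc.eventually (Iio_mem_nhds hlt)] with v hv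
      rw [cutoffForm, Real.smoothTransition.zero_of_nonpos (le_of_lt hv), zero_smul]
    exact contDiffAt_const.congr_of_eventuallyEq hev

/-- Since `η` is closed where the cutoff does not vanish, only the derivative of the cutoff
survives, wedged with `η`. -/
theorem fderiv_cutoffForm_sub {η : E → E →L[ℝ] ℝ} {D : E → ℝ} {B : Set E} (hBo : IsOpen B)
    (hD : ContDiffOn ℝ 1 D B) (h0 : ∀ x ∈ B, D x ≤ 0 → η x = 0)
    (h1 : ∀ x ∈ B, 0 < D x → ContDiffAt ℝ 1 η x)
    (h2 : ∀ x ∈ B, 0 < D x → ∀ u v, fderiv ℝ η x u v = fderiv ℝ η x v u) (n : ℝ) (hn : 0 < n) {y : E} (hy : y ∈ B) (u v : E) :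
    fderiv ℝ (cutoffForm n D η) y u v - fderiv ℝ (cutoffForm n D η) y v u =
      n * deriv Real.smoothTransition (n * D y - 1) *
        (fderiv ℝ D y u * η y v - fderiv ℝ D y v * η y u) := by
  have hDy := hD.contDiffAt (hBo.mem_nhds hy)
  rcases lt_or_ge 0 (D y) with h | h
  · have hd : HasFDerivAt (fun y => Real.smoothTransition (n * D y - 1))
        (deriv Real.smoothTransition (n * D y - 1) • n • fderiv ℝ D y) y :=
      (smoothTransition_hasDerivAt _).comp_hasFDerivAt y
        (((hDy.differentiableAt one_ne_zero).hasFDerivAt.const_mul n).sub_const 1)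
    have hs := hd.smul ((h1 y hy h).differentiableAt one_ne_zero).hasFDerivAt
    rw [show fderiv ℝ (cutoffForm n D η) y = _ from hs.fderiv]
    simp [h2 y hy h u v]
    ring
  · have hev : cutoffForm n D η =ᶠ[𝓝 y] fun _ => 0 := by
      have hlt : n * D y - 1 < 0 := by nlinarith
      have hc : ContinuousAt (fun y => n * D y - 1) y :=
        (continuousAt_const.mul hDy.continuousAt).sub continuousAt_const
      filter_upwards [hc.eventually (Iio_mem_nhds hlt)] with v hv
      rw [cutoffForm, Real.smoothTransition.zero_of_nonpos (le_of_lt hv), zero_smul]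
    rw [hev.fderiv_eq, h0 y hy h]
    simp

theorem abs_integral_sub_integral_le {η θ : E → E →L[ℝ] ℝ} {B : Set E} (hη : ContinuousOn η B)
    (hθ : ContinuousOn θ B) {ε : ℝ} (hε : ∀ y ∈ B, ‖η y - θ y‖ ≤ ε) {γ : ℝ → E}
    (hγ : Continuous γ) (hγB : ∀ t ∈ Icc (0 : ℝ) 1, γ t ∈ B) (v : E) :
    |(∫ t in (0 : ℝ)..1, η (γ t) v) - ∫ t in (0 : ℝ)..1, θ (γ t) v| ≤ ε * ‖v‖ := by
  have hi : ∀ {θ : E → E →L[ℝ] ℝ}, ContinuousOn θ B →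
      IntervalIntegrable (fun t => θ (γ t) v) volume 0 1 := fun h =>
    ((h.comp hγ.continuousOn hγB).clm_apply continuousOn_const).intervalIntegrable_of_Icc
      zero_le_one
  rw [← intervalIntegral.integral_sub (hi hη) (hi hθ)]
  have := intervalIntegral.norm_integral_le_of_norm_le_const (a := 0) (b := 1) (C := ε * ‖v‖)
    (f := fun t => η (γ t) v - θ (γ t) v) fun t ht => by
      rw [uIoc_of_le zero_le_one] at ht
      exact (η (γ t) - θ (γ t)).le_of_opNorm_le (hε _ (hγB t (Ioc_subset_Icc_self ht))) v
  simpa using this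

/-- The integral of a 1-form over the boundary of a triangle is zero, if the form is closed where
`D > 0` and vanishes elsewhere, and two sides of the triangle are transverse to the level sets of
`D`. -/
theorem integral_segment_sub_eq_zero {η : E → E →L[ℝ] ℝ} {D : E → ℝ} {B : Set E}
    (hBo : IsOpen B) (hBc : Convex ℝ B) (hη : ContinuousOn η B)
    (hD : ContDiffOn ℝ 1 D B) (h0 : ∀ x ∈ B, D x ≤ 0 → η x = 0)
    (h1 : ∀ x ∈ B, 0 < D x → ContDiffAt ℝ 1 η x)
    (h2 : ∀ x ∈ B, 0 < D x → ∀ u v, fderiv ℝ η x u v = fderiv ℝ η x v u)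
    {K c : ℝ} (hK : ∀ y ∈ B, ‖fderiv ℝ D y‖ ≤ K) (hc : 0 < c)
    (hsmall : ∀ ε > 0, ∃ δ > 0, ∀ y ∈ B, D y ≤ δ → ‖η y‖ ≤ ε)
    {b x w : E} (hb : b ∈ B) (hx : x ∈ B) (hxw : x + w ∈ B)
    (htr : ∀ s ∈ Icc (0 : ℝ) 1, ∀ y ∈ B, c ≤ fderiv ℝ D y (x + s • w - b)) :
    (∫ t in (0 : ℝ)..1, η (b + t • (x + w - b)) (x + w - b)) -
        (∫ t in (0 : ℝ)..1, η (b + t • (x - b)) (x - b)) - ∫ s in (0 : ℝ)..1, η (x + s • w) w = 0 := by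
  have hxs : ∀ s ∈ Icc (0 : ℝ) 1, x + s • w ∈ B := fun s hs => by
    simpa using hBc.add_smul_sub_mem hx hxw hs
  have hH : ∀ s ∈ Icc (0 : ℝ) 1, ∀ t ∈ Icc (0 : ℝ) 1, b + t • (x + s • w - b) ∈ B :=
    fun s hs t ht => hBc.add_smul_sub_mem hb (hxs s hs) ht
  have hK0 : 0 ≤ K := (norm_nonneg _).trans (hK b hb)
  set L := ‖x - b‖ + ‖w‖ with hL
  have hLs : ∀ s ∈ Icc (0 : ℝ) 1, ‖x + s • w - b‖ ≤ L := fun s hs => by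
    rw [show x + s • w - b = (x - b) + s • w by abel, hL]
    refine (norm_add_le _ _).trans (add_le_add_right ?_ _)
    rw [norm_smul, Real.norm_of_nonneg hs.1]
    exact mul_le_of_le_one_left (norm_nonneg _) hs.2
  -- The first three terms pay for replacing `η` by its cutoff on the sides of the triangle, the
  -- last one for the exterior derivative inside.
  set C := ‖x + w - b‖ + ‖x - b‖ + ‖w‖ + 2 * K * ‖w‖ * L / c with hC
  have hC0 : 0 ≤ C := by positivity
  suffices key : ∀ ε > 0, |(∫ t in (0 : ℝ)..1, η (b + t • (x + w - b)) (x + w - b)) -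
      (∫ t in (0 : ℝ)..1, η (b + t • (x - b)) (x - b)) -
        ∫ s in (0 : ℝ)..1, η (x + s • w) w| ≤ ε * C by
    rw [← abs_nonpos_iff]
    refine le_of_forall_pos_le_add fun ε hε => ?_
    have h := key (ε / (C + 1)) (by positivity)
    have : ε / (C + 1) * C ≤ ε := by
      rw [div_mul_eq_mul_div, div_le_iff₀ (by positivity)]
      nlinarith
    linarith
  intro ε hε
  obtain ⟨δ, hδ, hδη⟩ := hsmall ε hε
  have hn : 0 < 2 / δ := by positivity
  set n := 2 / δ with hn_def
  -- With this `n` the cutoff is `1`, with zero derivative, as soon as `D > δ`; all errors come from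
  -- the region where `‖η‖ ≤ ε`.
  have hnδ : n * δ = 2 := by rw [hn_def]; field_simp
  have hθ := contDiffOn_cutoffForm hBo hD h1 n hn
  have hclose : ∀ y ∈ B, ‖η y - cutoffForm n D η y‖ ≤ ε := by
    intro y hy
    have e : η y - cutoffForm n D η y = (1 - Real.smoothTransition (n * D y - 1)) • η y := by
      rw [cutoffForm]; module
    rw [e, norm_smul]
    rcases le_or_gt (D y) δ with h | h
    · have a1 := Real.smoothTransition.nonneg (n * D y - 1)
      have a2 := Real.smoothTransition.le_one (n * D y - 1)
      rw [Real.norm_of_nonneg (by linarith)]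
      exact (mul_le_of_le_one_left (norm_nonneg _) (by linarith)).trans (hδη y hy h)
    · rw [Real.smoothTransition.one_of_one_le (by nlinarith)]
      simpa using hε.le
  have d1 := abs_integral_sub_integral_le hη hθ.continuousOn hclose
    (γ := fun t => b + t • (x + w - b)) (by fun_prop)
    (fun t ht => hBc.add_smul_sub_mem hb hxw ht) (x + w - b)
  have d2 := abs_integral_sub_integral_le hη hθ.continuousOn hclose
    (γ := fun t => b + t • (x - b)) (by fun_prop)
    (fun t ht => hBc.add_smul_sub_mem hb hx ht) (x - b)
  have d3 := abs_integral_sub_integral_le hη hθ.continuousOn hclose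
    (γ := fun t => x + t • w) (by fun_prop) hxs w
  have d4 := integral_segment_sub_integral_segment hBo hBc hθ hb hx hxw
  have d5 : |∫ s in (0 : ℝ)..1, ∫ t in (0 : ℝ)..1,
        t * (fderiv ℝ (cutoffForm n D η) (b + t • (x + s • w - b)) w (x + s • w - b) -
          fderiv ℝ (cutoffForm n D η) (b + t • (x + s • w - b)) (x + s • w - b) w)| ≤
      2 * K * ‖w‖ * L / c * ε := by
    have := intervalIntegral.norm_integral_le_of_norm_le_const (a := 0) (b := 1)
      (C := 2 * K * ‖w‖ * L / c * ε) (f := fun s => ∫ t in (0 : ℝ)..1,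
        t * (fderiv ℝ (cutoffForm n D η) (b + t • (x + s • w - b)) w (x + s • w - b) -
          fderiv ℝ (cutoffForm n D η) (b + t • (x + s • w - b)) (x + s • w - b) w))
      fun s hs => ?_
    · simpa using this
    rw [uIoc_of_le zero_le_one] at hs
    have hs' := Ioc_subset_Icc_self hs
    set v := x + s • w - b with hv
    set M := 2 * K * ‖w‖ * L / c * ε with hM
    have hM0 : 0 ≤ M := by positivity
    -- The derivative of the cutoff grows like `n`. Transversality bounds the integrand by the
    -- derivative of `M` times the cutoff along the ray, and the cutoff stays in `[0, 1]`; hence the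
    -- integral is at most `M`, whatever `n` is.
    have hder : ∀ t ∈ Icc (0 : ℝ) 1, HasDerivAt
        (fun t : ℝ => M * Real.smoothTransition (n * D (b + t • v) - 1))
        (M * (deriv Real.smoothTransition (n * D (b + t • v) - 1) *
          (n * fderiv ℝ D (b + t • v) v))) t := by
      intro t ht
      have hy : HasDerivAt (fun t : ℝ => b + t • v) v t := by
        simpa using ((hasDerivAt_id t).smul_const v).const_add b
      have hDd := ((hD.contDiffAt (hBo.mem_nhds (hH s hs' t ht))).differentiableAt
        one_ne_zero).hasFDerivAt.comp_hasDerivAt t hy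
      exact ((smoothTransition_hasDerivAt _).comp t ((hDd.const_mul n).sub_const 1)).const_mul M
    have hγ : ContinuousOn (fun t : ℝ => b + t • v) (Icc 0 1) := by fun_prop
    have hcd : Continuous (deriv Real.smoothTransition) :=
      (Real.smoothTransition.contDiff (n := 1)).continuous_deriv le_rfl
    have hint : IntervalIntegrable (fun t => M * (deriv Real.smoothTransition
        (n * D (b + t • v) - 1) * (n * fderiv ℝ D (b + t • v) v))) volume 0 1 := by
      refine ContinuousOn.intervalIntegrable_of_Icc zero_le_one ?_
      have c1 := hD.continuousOn.comp hγ fun t ht => hH s hs' t ht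
      have c2 := (hD.continuousOn_fderiv_of_isOpen hBo le_rfl).comp hγ fun t ht => hH s hs' t ht
      refine continuousOn_const.mul (ContinuousOn.mul (hcd.comp_continuousOn ?_) ?_)
      · exact (continuousOn_const.mul c1).sub continuousOn_const
      · exact continuousOn_const.mul (c2.clm_apply continuousOn_const)
    refine (intervalIntegral.norm_integral_le_of_norm_le zero_le_one ?_ hint).trans ?_
    · refine ae_of_all _ fun t ht => ?_
      have ht' := Ioc_subset_Icc_self ht
      set y := b + t • v with hy
      have hyB : y ∈ B := hH s hs' t ht'
      rw [fderiv_cutoffForm_sub hBo hD h0 h1 h2 n hn hyB, norm_mul, norm_mul, norm_mul,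
        Real.norm_of_nonneg ht'.1, Real.norm_of_nonneg hn.le,
        Real.norm_of_nonneg (deriv_smoothTransition_nonneg _)]
      rcases le_or_gt (D y) δ with h | h
      · have b1 : ‖fderiv ℝ D y w * η y v - fderiv ℝ D y v * η y w‖ ≤ 2 * K * ‖w‖ * L * ε := by
          have e1 := (fderiv ℝ D y).le_of_opNorm_le (hK y hyB) w
          have e2 := (fderiv ℝ D y).le_of_opNorm_le (hK y hyB) v
          have e3 := (η y).le_of_opNorm_le (hδη y hyB h) v
          have e4 := (η y).le_of_opNorm_le (hδη y hyB h) w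
          have e5 := hLs s hs'
          calc _ ≤ ‖fderiv ℝ D y w * η y v‖ + ‖fderiv ℝ D y v * η y w‖ := norm_sub_le _ _
            _ = ‖fderiv ℝ D y w‖ * ‖η y v‖ + ‖fderiv ℝ D y v‖ * ‖η y w‖ := by
              rw [norm_mul, norm_mul]
            _ ≤ (K * ‖w‖) * (ε * ‖v‖) + (K * ‖v‖) * (ε * ‖w‖) := by gcongr
            _ = 2 * K * ‖w‖ * ‖v‖ * ε := by ring
            _ ≤ _ := by gcongr
        have b2 : 2 * K * ‖w‖ * L * ε = M * c := by rw [hM]; field_simp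
        have b3 := htr s hs' y hyB
        have b4 := deriv_smoothTransition_nonneg (n * D y - 1)
        calc _ ≤ 1 * (n * deriv Real.smoothTransition (n * D y - 1) * (M * c)) := by
              rw [b2] at b1
              gcongr
              exact ht'.2
          _ ≤ 1 * (n * deriv Real.smoothTransition (n * D y - 1) * (M * fderiv ℝ D y v)) := by
              gcongr
          _ = _ := by ring
      · rw [deriv_smoothTransition_eq_zero (by nlinarith)]
        simp
    · rw [intervalIntegral.integral_eq_sub_of_hasDerivAt
        (fun t ht => hder t (by rwa [uIcc_of_le zero_le_one] at ht)) hint]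
      have a1 := Real.smoothTransition.nonneg (n * D (b + (0 : ℝ) • v) - 1)
      have a2 := Real.smoothTransition.le_one (n * D (b + (1 : ℝ) • v) - 1)
      nlinarith
  rw [← d4] at d5
  rw [abs_le] at d1 d2 d3 d5 ⊢
  have e : ε * C = ε * ‖x + w - b‖ + ε * ‖x - b‖ + ε * ‖w‖ + 2 * K * ‖w‖ * L / c * ε := by
    rw [hC]; ring
  rw [e]
  constructor <;> linarith [d1.1, d1.2, d2.1, d2.2, d3.1, d3.2, d5.1, d5.2]

end Primitive

end

/-! ### From closed forms to local primitives, and from local primitives to the ray integral -/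

noncomputable section

section Primitive

open Set MeasureTheory Filter Topology

variable {E : Type*} [NormedAddCommGroup E] [NormedSpace ℝ E]

/-- A continuous 1-form that is closed where `D > 0` and vanishes elsewhere is locally exact at
the regular points of `D`. -/
theorem exists_primitive_of_vanishing [FiniteDimensional ℝ E] {η : E → E →L[ℝ] ℝ} {D : E → ℝ}
    {s : Set E} {z : E} (hs : IsOpen s) (hz : z ∈ s) (hη : ContinuousOn η s)
    (hD : ContDiffOn ℝ 1 D s) (h0 : ∀ x ∈ s, D x ≤ 0 → η x = 0)
    (h1 : ∀ x ∈ s, 0 < D x → ContDiffAt ℝ 1 η x)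
    (h2 : ∀ x ∈ s, 0 < D x → ∀ u v, fderiv ℝ η x u v = fderiv ℝ η x v u)
    {u : E} (hu : 0 < fderiv ℝ D z u) :
    ∃ U : E → ℝ, ∀ᶠ x in 𝓝 z, HasFDerivAt U (η x) x := by
  have : ProperSpace E := FiniteDimensional.proper ℝ E
  set m := fderiv ℝ D z u with hm
  set K := ‖fderiv ℝ D z‖ + 1 with hK
  have hK0 : 0 < K := by positivity
  have hDc : ContinuousAt (fderiv ℝ D) z :=
    (hD.continuousOn_fderiv_of_isOpen hs le_rfl).continuousAt (hs.mem_nhds hz)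
  have ev1 : ∀ᶠ y in 𝓝 z, ‖fderiv ℝ D y‖ < K :=
    hDc.norm.eventually (gt_mem_nhds (by rw [hK]; linarith))
  have ev2 : ∀ᶠ y in 𝓝 z, m / 2 < fderiv ℝ D y u :=
    (hDc.clm_apply continuousAt_const).eventually (lt_mem_nhds (show m / 2 < m by linarith))
  obtain ⟨R, hR, hball⟩ := Metric.nhds_basis_closedBall.mem_iff.1
    (ev1.and (ev2.and (hs.mem_nhds hz)))
  have hBs : Metric.ball z R ⊆ s := fun y hy => (hball (Metric.ball_subset_closedBall hy)).2.2
  -- By compactness, `D` has a minimum on the part of the closed ball where `‖η‖ ≥ ε`. The minimum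
  -- is positive because `η` vanishes where `D ≤ 0`, and half of it serves as `δ`.
  have hsmall : ∀ ε > 0, ∃ δ > 0, ∀ y ∈ Metric.ball z R, D y ≤ δ → ‖η y‖ ≤ ε := by
    intro ε hε
    have hcb : Metric.closedBall z R ⊆ s := fun y hy => (hball hy).2.2
    have hcomp : IsCompact (Metric.closedBall z R ∩ (fun y => ‖η y‖) ⁻¹' Ici ε) :=
      (isCompact_closedBall z R).of_isClosed_subset
        ((hη.mono hcb).norm.preimage_isClosed_of_isClosed Metric.isClosed_closedBall isClosed_Ici)
        inter_subset_left
    rcases (Metric.closedBall z R ∩ (fun y => ‖η y‖) ⁻¹' Ici ε).eq_empty_or_nonempty with he | hne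
    · refine ⟨1, one_pos, fun y hy _ => ?_⟩
      by_contra hcon
      have : y ∈ Metric.closedBall z R ∩ (fun y => ‖η y‖) ⁻¹' Ici ε :=
        ⟨Metric.ball_subset_closedBall hy, (not_le.1 hcon).le⟩
      rw [he] at this
      exact this
    · obtain ⟨y₀, hy₀, hmin⟩ := hcomp.exists_isMinOn hne
        (hD.continuousOn.mono (inter_subset_left.trans hcb))
      have hpos : 0 < D y₀ := by
        by_contra hcon
        have h := h0 y₀ (hcb hy₀.1) (not_lt.1 hcon)
        have h' : ε ≤ ‖η y₀‖ := hy₀.2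
        rw [h, norm_zero] at h'
        linarith
      refine ⟨D y₀ / 2, by positivity, fun y hy hyD => ?_⟩
      by_contra hcon
      have := hmin (show y ∈ Metric.closedBall z R ∩ (fun y => ‖η y‖) ⁻¹' Ici ε from
        ⟨Metric.ball_subset_closedBall hy, (not_le.1 hcon).le⟩)
      have h3 : D y₀ ≤ D y := this
      linarith
  obtain ⟨ρ, hρ, hρR⟩ : ∃ ρ > 0, ρ * ‖u‖ < R := by
    refine ⟨R / (2 * (‖u‖ + 1)), by positivity, ?_⟩
    rw [div_mul_eq_mul_div, div_lt_iff₀ (by positivity)]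
    nlinarith [norm_nonneg u]
  -- The apex of the cone lies a step back from `z` against `u`, so that `D` increases along all
  -- rays from `b` to points near `z`.
  set b := z - ρ • u with hb_def
  have hb : b ∈ Metric.ball z R := by
    rw [Metric.mem_ball, dist_eq_norm, hb_def, sub_sub_cancel_left, norm_neg, norm_smul,
      Real.norm_of_nonneg hρ.le]
    exact hρR
  -- On the ball, `ρ • u` contributes at least `ρ * m / 2` to the slope of `D`; this radius lets `x
  -- - z` cost at most half of that.
  set r := min R (ρ * m / (4 * K)) with hr
  have hr0 : 0 < r := lt_min hR (by positivity)
  have hrB : Metric.ball z r ⊆ Metric.ball z R := Metric.ball_subset_ball (min_le_left _ _)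
  have htr : ∀ x ∈ Metric.ball z r, ∀ y ∈ Metric.ball z R, ρ * m / 4 ≤ fderiv ℝ D y (x - b) := by
    intro x hx y hy
    have hy' := hball (Metric.ball_subset_closedBall hy)
    have e : fderiv ℝ D y (x - b) = ρ * fderiv ℝ D y u + fderiv ℝ D y (x - z) := by
      rw [show x - b = ρ • u + (x - z) by rw [hb_def]; abel, map_add, map_smul, smul_eq_mul]
    have e1 : ρ * (m / 2) ≤ ρ * fderiv ℝ D y u := by have := hy'.2.1; gcongr
    have e2 : ‖fderiv ℝ D y (x - z)‖ ≤ K * (ρ * m / (4 * K)) := by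
      have h5 : ‖x - z‖ ≤ ρ * m / (4 * K) := by
        rw [← dist_eq_norm]
        exact (Metric.mem_ball.1 hx).le.trans (min_le_right _ _)
      exact (fderiv ℝ D y).le_of_opNorm_le_of_le hy'.1.le h5
    have e3 : K * (ρ * m / (4 * K)) = ρ * m / 4 := by field_simp
    rw [Real.norm_eq_abs, e3, abs_le] at e2
    linarith [e2.1]
  refine ⟨fun x => ∫ t in (0 : ℝ)..1, η (b + t • (x - b)) (x - b), ?_⟩
  filter_upwards [Metric.ball_mem_nhds z hr0] with x hx
  have hform : ∀ y ∈ Metric.ball z r, (∫ t in (0 : ℝ)..1, η (b + t • (y - b)) (y - b)) =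
      (∫ t in (0 : ℝ)..1, η (b + t • (x - b)) (x - b)) + ∫ᶜ v in .segment x y, η v := by
    intro y hy
    have h := integral_segment_sub_eq_zero Metric.isOpen_ball (convex_ball z R) (hη.mono hBs)
      (hD.mono hBs) (fun x hx => h0 x (hBs hx)) (fun x hx => h1 x (hBs hx))
      (fun x hx => h2 x (hBs hx))
      (fun y hy => (hball (Metric.ball_subset_closedBall hy)).1.le) (c := ρ * m / 4)
      (by positivity) hsmall hb (hrB hx) (w := y - x) (by simpa using hrB hy)
      (fun σ hσ v hv => htr _ ((convex_ball z r).add_smul_sub_mem hx hy hσ) v hv)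
    rw [add_sub_cancel] at h
    rw [curveIntegral_segment]
    have e : ∀ t : ℝ, AffineMap.lineMap x y t = x + t • (y - x) := fun t => by
      rw [AffineMap.lineMap_apply, vsub_eq_sub, vadd_eq_add, add_comm]
    simp only [e]
    linarith
  have hder : HasFDerivAt (fun y => (∫ t in (0 : ℝ)..1, η (b + t • (x - b)) (x - b)) +
      ∫ᶜ v in .segment x y, η v) (η x) x := by
    refine (HasFDerivAt.curveIntegral_segment_source' ?_).const_add _
    filter_upwards [Metric.isOpen_ball.mem_nhds (hrB hx)] with y hy
    exact hη.continuousAt (hs.mem_nhds (hBs hy))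
  refine hder.congr_of_eventuallyEq ?_
  filter_upwards [Metric.isOpen_ball.mem_nhds hx] with y hy using hform y hy

/-- The ray integral of a locally exact 1-form on a star-shaped set is a primitive. -/
theorem hasFDerivAt_integral_ray {ω : E → E →L[ℝ] ℝ} {O : Set E} {a : E} (hO : IsOpen O)
    (hstar : ∀ x ∈ O, ∀ t ∈ Icc (0 : ℝ) 1, a + t • (x - a) ∈ O) (hω : ContinuousOn ω O)
    (hloc : ∀ z ∈ O, ∃ U : E → ℝ, ∀ᶠ x in 𝓝 z, HasFDerivAt U (ω x) x) {x : E} (hx : x ∈ O) :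
    HasFDerivAt (fun x => ∫ t in (0 : ℝ)..1, ω (a + t • (x - a)) (x - a)) (ω x) x := by
  -- The statement for the integral truncated at `T`. It is trivial for `T = 0` and is the claim for
  -- `T = 1`. For `T₁` and `T₂` close to each other, the truncated integrals differ by a difference
  -- of values of a local primitive, so the statement propagates along the connected interval.
  set P : ℝ → Prop := fun T => HasFDerivAt (fun y => ∫ t in (0 : ℝ)..T, ω (a + t • (y - a)) (y - a))
    (T • ω (a + T • (x - a))) x with hP
  have hcont : ∀ y ∈ O, ContinuousOn (fun t : ℝ => ω (a + t • (y - a)) (y - a)) (Icc 0 1) :=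
    fun y hy => (hω.comp (f := fun t : ℝ => a + t • (y - a)) (by fun_prop)
      fun t ht => hstar y hy t ht).clm_apply continuousOn_const
  have hstep : ∀ τ ∈ Icc (0 : ℝ) 1, ∃ V ∈ 𝓝 τ, ∀ T₁ ∈ V ∩ Icc 0 1, ∀ T₂ ∈ V ∩ Icc 0 1,
      P T₁ → P T₂ := by
    intro τ hτ
    obtain ⟨U, hU⟩ := hloc _ (hstar x hx τ hτ)
    have hc : ContinuousAt (fun q : ℝ × E => a + q.1 • (q.2 - a)) (τ, x) := by fun_prop
    obtain ⟨V, hV, Y, hY, hVY⟩ := mem_nhds_prod_iff.1 (hc.eventually hU)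
    obtain ⟨δ, hδ, hδV⟩ := Metric.mem_nhds_iff.1 hV
    refine ⟨Metric.ball τ δ, Metric.ball_mem_nhds τ hδ, fun T₁ h₁ T₂ h₂ hT => ?_⟩
    have hUd : ∀ T ∈ Metric.ball τ δ, ∀ y ∈ Y, HasFDerivAt U (ω (a + T • (y - a)))
        (a + T • (y - a)) := fun T hT y hy => hVY (mk_mem_prod (hδV hT) hy)
    have hd : ∀ T ∈ Metric.ball τ δ, HasFDerivAt (fun y => U (a + T • (y - a)))
        (T • ω (a + T • (x - a))) x := by
      intro T hT
      have h1 : HasFDerivAt (fun y : E => a + T • (y - a)) (T • ContinuousLinearMap.id ℝ E) x :=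
        (((hasFDerivAt_id x).sub_const a).const_smul T).const_add a
      refine ((hUd T hT x (mem_of_mem_nhds hY)).comp x h1).congr_fderiv ?_
      ext v
      simp
    have hform : ∀ y ∈ Y ∩ O, (∫ t in (0 : ℝ)..T₂, ω (a + t • (y - a)) (y - a)) =
        (∫ t in (0 : ℝ)..T₁, ω (a + t • (y - a)) (y - a)) +
          (U (a + T₂ • (y - a)) - U (a + T₁ • (y - a))) := by
      intro y hy
      have hi : ∀ {p q : ℝ}, p ∈ Icc (0 : ℝ) 1 → q ∈ Icc (0 : ℝ) 1 →
          IntervalIntegrable (fun t : ℝ => ω (a + t • (y - a)) (y - a)) volume p q :=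
        fun hp hq => ((hcont y hy.2).mono (uIcc_subset_Icc hp hq)).intervalIntegrable
      have h0 : (0 : ℝ) ∈ Icc (0 : ℝ) 1 := ⟨le_rfl, zero_le_one⟩
      rw [← intervalIntegral.integral_add_adjacent_intervals (hi h0 h₁.2) (hi h₁.2 h₂.2)]
      congr 1
      refine intervalIntegral.integral_eq_sub_of_hasDerivAt (f := fun t => U (a + t • (y - a)))
        (fun t ht => ?_) (hi h₁.2 h₂.2)
      have htV : t ∈ Metric.ball τ δ :=
        (convex_ball τ δ).ordConnected.uIcc_subset h₁.1 h₂.1 ht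
      have hγ : HasDerivAt (fun t : ℝ => a + t • (y - a)) (y - a) t := by
        simpa using ((hasDerivAt_id t).smul_const (y - a)).const_add a
      exact (hUd t htV y hy.1).comp_hasDerivAt t hγ
    have hfin : HasFDerivAt (fun y => (∫ t in (0 : ℝ)..T₁, ω (a + t • (y - a)) (y - a)) +
          (U (a + T₂ • (y - a)) - U (a + T₁ • (y - a)))) (T₂ • ω (a + T₂ • (x - a))) x := by
      refine (HasFDerivAt.add hT ((hd T₂ h₂.1).sub (hd T₁ h₁.1))).congr_fderiv ?_
      abel
    refine hfin.congr_of_eventuallyEq ?_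
    filter_upwards [inter_mem hY (hO.mem_nhds hx)] with y hy using hform y hy
  have h0 : P 0 := by
    simp only [hP, intervalIntegral.integral_same, zero_smul]
    exact hasFDerivAt_const 0 x
  have h1 : P 0 → P 1 := by
    refine isPreconnected_Icc.induction₂' (fun T₁ T₂ => P T₁ → P T₂) (fun τ hτ => ?_)
      (fun T₁ T₂ T₃ _ _ _ h h' => h' ∘ h) (left_mem_Icc.2 zero_le_one) (right_mem_Icc.2 zero_le_one)
    obtain ⟨V, hV, hVP⟩ := hstep τ hτ
    filter_upwards [mem_nhdsWithin_of_mem_nhds hV, self_mem_nhdsWithin] with T hT hT'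
    have hτV := mem_of_mem_nhds hV
    exact ⟨hVP τ ⟨hτV, hτ⟩ T ⟨hT, hT'⟩, hVP T ⟨hT, hT'⟩ τ ⟨hτV, hτ⟩⟩
  have := h1 h0
  simp only [hP, one_smul, add_sub_cancel] at this
  exact this

end Primitive

end

noncomputable section

/-! ### The derivatives of the edge lengths -/

open Topology

/-- The reason for the symmetry of the Jacobian: differentiating the normalised cofactor of an edge
by an adjacent angle yields a single cofactor, that of the third edge at the common vertex. -/
theorem edgeCofactor_partial_b (ca cA cb cB cc cC : ℝ) :
    ((1 - ca ^ 2) * cC + ca * (cB + ca * cC)) *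
        (1 - ca ^ 2 - cb ^ 2 - cc ^ 2 - 2 * ca * cb * cc) +
      ((1 - ca ^ 2) * (cA + cb * cC) + (cc + ca * cb) * (cB + ca * cC)) * (cb + ca * cc) =
    (1 - ca ^ 2) * ((1 - cc ^ 2) * (cC + ca * cB) + (cb + cc * ca) * (cA + cc * cB)) := by
  ring

/-- The coefficient of `dl / da` (up to the common factor). -/
def edgeDiag (a a' b b' c c' : ℝ) : ℝ :=
  (-(2 * Real.cos a * (Real.cos a' + Real.cos b * Real.cos c') -
      Real.cos b * (Real.cos b' + Real.cos a * Real.cos c') -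
      (Real.cos c + Real.cos a * Real.cos b) * Real.cos c') +
    edgeCofactor a a' b b' c c' *
      ((Real.cos a + Real.cos b * Real.cos c) / vertexGram a b c +
        (Real.cos a + Real.cos c' * Real.cos b') / vertexGram a c' b')) / Real.sin a ^ 2

/-- The shape of the coefficients matters: for opposite edges `sin a * sin a'`, for adjacent ones
`sin a * sin b` times the cofactor of the third edge over the minor of the common vertex. Both are
symmetric in the two edges, up to the common factor. The diagonal coefficient may be anything. -/
theorem hasDerivAt_extArccos_edgeCos {a a' b b' c c' va va' vb vb' vc vc' : ℝ}
    (hs : 0 < Real.sin a) (h1 : 0 < vertexGram a b c) (h2 : 0 < vertexGram a c' b')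
    (hD : gramPoly a a' b b' c c' ≠ 0) :
    HasDerivAt (fun t : ℝ => extArccos (edgeCofactor (a + t * va) (a' + t * va') (b + t * vb)
        (b' + t * vb') (c + t * vc) (c' + t * vc') /
        √(vertexGram (a + t * va) (b + t * vb) (c + t * vc) *
          vertexGram (a + t * va) (c' + t * vc') (b' + t * vb'))))
      ((√|gramPoly a a' b b' c c'|)⁻¹ * Real.sin a * (Real.sin a' * va' +
        Real.sin b * (edgeCofactor c c' a a' b b' / vertexGram a b c) * vb +
        Real.sin c * (edgeCofactor b b' a a' c c' / vertexGram a b c) * vc +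
        Real.sin c' * (edgeCofactor b' b a a' c' c / vertexGram a c' b') * vc' +
        Real.sin b' * (edgeCofactor c' c a a' b' b / vertexGram a c' b') * vb' +
        Real.sin a * edgeDiag a a' b b' c c' * va)) 0 := by
  have hcos : ∀ p q : ℝ, HasDerivAt (fun t : ℝ => Real.cos (p + t * q)) (-Real.sin p * q) 0 := by
    intro p q
    have h : HasDerivAt (fun t : ℝ => p + t * q) q 0 := by
      simpa using ((hasDerivAt_id (0 : ℝ)).mul_const q).const_add p
    simpa using h.cos
  have hG : ∀ p q r vp vq vr : ℝ, HasDerivAt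
      (fun t : ℝ => vertexGram (p + t * vp) (q + t * vq) (r + t * vr))
      (2 * (Real.sin p * (Real.cos p + Real.cos q * Real.cos r) * vp +
        Real.sin q * (Real.cos q + Real.cos p * Real.cos r) * vq +
        Real.sin r * (Real.cos r + Real.cos p * Real.cos q) * vr)) 0 := by
    intro p q r vp vq vr
    simp only [vertexGram]
    refine ((((((hcos p vp).pow 2).const_sub 1).sub ((hcos q vq).pow 2)).sub
      ((hcos r vr).pow 2)).sub ((((hcos p vp).const_mul 2).mul (hcos q vq)).mul
      (hcos r vr))).congr_deriv ?_
    simp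
    ring
  have hN : HasDerivAt (fun t : ℝ => edgeCofactor (a + t * va) (a' + t * va') (b + t * vb)
        (b' + t * vb') (c + t * vc) (c' + t * vc'))
      (2 * Real.cos a * Real.sin a * va * (Real.cos a' + Real.cos b * Real.cos c') +
        Real.sin a ^ 2 * (-Real.sin a' * va' + (-Real.sin b * vb * Real.cos c' +
          Real.cos b * (-Real.sin c' * vc'))) +
        ((-Real.sin c * vc + (-Real.sin a * va * Real.cos b + Real.cos a * (-Real.sin b * vb))) *
          (Real.cos b' + Real.cos a * Real.cos c') +
        (Real.cos c + Real.cos a * Real.cos b) *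
          (-Real.sin b' * vb' + (-Real.sin a * va * Real.cos c' +
            Real.cos a * (-Real.sin c' * vc'))))) 0 := by
    simp only [edgeCofactor, Real.sin_sq]
    refine (((((hcos a va).pow 2).const_sub 1).mul ((hcos a' va').add
      ((hcos b vb).mul (hcos c' vc')))).add (((hcos c vc).add ((hcos a va).mul (hcos b vb))).mul
      ((hcos b' vb').add ((hcos a va).mul (hcos c' vc'))))).congr_deriv ?_
    simp only [zero_mul, add_zero, Nat.cast_ofNat, Nat.add_one_sub_one, pow_one, Pi.mul_apply, Pi.add_apply, Pi.pow_apply]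
    ring
  have hP := (hG a b c va vb vc).mul (hG a c' b' va vc' vb')
  have hP0 : 0 < vertexGram a b c * vertexGram a c' b' := mul_pos h1 h2
  have hF := hN.div (hP.sqrt (by simpa using hP0.ne')) (by simpa using (Real.sqrt_pos.2 hP0).ne')
  have hq := Real.sqrt_pos.2 hP0
  have hq2 := Real.sq_sqrt hP0.le
  have hsq := edgeCofactor_sq a a' b b' c c'
  set F := edgeCofactor a a' b b' c c' / √(vertexGram a b c * vertexGram a c' b') with hFdef
  have hF1 : 1 - F ^ 2 = gramPoly a a' b b' c c' * (Real.sin a /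
      √(vertexGram a b c * vertexGram a c' b')) ^ 2 := by
    rw [hFdef, div_pow, div_pow, hq2, ← hsq]
    rw [← hsq] at hP0
    field_simp
    ring
  have hF2 : √|1 - F ^ 2| = √|gramPoly a a' b b' c c'| * (Real.sin a /
      √(vertexGram a b c * vertexGram a c' b')) := by
    rw [hF1, abs_mul, abs_of_nonneg (sq_nonneg (Real.sin a / √(vertexGram a b c * vertexGram a c' b'))), Real.sqrt_mul (abs_nonneg _),
      Real.sqrt_sq (by positivity)]
  have hF0 : 1 - F ^ 2 ≠ 0 := by
    rw [hF1]
    exact mul_ne_zero hD (by positivity)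
  have hA := (extArccos_contDiffAt_and_hasDerivAt (c := F) (fun e => hF0 (by rw [e]; ring))
    (fun e => hF0 (by rw [e]; ring))).2
  have hcomp := HasDerivAt.comp_of_eq (0 : ℝ) hA hF (by simp [hFdef])
  refine hcomp.congr_deriv ?_
  rw [hF2]
  simp only [zero_mul, add_zero, Pi.mul_apply]
  have hd := Real.sqrt_pos.2 (abs_pos.2 hD)
  set R := √|gramPoly a a' b b' c c'|
  set Q := √(vertexGram a b c * vertexGram a c' b')
  have hI : ∀ p p' q q' r r' : ℝ, 0 < vertexGram p q r →
      Real.sin p ^ 2 * (edgeCofactor r r' p p' q q' / vertexGram p q r) =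
      (Real.sin p ^ 2 * Real.cos r' + Real.cos p * (Real.cos q' + Real.cos p * Real.cos r')) +
      edgeCofactor p p' q q' r r' * (Real.cos q + Real.cos p * Real.cos r) / vertexGram p q r := by
    intro p p' q q' r r' h
    have I := edgeCofactor_partial_b (Real.cos p) (Real.cos p') (Real.cos q) (Real.cos q')
      (Real.cos r) (Real.cos r')
    rw [← mul_div_assoc, eq_comm, add_div' _ _ _ h.ne']
    congr 1
    simp only [edgeCofactor, vertexGram, Real.sin_sq]
    linarith
  have I1 := hI a a' b b' c c' h1
  have I2 := hI a a' c c' b b' (by rwa [← vertexGram_swap])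
  have I3 := hI a a' c' c b' b h2
  have I4 := hI a a' b' b c' c (by rwa [← vertexGram_swap])
  rw [edgeCofactor_swap a a' c c' b b', vertexGram_swap a c b] at I2
  rw [← edgeCofactor_swap' a a' c c' b b', edgeCofactor_swap a a' c c' b b'] at I3
  rw [← edgeCofactor_swap' a a' b b' c c', vertexGram_swap a b' c'] at I4
  have I5 : Real.sin a ^ 2 * edgeDiag a a' b b' c c' = edgeCofactor a a' b b' c c' * ((Real.cos a + Real.cos b * Real.cos c) / vertexGram a b c +
        (Real.cos a + Real.cos c' * Real.cos b') / vertexGram a c' b')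
      -(2 * Real.cos a * (Real.cos a' + Real.cos b * Real.cos c') -
      Real.cos b * (Real.cos b' + Real.cos a * Real.cos c') -
      (Real.cos c + Real.cos a * Real.cos b) * Real.cos c') := by
    rw [edgeDiag]
    field_simp
    ring
  have hQ : Q ^ 2 = vertexGram a b c * vertexGram a c' b' := hq2
  generalize edgeCofactor c c' a a' b b' = C1 at *
  generalize edgeCofactor b b' a a' c c' = C2 at *
  generalize edgeCofactor b' b a a' c' c = C3 at *
  generalize edgeCofactor c' c a a' b' b = C4 at *
  generalize edgeCofactor a a' b b' c c' = N at *
  generalize edgeDiag a a' b b' c c' = Z at *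
  generalize vertexGram a b c = G1 at *
  generalize vertexGram a c' b' = G2 at *
  have e1 : ∀ u v : ℝ, (u * G2 + G1 * v) / Q ^ 2 = u / G1 + v / G2 := by
    intro u v
    rw [hQ]
    field_simp
  have e2 : ∀ n p X : ℝ, -(n - N / 2 * (p / Q ^ 2)) = Real.sin a ^ 2 * X →
      -(R * (Real.sin a / Q))⁻¹ * ((n * Q - N * (p / (2 * Q))) / Q ^ 2) =
        R⁻¹ * Real.sin a * X := by
    intro n p X h
    have : X = -(n - N / 2 * (p / Q ^ 2)) / Real.sin a ^ 2 := by rw [h]; field_simp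
    rw [this]
    field_simp
  refine e2 _ _ _ ?_
  rw [e1]
  clear hF hcomp hA hN hG hP hcos hF0
  linear_combination -(Real.sin b * vb * I1) - (Real.sin c * vc * I2) - (Real.sin c' * vc' * I3) -
    (Real.sin b' * vb' * I4) - Real.sin a * va * I5 -
    (Real.sin c * vc * Real.cos b' + Real.cos c * Real.sin b' * vb') * Real.sin_sq_add_cos_sq a

end

noncomputable section

/-! ### The Schläfli form in coordinates -/

open Topology

/-- The symmetric matrix with zero diagonal that has the entries of a given matrix above the
diagonal. -/
def symmetrize : (Fin 4 → Fin 4 → ℝ) →L[ℝ] (Fin 4 → Fin 4 → ℝ) :=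
  ContinuousLinearMap.pi fun i => ContinuousLinearMap.pi fun j =>
    if i = j then 0 else
      (ContinuousLinearMap.proj (φ := fun _ : Fin 4 => ℝ) (max i j)).comp
        (ContinuousLinearMap.proj (R := ℝ) (φ := fun _ : Fin 4 => Fin 4 → ℝ) (min i j))

theorem symmetrize_apply (x : Fin 4 → Fin 4 → ℝ) (i j : Fin 4) :
    symmetrize x i j = if i = j then 0 else x (min i j) (max i j) := by
  simp only [symmetrize, ContinuousLinearMap.coe_pi']
  split_ifs <;> simp

theorem symmetrize_self (x : Fin 4 → Fin 4 → ℝ) (i : Fin 4) : symmetrize x i i = 0 := by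
  simp [symmetrize_apply]

theorem symmetrize_comm (x : Fin 4 → Fin 4 → ℝ) (i j : Fin 4) :
    symmetrize x i j = symmetrize x j i := by
  simp only [symmetrize_apply, min_comm, max_comm, eq_comm]

theorem symmetrize_of_lt (x : Fin 4 → Fin 4 → ℝ) {i j : Fin 4} (h : i < j) :
    symmetrize x i j = x i j := by
  rw [symmetrize_apply, if_neg h.ne, min_eq_left h.le, max_eq_right h.le]

theorem symmetrize_eq {x : Fin 4 → Fin 4 → ℝ} (h0 : ∀ i, x i i = 0) (h : ∀ i j, x i j = x j i) :
    symmetrize x = x := by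
  ext i j
  rcases lt_trichotomy i j with hij | rfl | hij
  · exact symmetrize_of_lt x hij
  · rw [symmetrize_self, h0]
  · rw [symmetrize_comm, symmetrize_of_lt x hij, h]

namespace AngleStructures3

variable {x y : Fin 4 → Fin 4 → ℝ}

theorem symmetrize_eq_self (hx : x ∈ AngleStructures3) : symmetrize x = x :=
  symmetrize_eq hx.1 hx.2.1

/-- The matrices whose entries above the diagonal are those of an angle structure. -/
def domain : Set (Fin 4 → Fin 4 → ℝ) := symmetrize ⁻¹' AngleStructures3

theorem convex : Convex ℝ AngleStructures3 := by
  intro x hx y hy a b ha hb hab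
  have hlt : ∀ {c p q : ℝ}, p < c → q < c → a * p + b * q < c := fun {c p q} hp hq =>
    (convex_Iio c) (Set.mem_Iio.2 hp) (Set.mem_Iio.2 hq) ha hb hab
  have hgt : ∀ {c p q : ℝ}, c < p → c < q → c < a * p + b * q := fun {c p q} hp hq =>
    (convex_Ioi c) (Set.mem_Ioi.2 hp) (Set.mem_Ioi.2 hq) ha hb hab
  refine ⟨fun i => ?_, fun i j => ?_, fun i j h => ?_, fun i j k l h => ?_⟩ <;>
    simp only [Pi.add_apply, Pi.smul_apply, smul_eq_mul]
  · rw [hx.1, hy.1]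
    simp
  · rw [hx.2.1, hy.2.1]
  · exact ⟨hgt (hx.2.2.1 i j h).1 (hy.2.2.1 i j h).1, hlt (hx.2.2.1 i j h).2 (hy.2.2.1 i j h).2⟩
  · have h1 := hgt (hx.2.2.2 i j k l h).1 (hy.2.2.2 i j k l h).1
    have h2 := hlt (hx.2.2.2 i j k l h).2 (hy.2.2.2 i j k l h).2
    constructor <;> linarith

theorem convex_domain : Convex ℝ domain :=
  convex.linear_preimage symmetrize.toLinearMap

/-- `AngleStructures3` lies in the symmetric matrices with zero diagonal and is not open. Its
preimage under `symmetrize` is, so that ordinary Fréchet derivatives can be used. -/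
theorem isOpen_domain : IsOpen domain := by
  have hc : ∀ i j, Continuous fun x => symmetrize x i j := fun i j =>
    (continuous_apply_apply i j).comp symmetrize.continuous
  have he : domain = {x | (∀ i j, i ≠ j → 0 < symmetrize x i j ∧ symmetrize x i j < Real.pi) ∧
      ∀ i j k l : Fin 4, [i, j, k, l].Nodup →
        Real.pi < symmetrize x i j + symmetrize x i k + symmetrize x i l ∧
          symmetrize x i j + symmetrize x i k - symmetrize x i l < Real.pi} := by
    ext x
    exact ⟨fun h => ⟨h.2.2.1, h.2.2.2⟩,
      fun h => ⟨symmetrize_self x, symmetrize_comm x, h.1, h.2⟩⟩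
  rw [he]
  simp only [Set.ofPred_and, Set.ofPred_forall]
  refine IsOpen.inter ?_ ?_
  · refine isOpen_iInter_of_finite fun i => isOpen_iInter_of_finite fun j =>
      isOpen_iInter_of_finite fun _ => IsOpen.inter ?_ ?_
    · exact isOpen_lt continuous_const (hc i j)
    · exact isOpen_lt (hc i j) continuous_const
  · refine isOpen_iInter_of_finite fun i => isOpen_iInter_of_finite fun j =>
      isOpen_iInter_of_finite fun k => isOpen_iInter_of_finite fun l =>
      isOpen_iInter_of_finite fun _ => IsOpen.inter ?_ ?_
    · exact isOpen_lt continuous_const (((hc i j).add (hc i k)).add (hc i l))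
    · exact isOpen_lt (((hc i j).add (hc i k)).sub (hc i l)) continuous_const

theorem regularAngles_mem : regularAngles ∈ AngleStructures3 := by
  have h1 : Real.arccos (1 / 3) < Real.pi / 2 := by
    rw [Real.arccos_lt_pi_div_two]
    norm_num
  have h2 : Real.pi / 3 < Real.arccos (1 / 3) := by
    rw [← Real.arccos_cos (x := Real.pi / 3) (by positivity) (by linarith [Real.pi_pos]),
      Real.cos_pi_div_three]
    exact Real.strictAntiOn_arccos (by norm_num) (by norm_num) (by norm_num)
  have hp := Real.pi_pos
  refine ⟨fun i => by simp [regularAngles], fun i j => by simp [regularAngles, eq_comm],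
    fun i j h => ?_, fun i j k l h => ?_⟩
  · simp only [regularAngles, if_neg h]
    constructor <;> linarith
  · simp only [List.nodup_cons, List.mem_cons, List.not_mem_nil, or_false, not_or] at h
    simp only [regularAngles, if_neg h.1.1, if_neg h.1.2.1, if_neg h.1.2.2]
    constructor <;> linarith

/-- The cofactor of the Gram matrix at an edge. -/
def cofactor (x : Fin 4 → Fin 4 → ℝ) (i j : Fin 4) : ℝ :=
  edgeCofactor (x i j) (x (thirdVertex i j) (fourthVertex i j)) (x i (thirdVertex i j))
    (x j (fourthVertex i j)) (x i (fourthVertex i j)) (x j (thirdVertex i j))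

/-- The Gram determinant of the link of a vertex. -/
def vertexDet (x : Fin 4 → Fin 4 → ℝ) (i : Fin 4) : ℝ :=
  vertexGram (x i (i + 1)) (x i (i + 2)) (x i (i + 3))

theorem edgeCofactor_eq_cofactor (hx : x ∈ AngleStructures3) {i j k l : Fin 4}
    (h : [i, j, k, l].Nodup) :
    edgeCofactor (x i j) (x k l) (x i k) (x j l) (x i l) (x j k) = cofactor x i j := by
  rw [cofactor]
  rcases thirdVertex_fourthVertex_eq i j k l h with ⟨h1, h2⟩ | ⟨h1, h2⟩
  · rw [h1, h2]
  rw [h1, h2, edgeCofactor_swap, hx.2.1 l k]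

theorem cofactor_comm (hx : x ∈ AngleStructures3) {i j : Fin 4} (h : i ≠ j) :
    cofactor x i j = cofactor x j i := by
  have h1 := nodup_thirdVertex_fourthVertex i j h
  rw [← edgeCofactor_eq_cofactor hx h1, ← edgeCofactor_eq_cofactor hx (nodup_swap_fst h1),
    hx.2.1 j i, edgeCofactor_swap', edgeCofactor_swap]

theorem vertexGram_eq_vertexDet (x : Fin 4 → Fin 4 → ℝ) {i j k l : Fin 4}
    (h : [i, j, k, l].Nodup) : vertexGram (x i j) (x i k) (x i l) = vertexDet x i := by
  have hcase : ∀ i j k l : Fin 4, [i, j, k, l].Nodup →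
      (j = i + 1 ∧ k = i + 2 ∧ l = i + 3) ∨ (j = i + 1 ∧ k = i + 3 ∧ l = i + 2) ∨
      (j = i + 2 ∧ k = i + 1 ∧ l = i + 3) ∨ (j = i + 2 ∧ k = i + 3 ∧ l = i + 1) ∨
      (j = i + 3 ∧ k = i + 1 ∧ l = i + 2) ∨ (j = i + 3 ∧ k = i + 2 ∧ l = i + 1) := by decide
  rcases hcase i j k l h with ⟨rfl, rfl, rfl⟩ | ⟨rfl, rfl, rfl⟩ | ⟨rfl, rfl, rfl⟩ |
    ⟨rfl, rfl, rfl⟩ | ⟨rfl, rfl, rfl⟩ | ⟨rfl, rfl, rfl⟩ <;> simp only [vertexDet, vertexGram] <;> ring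

/-- The coefficient of `dx_ij` in the differential of the length of the edge `ij`. -/
def diagCoeff (x : Fin 4 → Fin 4 → ℝ) (i j k l : Fin 4) : ℝ :=
  Real.sin (x i j) * edgeDiag (x i j) (x k l) (x i k) (x j l) (x i l) (x j k)

/-- The differential of the length of the edge `ij`. -/
def edgeLengthDeriv (x v : Fin 4 → Fin 4 → ℝ) (i j k l : Fin 4) : ℝ :=
  (√|gramDet x|)⁻¹ * Real.sin (x i j) * (Real.sin (x k l) * v k l +
    Real.sin (x i k) * (cofactor x i l / vertexDet x i) * v i k +
    Real.sin (x i l) * (cofactor x i k / vertexDet x i) * v i l +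
    Real.sin (x j k) * (cofactor x j l / vertexDet x j) * v j k +
    Real.sin (x j l) * (cofactor x j k / vertexDet x j) * v j l +
    diagCoeff x i j k l * v i j)

theorem hasDerivAt_edgeCos (hx : x ∈ AngleStructures3) (hD : gramDet x ≠ 0)
    (v : Fin 4 → Fin 4 → ℝ) {i j k l : Fin 4} (h : [i, j, k, l].Nodup) :
    HasDerivAt (fun t : ℝ => extArccos (edgeCos (x + t • v) i j k l))
      (edgeLengthDeriv x v i j k l) 0 := by
  have h1 := vertexGram_pos hx h
  have h2 := vertexGram_pos hx (nodup_swap_fst h)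
  rw [hx.2.1 j i] at h2
  have hg := gramPoly_eq_gramDet hx i j k l h
  have := hasDerivAt_extArccos_edgeCos (a := x i j) (a' := x k l) (b := x i k) (b' := x j l)
    (c := x i l) (c' := x j k) (va := v i j) (va' := v k l) (vb := v i k) (vb' := v j l)
    (vc := v i l) (vc' := v j k) (sin_pos hx (ne_of_nodup h)) h1 h2 (by rwa [hg])
  have e1 : edgeCofactor (x i l) (x j k) (x i j) (x k l) (x i k) (x j l) = cofactor x i l := by
    rw [← edgeCofactor_eq_cofactor hx (nodup_swap_mid (nodup_swap_last h)), hx.2.1 l k, hx.2.1 l j]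
  have e2 : edgeCofactor (x i k) (x j l) (x i j) (x k l) (x i l) (x j k) = cofactor x i k := by
    rw [← edgeCofactor_eq_cofactor hx (nodup_swap_mid h), hx.2.1 k j]
  have e3 : edgeCofactor (x j l) (x i k) (x i j) (x k l) (x j k) (x i l) = cofactor x j l := by
    rw [← edgeCofactor_eq_cofactor hx (nodup_swap_mid (nodup_swap_last (nodup_swap_fst h))),
      hx.2.1 l k, hx.2.1 l i, hx.2.1 j i]
  have e4 : edgeCofactor (x j k) (x i l) (x i j) (x k l) (x j l) (x i k) = cofactor x j k := by
    rw [← edgeCofactor_eq_cofactor hx (nodup_swap_mid (nodup_swap_fst h)), hx.2.1 k i, hx.2.1 j i]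
  refine this.congr_deriv ?_
  rw [hg, edgeLengthDeriv, diagCoeff, vertexGram_eq_vertexDet x h, e1, e2, e3, e4, hx.2.1 i j,
    vertexGram_eq_vertexDet x (nodup_swap_fst h)]

end AngleStructures3

end

/-! ### Continuity and closedness of the Schläfli form -/

noncomputable section

open Topology

namespace AngleStructures3

variable {x y : Fin 4 → Fin 4 → ℝ}

/-- The Schläfli form as a field of covectors on `domain`. -/
def schlaefliCovector (x : Fin 4 → Fin 4 → ℝ) : (Fin 4 → Fin 4 → ℝ) →L[ℝ] ℝ :=
  (1 / 2 : ℝ) • ∑ i, ∑ j ∈ Finset.Ioi i, edgeLength (symmetrize x) i j •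
    (ContinuousLinearMap.proj (φ := fun _ : Fin 4 => ℝ) j).comp
      (ContinuousLinearMap.proj (R := ℝ) (φ := fun _ : Fin 4 => Fin 4 → ℝ) i)

theorem schlaefliCovector_apply (x w : Fin 4 → Fin 4 → ℝ) :
    schlaefliCovector x w = schlaefliForm (symmetrize x) w := by
  simp [schlaefliCovector, schlaefliForm]

theorem schlaefliForm_symmetrize (x w : Fin 4 → Fin 4 → ℝ) :
    schlaefliForm x (symmetrize w) = schlaefliForm x w := by
  unfold schlaefliForm
  refine congrArg _ (Finset.sum_congr rfl fun i _ => Finset.sum_congr rfl fun j hj => ?_)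
  rw [symmetrize_of_lt w (Finset.mem_Ioi.1 hj)]

theorem contDiff_symmetrize_apply (i j : Fin 4) :
    ContDiff ℝ 1 fun x : Fin 4 → Fin 4 → ℝ => symmetrize x i j :=
  (((ContinuousLinearMap.proj (φ := fun _ : Fin 4 => ℝ) j).comp
      (ContinuousLinearMap.proj (R := ℝ) (φ := fun _ : Fin 4 => Fin 4 → ℝ) i)).comp
        symmetrize).contDiff

theorem contDiff_vertexGram (f g h : (Fin 4 → Fin 4 → ℝ) → ℝ) (hf : ContDiff ℝ 1 f)
    (hg : ContDiff ℝ 1 g) (hh : ContDiff ℝ 1 h) :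
    ContDiff ℝ 1 fun x => vertexGram (f x) (g x) (h x) := by
  unfold vertexGram
  fun_prop

theorem contDiff_gramDet :
    ContDiff ℝ 1 fun x : Fin 4 → Fin 4 → ℝ => gramDet (symmetrize x) := by
  have h := contDiff_symmetrize_apply
  unfold gramDet gramPoly
  fun_prop

theorem contDiffAt_edgeCos (hx : x ∈ domain) {i j k l : Fin 4} (h : [i, j, k, l].Nodup) :
    ContDiffAt ℝ 1 (fun x => edgeCos (symmetrize x) i j k l) x := by
  have hc := contDiff_symmetrize_apply
  have hpos := vertexGram_mul_pos hx h
  unfold edgeCos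
  refine ContDiffAt.div ?_ (ContDiffAt.sqrt ?_ ?_) ?_
  · unfold edgeCofactor
    fun_prop
  · exact ((contDiff_vertexGram _ _ _ (hc _ _) (hc _ _) (hc _ _)).mul
      (contDiff_vertexGram _ _ _ (hc _ _) (hc _ _) (hc _ _))).contDiffAt
  · exact hpos.ne'
  · exact (Real.sqrt_pos.2 hpos).ne'

theorem edgeLength_eventuallyEq (hx : x ∈ domain) {i j k l : Fin 4} (h : [i, j, k, l].Nodup) :
    (fun x => edgeLength (symmetrize x) i j) =ᶠ[𝓝 x]
      fun x => extArccos (edgeCos (symmetrize x) i j k l) := by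
  filter_upwards [isOpen_domain.mem_nhds hx] with y hy
  exact edgeLength_eq hy h

theorem contDiffAt_edgeLength (hx : x ∈ domain) (hD : gramDet (symmetrize x) ≠ 0) {i j : Fin 4}
    (hij : i ≠ j) : ContDiffAt ℝ 1 (fun x => edgeLength (symmetrize x) i j) x := by
  have h := nodup_thirdVertex_fourthVertex i j hij
  refine ContDiffAt.congr_of_eventuallyEq ?_ (edgeLength_eventuallyEq hx h)
  have hF := one_sub_edgeCos_sq hx h
  have hF0 : 1 - edgeCos (symmetrize x) i j (thirdVertex i j) (fourthVertex i j) ^ 2 ≠ 0 := by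
    rw [hF]
    exact div_ne_zero (mul_ne_zero hD (pow_ne_zero 2 (sin_pos hx hij).ne'))
      (vertexGram_mul_pos hx h).ne'
  exact (extArccos_contDiffAt_and_hasDerivAt (fun e => hF0 (by rw [e]; ring))
    (fun e => hF0 (by rw [e]; ring))).1.comp x (contDiffAt_edgeCos hx h)

theorem continuousAt_edgeLength (hx : x ∈ domain) {i j : Fin 4} (hij : i ≠ j) :
    ContinuousAt (fun x => edgeLength (symmetrize x) i j) x := by
  have h := nodup_thirdVertex_fourthVertex i j hij
  refine ContinuousAt.congr ?_ (edgeLength_eventuallyEq hx h).symm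
  exact continuous_extArccos.continuousAt.comp (contDiffAt_edgeCos hx h).continuousAt

theorem fderiv_edgeLength (hx : x ∈ domain) (hD : gramDet (symmetrize x) ≠ 0)
    (v : Fin 4 → Fin 4 → ℝ) {i j k l : Fin 4} (h : [i, j, k, l].Nodup) :
    fderiv ℝ (fun x => edgeLength (symmetrize x) i j) x v =
      edgeLengthDeriv (symmetrize x) (symmetrize v) i j k l := by
  have h1 := ((contDiffAt_edgeLength hx hD (ne_of_nodup h)).differentiableAt
    one_ne_zero).hasFDerivAt
  have h2 : HasDerivAt (fun t : ℝ => x + t • v) v 0 := by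
    simpa using ((hasDerivAt_id (0 : ℝ)).smul_const v).const_add x
  have h3 := HasFDerivAt.comp_hasDerivAt_of_eq (0 : ℝ) h1 h2 (by simp)
  have h4 := hasDerivAt_edgeCos hx hD (symmetrize v) h
  refine h3.unique (h4.congr_of_eventuallyEq ?_)
  have h5 : Filter.Tendsto (fun t : ℝ => x + t • v) (𝓝 0) (𝓝 x) := by
    have := h2.continuousAt.tendsto
    simpa using this
  filter_upwards [h5.eventually (edgeLength_eventuallyEq hx h)] with t ht
  simp only [Function.comp_apply, ht]
  rw [map_add, map_smul]

theorem sum_Ioi (g : Fin 4 → Fin 4 → ℝ) : ∑ i, ∑ j ∈ Finset.Ioi i, g i j =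
    g 0 1 + g 0 2 + g 0 3 + g 1 2 + g 1 3 + g 2 3 := by
  have h0 : Finset.Ioi (0 : Fin 4) = {1, 2, 3} := by decide
  have h1 : Finset.Ioi (1 : Fin 4) = {2, 3} := by decide
  have h2 : Finset.Ioi (2 : Fin 4) = {3} := by decide
  have h3 : Finset.Ioi (3 : Fin 4) = ∅ := by decide
  rw [Fin.sum_univ_four, h0, h1, h2, h3]
  simp
  ring

/-- Symmetry of the Jacobian of the lengths, read off from the form of its coefficients once
`cofactor` is known to be symmetric. -/
theorem sum_edgeLengthDeriv_comm (hx : x ∈ AngleStructures3) {v w : Fin 4 → Fin 4 → ℝ}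
    (hv : ∀ i j, v i j = v j i) (hw : ∀ i j, w i j = w j i) :
    edgeLengthDeriv x v 0 1 2 3 * w 0 1 + edgeLengthDeriv x v 0 2 1 3 * w 0 2 +
      edgeLengthDeriv x v 0 3 1 2 * w 0 3 + edgeLengthDeriv x v 1 2 0 3 * w 1 2 +
      edgeLengthDeriv x v 1 3 0 2 * w 1 3 + edgeLengthDeriv x v 2 3 0 1 * w 2 3 =
    edgeLengthDeriv x w 0 1 2 3 * v 0 1 + edgeLengthDeriv x w 0 2 1 3 * v 0 2 +
      edgeLengthDeriv x w 0 3 1 2 * v 0 3 + edgeLengthDeriv x w 1 2 0 3 * v 1 2 +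
      edgeLengthDeriv x w 1 3 0 2 * v 1 3 + edgeLengthDeriv x w 2 3 0 1 * v 2 3 := by
  simp only [edgeLengthDeriv, hx.2.1 1 0, hx.2.1 2 0, hx.2.1 3 0, hx.2.1 2 1, hx.2.1 3 1,
    hx.2.1 3 2, hv 1 0, hv 2 0, hv 3 0, hv 2 1, hv 3 1, hv 3 2, hw 1 0, hw 2 0, hw 3 0, hw 2 1,
    hw 3 1, hw 3 2,
    cofactor_comm hx (show (1 : Fin 4) ≠ 0 by decide),
    cofactor_comm hx (show (2 : Fin 4) ≠ 0 by decide),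
    cofactor_comm hx (show (3 : Fin 4) ≠ 0 by decide),
    cofactor_comm hx (show (2 : Fin 4) ≠ 1 by decide),
    cofactor_comm hx (show (3 : Fin 4) ≠ 1 by decide),
    cofactor_comm hx (show (3 : Fin 4) ≠ 2 by decide)]
  ring

theorem contDiffAt_schlaefliCovector (hx : x ∈ domain) (hD : gramDet (symmetrize x) ≠ 0) :
    ContDiffAt ℝ 1 schlaefliCovector x := by
  unfold schlaefliCovector
  refine ContDiffAt.const_smul _ (ContDiffAt.sum fun i _ => ContDiffAt.sum fun j hj => ?_)
  exact (contDiffAt_edgeLength hx hD (Finset.mem_Ioi.1 hj).ne).smul contDiffAt_const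

theorem continuousOn_schlaefliCovector : ContinuousOn schlaefliCovector domain := by
  have h : ∀ i, ∀ j ∈ Finset.Ioi i,
      ContinuousOn (fun x => edgeLength (symmetrize x) i j) domain := fun i j hj x hx =>
    (continuousAt_edgeLength hx (Finset.mem_Ioi.1 hj).ne).continuousWithinAt
  rw [continuousOn_clm_apply]
  intro w
  simp only [schlaefliCovector_apply, schlaefliForm]
  exact continuousOn_const.mul (continuousOn_finsetSum _ fun i _ => continuousOn_finsetSum _
    fun j hj => (h i j hj).mul continuousOn_const)

theorem fderiv_schlaefliCovector_comm (hx : x ∈ domain) (hD : gramDet (symmetrize x) ≠ 0)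
    (v w : Fin 4 → Fin 4 → ℝ) :
    fderiv ℝ schlaefliCovector x v w = fderiv ℝ schlaefliCovector x w v := by
  have key : ∀ v w : Fin 4 → Fin 4 → ℝ, fderiv ℝ schlaefliCovector x v w =
      (1 / 2) * ∑ i, ∑ j ∈ Finset.Ioi i,
        fderiv ℝ (fun x => edgeLength (symmetrize x) i j) x v * symmetrize w i j := by
    intro v w
    have hd : HasFDerivAt (fun y => schlaefliCovector y w)
        ((1 / 2 : ℝ) • ∑ i, ∑ j ∈ Finset.Ioi i,
          w i j • fderiv ℝ (fun x => edgeLength (symmetrize x) i j) x) x := by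
      simp only [schlaefliCovector_apply, schlaefliForm]
      refine HasFDerivAt.const_mul (HasFDerivAt.fun_sum fun i _ => HasFDerivAt.fun_sum
        fun j hj => HasFDerivAt.mul_const ?_ _) _
      exact ((contDiffAt_edgeLength hx hD (Finset.mem_Ioi.1 hj).ne).differentiableAt
        one_ne_zero).hasFDerivAt
    have he := (((contDiffAt_schlaefliCovector hx hD).differentiableAt
      one_ne_zero).hasFDerivAt.clm_apply (hasFDerivAt_const w x)).unique hd
    have he := DFunLike.congr_fun he v
    simp at he
    rw [he]
    simp only [one_div]
    congr 1
    refine Finset.sum_congr rfl fun i _ => Finset.sum_congr rfl fun j hj => ?_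
    rw [symmetrize_of_lt w (Finset.mem_Ioi.1 hj), mul_comm]
  rw [key, key]
  congr 1
  rw [sum_Ioi, sum_Ioi]
  simp only [fderiv_edgeLength hx hD _ (show [(0 : Fin 4), 1, 2, 3].Nodup by decide),
    fderiv_edgeLength hx hD _ (show [(0 : Fin 4), 2, 1, 3].Nodup by decide),
    fderiv_edgeLength hx hD _ (show [(0 : Fin 4), 3, 1, 2].Nodup by decide),
    fderiv_edgeLength hx hD _ (show [(1 : Fin 4), 2, 0, 3].Nodup by decide),
    fderiv_edgeLength hx hD _ (show [(1 : Fin 4), 3, 0, 2].Nodup by decide),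
    fderiv_edgeLength hx hD _ (show [(2 : Fin 4), 3, 0, 1].Nodup by decide)]
  exact sum_edgeLengthDeriv_comm hx (symmetrize_comm v) (symmetrize_comm w)

end AngleStructures3

end

/-! ### Local primitives across a regular level set -/

noncomputable section

section Primitive

open Set Filter Topology

variable {E : Type*} [NormedAddCommGroup E] [NormedSpace ℝ E]

/-- A continuous 1-form that is closed off a level set and vanishes on it is locally exact at the
regular points of the level set. -/
theorem exists_primitive_of_vanishing_on_level [FiniteDimensional ℝ E] {η : E → E →L[ℝ] ℝ}
    {D : E → ℝ} {s : Set E} {z : E} (hs : IsOpen s) (hz : z ∈ s) (hη : ContinuousOn η s)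
    (hD : ContDiffOn ℝ 1 D s) (h0 : ∀ x ∈ s, D x = 0 → η x = 0)
    (h1 : ∀ x ∈ s, D x ≠ 0 → ContDiffAt ℝ 1 η x)
    (h2 : ∀ x ∈ s, D x ≠ 0 → ∀ u v, fderiv ℝ η x u v = fderiv ℝ η x v u)
    {u : E} (hu : fderiv ℝ D z u ≠ 0) :
    ∃ U : E → ℝ, ∀ᶠ x in 𝓝 z, HasFDerivAt U (η x) x := by
  classical
  -- The form is split into its restrictions to the two sides of the level set, each extended by
  -- zero; their primitives are added.
  have half : ∀ D : E → ℝ, ContDiffOn ℝ 1 D s → (∀ x ∈ s, D x = 0 → η x = 0) →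
      (∀ x ∈ s, D x ≠ 0 → ContDiffAt ℝ 1 η x) →
      (∀ x ∈ s, D x ≠ 0 → ∀ u v, fderiv ℝ η x u v = fderiv ℝ η x v u) →
      fderiv ℝ D z u ≠ 0 →
      ∃ U : E → ℝ, ∀ᶠ x in 𝓝 z, HasFDerivAt U (if 0 < D x then η x else 0) x := by
    intro D hD h0 h1 h2 hu
    have hDc : ∀ x ∈ s, ContinuousAt D x := fun x hx => hD.continuousOn.continuousAt (hs.mem_nhds hx)
    have heq : ∀ x ∈ s, 0 < D x → (fun x => if 0 < D x then η x else 0) =ᶠ[𝓝 x] η := by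
      intro x hx hpos
      filter_upwards [(hDc x hx).eventually (lt_mem_nhds hpos)] with y hy
      rw [if_pos hy]
    have hc : ContinuousOn (fun x => if 0 < D x then η x else 0) s := by
      intro x hx
      refine ContinuousAt.continuousWithinAt ?_
      have hηx := hη.continuousAt (hs.mem_nhds hx)
      rcases lt_trichotomy (D x) 0 with h | h | h
      · have : (fun x => if 0 < D x then η x else 0) =ᶠ[𝓝 x] fun _ => 0 := by
          filter_upwards [(hDc x hx).eventually (gt_mem_nhds h)] with y hy
          rw [if_neg hy.le.not_gt]
        exact continuousAt_const.congr this.symm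
      · have hx0 := h0 x hx h
        rw [ContinuousAt, hx0] at hηx
        rw [ContinuousAt, if_neg h.le.not_gt]
        refine squeeze_zero_norm (fun y => ?_) (tendsto_zero_iff_norm_tendsto_zero.1 hηx)
        split_ifs <;> simp
      · exact hηx.congr (heq x hx h).symm
    obtain ⟨v, hv⟩ : ∃ v, 0 < fderiv ℝ D z v := by
      rcases lt_or_gt_of_ne hu with h | h
      · exact ⟨-u, by simpa using h⟩
      · exact ⟨u, h⟩
    refine exists_primitive_of_vanishing hs hz hc hD (fun x _ hx => if_neg hx.not_gt)
      (fun x hx hpos => (h1 x hx hpos.ne').congr_of_eventuallyEq (heq x hx hpos))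
      (fun x hx hpos a b => ?_) hv
    rw [(heq x hx hpos).fderiv_eq]
    exact h2 x hx hpos.ne' a b
  obtain ⟨U, hU⟩ := half D hD h0 h1 h2 hu
  obtain ⟨V, hV⟩ := half (fun x => -D x) hD.neg (fun x hx h => h0 x hx (by linarith))
    (fun x hx h => h1 x hx (by simpa using h)) (fun x hx h => h2 x hx (by simpa using h))
    (by rw [fderiv_fun_neg]; simpa using hu)
  refine ⟨fun x => U x + V x, ?_⟩
  filter_upwards [hU, hV, hs.mem_nhds hz] with x hx hx' hxs
  refine (hx.add hx').congr_fderiv ?_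
  rcases lt_trichotomy (D x) 0 with h | h | h
  · rw [if_neg h.le.not_gt, if_pos (by linarith), zero_add]
  · rw [if_neg h.le.not_gt, if_neg (by linarith), zero_add, h0 x hxs h]
  · rw [if_pos h, if_neg (by linarith), add_zero]

/-- A continuous 1-form that is closed off a level set and constant on it is locally exact at the
regular points of the level set. -/
theorem exists_primitive_of_const_on_level [FiniteDimensional ℝ E] {ω : E → E →L[ℝ] ℝ}
    {D : E → ℝ} {s : Set E} {z : E} (hs : IsOpen s) (hz : z ∈ s) (hω : ContinuousOn ω s)
    (hD : ContDiffOn ℝ 1 D s) (h0 : ∀ x ∈ s, D x = 0 → ω x = ω z)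
    (h1 : ∀ x ∈ s, D x ≠ 0 → ContDiffAt ℝ 1 ω x)
    (h2 : ∀ x ∈ s, D x ≠ 0 → ∀ u v, fderiv ℝ ω x u v = fderiv ℝ ω x v u)
    {u : E} (hu : fderiv ℝ D z u ≠ 0) :
    ∃ U : E → ℝ, ∀ᶠ x in 𝓝 z, HasFDerivAt U (ω x) x := by
  obtain ⟨U, hU⟩ := exists_primitive_of_vanishing_on_level (η := fun x => ω x - ω z) hs hz
    (hω.sub continuousOn_const) hD (fun x hx h => sub_eq_zero.2 (h0 x hx h))
    (fun x hx h => (h1 x hx h).sub contDiffAt_const)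
    (fun x hx h a b => by
      rw [fderiv_sub_const]
      exact h2 x hx h a b) hu
  refine ⟨fun x => U x + ω z x, hU.mono fun x hx => ?_⟩
  exact (hx.add (ω z).hasFDerivAt).congr_fderiv (sub_add_cancel _ _)

end Primitive

/-! ### The differential of the volume -/

namespace AngleStructures3

open Topology

variable {x : Fin 4 → Fin 4 → ℝ}

theorem edgeCos_sq_eq_one (hx : x ∈ AngleStructures3) (hD : gramDet x = 0) {i j k l : Fin 4}
    (h : [i, j, k, l].Nodup) : edgeCos x i j k l ^ 2 = 1 := by
  have := one_sub_edgeCos_sq hx h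
  rw [hD, zero_mul, zero_div] at this
  linarith

/-- Where `gramDet` vanishes, `edgeCos` is `1` or `-1`, and by continuity it cannot jump from one to
the other. -/
theorem edgeLength_eventually_eq (hx : x ∈ domain) (hD : gramDet (symmetrize x) = 0)
    {i j : Fin 4} (hij : i ≠ j) : ∀ᶠ y in 𝓝 x, gramDet (symmetrize y) = 0 →
      edgeLength (symmetrize y) i j = edgeLength (symmetrize x) i j := by
  have h := nodup_thirdVertex_fourthVertex i j hij
  filter_upwards [isOpen_domain.mem_nhds hx, Metric.tendsto_nhds.1
    (contDiffAt_edgeCos hx h).continuousAt 1 one_pos] with y hy hd hDy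
  rw [edgeLength_eq hy h, edgeLength_eq hx h]
  have h1 := edgeCos_sq_eq_one hx hD h
  have h2 := edgeCos_sq_eq_one hy hDy h
  rw [Real.dist_eq, abs_lt] at hd
  rcases sq_eq_sq_iff_eq_or_eq_neg.1 (h2.trans h1.symm) with he | he
  · rw [he]
  · rw [he] at hd
    nlinarith

/-- The derivative by the angle `x 2 3` is `2 * sin (x 2 3)` times the cofactor at the opposite edge
`01`, and cofactors do not vanish when `gramDet ≤ 0`. -/
theorem fderiv_gramDet_ne_zero (hx : x ∈ domain) (hD : gramDet (symmetrize x) = 0) :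
    fderiv ℝ (fun x => gramDet (symmetrize x)) x (Pi.single 2 (Pi.single 3 1)) ≠ 0 := by
  set u : Fin 4 → Fin 4 → ℝ := Pi.single 2 (Pi.single 3 1) with hu
  have h1 := (contDiff_gramDet.differentiable one_ne_zero x).hasFDerivAt
  have h2 : HasDerivAt (fun t : ℝ => x + t • u) u 0 := by
    simpa using ((hasDerivAt_id (0 : ℝ)).smul_const u).const_add x
  have h3 := HasFDerivAt.comp_hasDerivAt_of_eq (0 : ℝ) h1 h2 (by simp)
  set y := symmetrize x with hy
  have h4 : HasDerivAt (fun t : ℝ => gramPoly (y 0 1) (y 2 3 + t) (y 0 2) (y 1 3) (y 0 3) (y 1 2))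
      (2 * Real.sin (y 2 3) *
        edgeCofactor (y 0 1) (y 2 3) (y 0 2) (y 1 3) (y 0 3) (y 1 2)) 0 := by
    have hc : HasDerivAt (fun t : ℝ => Real.cos (y 2 3 + t)) (-Real.sin (y 2 3)) 0 := by
      simpa using ((hasDerivAt_id (0 : ℝ)).const_add (y 2 3)).cos
    -- The determinant as a quadratic polynomial in `cos a'`; putting `π / 2` for `a'` leaves its
    -- constant term.
    have he : ∀ a a' b b' c c' : ℝ, gramPoly a a' b b' c c' =
        (-(Real.sin a ^ 2) * Real.cos a' ^ 2 +
          -2 * (edgeCofactor a a' b b' c c' - Real.sin a ^ 2 * Real.cos a') * Real.cos a') +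
        gramPoly a (Real.pi / 2) b b' c c' := by
      intro a a' b b' c c'
      simp only [gramPoly, edgeCofactor, Real.sin_sq, Real.cos_pi_div_two]
      ring
    have hq : HasDerivAt (fun t : ℝ => (-(Real.sin (y 0 1) ^ 2) * Real.cos (y 2 3 + t) ^ 2 +
        -2 * (edgeCofactor (y 0 1) (y 2 3) (y 0 2) (y 1 3) (y 0 3) (y 1 2) -
          Real.sin (y 0 1) ^ 2 * Real.cos (y 2 3)) * Real.cos (y 2 3 + t)) +
        gramPoly (y 0 1) (Real.pi / 2) (y 0 2) (y 1 3) (y 0 3) (y 1 2))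
        (2 * Real.sin (y 2 3) *
          edgeCofactor (y 0 1) (y 2 3) (y 0 2) (y 1 3) (y 0 3) (y 1 2)) 0 := by
      refine (((hc.pow 2).const_mul _).add (hc.const_mul _)).add_const _ |>.congr_deriv ?_
      simp
      ring
    refine hq.congr_of_eventuallyEq (Filter.Eventually.of_forall fun t => ?_)
    simp only []
    rw [he]
    simp only [edgeCofactor]
    ring
  have h5 : (fun x => gramDet (symmetrize x)) ∘ (fun t : ℝ => x + t • u) =
      fun t : ℝ => gramPoly (y 0 1) (y 2 3 + t) (y 0 2) (y 1 3) (y 0 3) (y 1 2) := by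
    funext t
    simp [gramDet, hy, hu, symmetrize_apply]
  rw [h5] at h3
  rw [h3.unique h4]
  have hne := edgeCofactor_ne_zero hx hD.le (show [(0 : Fin 4), 1, 2, 3].Nodup by decide)
  have hs := sin_pos hx (show (2 : Fin 4) ≠ 3 by decide)
  exact mul_ne_zero (mul_ne_zero two_ne_zero hs.ne') hne

/-- Off `gramDet = 0` this is the Poincaré lemma on a ball. At a point with `gramDet = 0`, the form
is constant along this regular level set and closed beside it. -/
theorem exists_local_primitive {z : Fin 4 → Fin 4 → ℝ} (hz : z ∈ domain) :
    ∃ U, ∀ᶠ x in 𝓝 z, HasFDerivAt U (schlaefliCovector x) x := by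
  by_cases hD : gramDet (symmetrize z) = 0
  · have hev : ∀ᶠ x in 𝓝 z, x ∈ domain ∧ (gramDet (symmetrize x) = 0 →
        schlaefliCovector x = schlaefliCovector z) := by
      have h1 : ∀ᶠ x in 𝓝 z, ∀ i j : Fin 4, i ≠ j → gramDet (symmetrize x) = 0 →
          edgeLength (symmetrize x) i j = edgeLength (symmetrize z) i j := by
        simp only [Filter.eventually_all]
        exact fun i j hij => edgeLength_eventually_eq hz hD hij
      filter_upwards [isOpen_domain.mem_nhds hz, h1] with x hx h
      refine ⟨hx, fun h0 => ?_⟩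
      unfold schlaefliCovector
      congr 1
      refine Finset.sum_congr rfl fun i _ => Finset.sum_congr rfl fun j hj => ?_
      rw [h i j (Finset.mem_Ioi.1 hj).ne h0]
    obtain ⟨s, hs, hso, hzs⟩ := eventually_nhds_iff.1 hev
    exact exists_primitive_of_const_on_level hso hzs
      (continuousOn_schlaefliCovector.mono fun x hx => (hs x hx).1)
      contDiff_gramDet.contDiffOn (fun x hx => (hs x hx).2)
      (fun x hx => contDiffAt_schlaefliCovector (hs x hx).1)
      (fun x hx => fderiv_schlaefliCovector_comm (hs x hx).1) (fderiv_gramDet_ne_zero hz hD)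
  · have hev : ∀ᶠ x in 𝓝 z, x ∈ domain ∧ gramDet (symmetrize x) ≠ 0 :=
      Filter.Eventually.and (isOpen_domain.mem_nhds hz)
        (contDiff_gramDet.continuous.continuousAt.eventually_ne hD)
    obtain ⟨r, hr, hball⟩ := Metric.eventually_nhds_iff_ball.1 hev
    obtain ⟨U, hU⟩ := Convex.exists_forall_hasFDerivAt_of_fderiv_symmetric (convex_ball z r)
      Metric.isOpen_ball (ω := schlaefliCovector)
      (fun x hx => ((contDiffAt_schlaefliCovector (hball x hx).1 (hball x hx).2).differentiableAt
        one_ne_zero).differentiableWithinAt)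
      (fun x hx u v => fderiv_schlaefliCovector_comm (hball x hx).1 (hball x hx).2 u v)
    exact ⟨U, Filter.eventually_of_mem (Metric.ball_mem_nhds z hr) hU⟩

/-- By definition the volume is the ray integral of a locally exact form over a convex set, with the
regular tetrahedron as centre. -/
theorem hasFDerivAt_tetVolume (hx : x ∈ domain) :
    HasFDerivAt (fun x => tetVolume (symmetrize x)) (schlaefliCovector x) x := by
  have hreg := symmetrize_eq_self regularAngles_mem
  have hmem : regularAngles ∈ domain := by
    rw [domain, Set.mem_preimage, hreg]
    exact regularAngles_mem
  refine (hasFDerivAt_integral_ray (a := regularAngles) isOpen_domain (fun y hy t ht => ?_)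
    continuousOn_schlaefliCovector (fun z hz => exists_local_primitive hz)
    hx).congr_of_eventuallyEq (Filter.Eventually.of_forall fun y => ?_)
  · have := convex_domain.add_smul_sub_mem hmem hy ht
    exact this
  · refine intervalIntegral.integral_congr fun t _ => ?_
    rw [schlaefliCovector_apply, ← schlaefliForm_symmetrize _ (y - regularAngles), map_add,
      map_smul, map_sub, hreg]

end AngleStructures3

end

/-! ### Critical points: glued edges have equal lengths -/

noncomputable section

open Topology

theorem hasDerivAt_add_smul {F : Type*} [NormedAddCommGroup F] [NormedSpace ℝ F] (x v : F) :
    HasDerivAt (fun s : ℝ => x + s • v) v 0 := by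
  simpa using ((hasDerivAt_id (0 : ℝ)).smul_const v).const_add x

namespace Triangulation

variable {ι : Type*} {M : Type*} [TopologicalSpace M] [Fintype ι]

theorem symmetrize_add_smul {x : Fin 4 → Fin 4 → ℝ} (hx : x ∈ AngleStructures3) (s : ℝ)
    (u : Fin 4 → Fin 4 → ℝ) : symmetrize (x + s • u) = x + s • symmetrize u := by
  rw [map_add, map_smul, AngleStructures3.symmetrize_eq_self hx]

/-- The derivative of the volume along a line in `AS(M, T)` is computed twice, by criticality and by
the Schläfli form. -/
theorem sum_schlaefliForm_eq_zero (T : Triangulation ι M) {p : ι → Fin 4 → Fin 4 → ℝ}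
    (hp : T.IsCriticalPoint p) {u : ι → Fin 4 → Fin 4 → ℝ}
    (hu : ∀ᶠ s : ℝ in 𝓝 0, (fun σ => p σ + s • symmetrize (u σ)) ∈ T.angleStructures) :
    ∑ σ, schlaefliForm (p σ) (u σ) = 0 := by
  have hdom : ∀ σ, p σ ∈ AngleStructures3.domain := fun σ => by
    rw [AngleStructures3.domain, Set.mem_preimage,
      AngleStructures3.symmetrize_eq_self (hp.1.1 σ)]
    exact hp.1.1 σ
  have h1 : HasDerivAt (fun s : ℝ => T.volume (p + s • fun σ => symmetrize (u σ))) 0 0 := by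
    have := HasFDerivWithinAt.comp_hasDerivAt_of_eq (0 : ℝ) hp.2
      (hasDerivAt_add_smul p fun σ => symmetrize (u σ)) hu (by simp)
    exact this
  have h2 : HasDerivAt (fun s : ℝ => T.volume (p + s • fun σ => symmetrize (u σ)))
      (∑ σ, schlaefliForm (p σ) (u σ)) 0 := by
    have h3 : ∀ σ, HasDerivAt (fun s : ℝ => tetVolume (p σ + s • symmetrize (u σ)))
        (schlaefliForm (p σ) (u σ)) 0 := fun σ => by
      have := HasFDerivAt.comp_hasDerivAt_of_eq (0 : ℝ)
        (AngleStructures3.hasFDerivAt_tetVolume (hdom σ)) (hasDerivAt_add_smul (p σ) (u σ)) (by simp)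
      rw [AngleStructures3.schlaefliCovector_apply,
        AngleStructures3.symmetrize_eq_self (hp.1.1 σ)] at this
      refine this.congr_of_eventuallyEq (Filter.Eventually.of_forall fun s => ?_)
      simp only [Function.comp_apply]
      rw [symmetrize_add_smul (hp.1.1 σ)]
    exact HasDerivAt.fun_sum fun σ _ => h3 σ
  exact h2.unique h1

/-- Moving angle from the edge `b` to the edge `a` of the same class keeps all angle sums, and the
Schläfli form of this direction is half the difference of the two lengths. -/
theorem edgeLength_eq_of_mk_eq (T : Triangulation ι M) {p : ι → Fin 4 → Fin 4 → ℝ}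
    (hp : T.IsCriticalPoint p) {a b : ι × TetEdge}
    (hab : (Quot.mk _ a : T.toFaceGluing.Edge) = Quot.mk _ b) :
    edgeLength (p a.1) a.2.1.1 a.2.1.2 = edgeLength (p b.1) b.2.1.1 b.2.1.2 := by
  classical
  set u : ι → Fin 4 → Fin 4 → ℝ := fun σ i j => if h : i < j then
    (if (σ, (⟨(i, j), h⟩ : TetEdge)) = a then 1 else 0) -
      (if (σ, (⟨(i, j), h⟩ : TetEdge)) = b then 1 else 0) else 0 with hu
  have hue : ∀ c : ι × TetEdge, u c.1 c.2.1.1 c.2.1.2 =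
      (if c = a then 1 else 0) - (if c = b then 1 else 0) := fun c => dif_pos c.2.2
  have hmem : ∀ᶠ s : ℝ in 𝓝 0, (fun σ => p σ + s • symmetrize (u σ)) ∈ T.angleStructures := by
    have h1 : ∀ᶠ s : ℝ in 𝓝 0, ∀ σ, p σ + s • symmetrize (u σ) ∈ AngleStructures3 := by
      rw [Filter.eventually_all]
      intro σ
      have hc : ContinuousAt (fun s : ℝ => p σ + s • u σ) 0 := by fun_prop
      have hd : AngleStructures3.domain ∈ 𝓝 (p σ + (0 : ℝ) • u σ) := by
        refine AngleStructures3.isOpen_domain.mem_nhds ?_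
        rw [AngleStructures3.domain, Set.mem_preimage, symmetrize_add_smul (hp.1.1 σ), zero_smul,
          add_zero]
        exact hp.1.1 σ
      filter_upwards [hc hd] with s hs
      rw [← symmetrize_add_smul (hp.1.1 σ)]
      exact hs
    filter_upwards [h1] with s hs
    refine ⟨hs, fun e => ?_⟩
    have h2 : ∀ c : ι × TetEdge, (p c.1 + s • symmetrize (u c.1)) c.2.1.1 c.2.1.2 =
        p c.1 c.2.1.1 c.2.1.2 + s * ((if c = a then 1 else 0) - (if c = b then 1 else 0)) := by
      intro c
      rw [← hue, ← symmetrize_of_lt (u c.1) c.2.2]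
      rfl
    have h3 := hp.1.2 e
    rw [← h3, ← sub_eq_zero, ← Finset.sum_sub_distrib]
    have h4 : ∀ c : ι × TetEdge,
        ((if (Quot.mk _ c : T.toFaceGluing.Edge) = e then
            (p c.1 + s • symmetrize (u c.1)) c.2.1.1 c.2.1.2 else 0) -
          if (Quot.mk _ c : T.toFaceGluing.Edge) = e then p c.1 c.2.1.1 c.2.1.2 else 0) =
        s * ((if c = a then if (Quot.mk _ a : T.toFaceGluing.Edge) = e then 1 else 0 else 0) -
          if c = b then if (Quot.mk _ b : T.toFaceGluing.Edge) = e then 1 else 0 else 0) := by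
      intro c
      rw [h2]
      have h5 : ∀ d : ι × TetEdge,
          (if c = d then if (Quot.mk _ d : T.toFaceGluing.Edge) = e then (1 : ℝ) else 0 else 0) =
          if (Quot.mk _ c : T.toFaceGluing.Edge) = e then if c = d then 1 else 0 else 0 := by
        intro d
        by_cases h : c = d
        · rw [if_pos h, if_pos h, h]
        · rw [if_neg h, if_neg h, ite_self]
      rw [h5, h5]
      by_cases hc : (Quot.mk _ c : T.toFaceGluing.Edge) = e
      · simp only [if_pos hc]
        ring
      · simp only [if_neg hc]
        ring
    rw [Finset.sum_congr rfl fun c _ => h4 c, ← Finset.mul_sum, Finset.sum_sub_distrib,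
      Finset.sum_ite_eq', Finset.sum_ite_eq', hab]
    simp
  have h := T.sum_schlaefliForm_eq_zero hp hmem
  have hs : ∀ σ, schlaefliForm (p σ) (u σ) = (1 / 2) * ∑ e : TetEdge,
      edgeLength (p σ) e.1.1 e.1.2 *
        ((if (σ, e) = a then 1 else 0) - (if (σ, e) = b then 1 else 0)) := by
    intro σ
    rw [schlaefliForm, AngleStructures3.sum_Ioi,
      ← AngleStructures3.sum_tetEdge fun i j => edgeLength (p σ) i j * u σ i j]
    exact congrArg _ (Finset.sum_congr rfl fun e _ => by rw [← hue (σ, e)])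
  rw [Finset.sum_congr rfl fun σ _ => hs σ, ← Finset.mul_sum,
    ← Fintype.sum_prod_type' (f := fun σ (e : TetEdge) => edgeLength (p σ) e.1.1 e.1.2 *
        ((if (σ, e) = a then 1 else 0) - (if (σ, e) = b then 1 else 0)))] at h
  simp only [Prod.mk.eta, mul_sub, mul_ite, mul_one, mul_zero, Finset.sum_sub_distrib,
    Finset.sum_ite_eq', Finset.mem_univ, if_true] at h
  linarith

end Triangulation

end

noncomputable section

/-! ### Standard disks -/

theorem sum_add_sum_compl (x : Simplex3) (A : Finset (Fin 4)) :
    ∑ i ∈ A, x i + ∑ i ∈ Aᶜ, x i = 1 := by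
  rw [Finset.sum_add_sum_compl]
  exact stdSimplex.sum_eq_one x

theorem standardDisk_empty : standardDisk ∅ = ∅ := by
  ext x
  simp [standardDisk]

theorem standardDisk_compl (A : Finset (Fin 4)) : standardDisk Aᶜ = standardDisk A := by
  ext x
  have := sum_add_sum_compl x A
  simp only [standardDisk, Set.mem_ofPred_eq]
  constructor <;> intro h <;> linarith

theorem isNormalDisk_standardDisk {A : Finset (Fin 4)} (hA : A.Nonempty) (h0 : 0 ∉ A) :
    IsNormalDisk (standardDisk A) := by
  have h1 : ∀ B : Finset (Fin 4), B.card = 1 ∨ B.card = 2 → IsNormalDisk (standardDisk B) :=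
    fun B hB => ⟨B, hB, Homeomorph.refl _, fun x i => Iff.rfl, by simp⟩
  have hpos := hA.card_pos
  have hlt : A.card < 4 := (Finset.card_lt_univ_of_notMem h0).trans_eq (Fintype.card_fin 4)
  -- Three vertices are cut off from the fourth by the triangle around the fourth one.
  by_cases h3 : A.card = 3
  · rw [← standardDisk_compl]
    refine h1 _ (Or.inl ?_)
    rw [Finset.card_compl, h3, Fintype.card_fin]
  · exact h1 A (by omega)

theorem sum_eq_of_mem_simplexFace {x : Simplex3} {B : Finset (Fin 4)} (hx : x ∈ simplexFace B) :
    ∑ i ∈ B, x i = 1 := by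
  rw [← stdSimplex.sum_eq_one x]
  exact Finset.sum_subset (Finset.subset_univ B) fun i _ hi => hx i hi

/-- The standard disk of `A` meets only those faces that have vertices on both sides. -/
theorem exists_mem_notMem_of_mem_standardDisk {A B : Finset (Fin 4)} {x : Simplex3}
    (hx : x ∈ standardDisk A ∩ simplexFace B) : (∃ i ∈ B, i ∈ A) ∧ ∃ j ∈ B, j ∉ A := by
  have h1 : ∑ i ∈ A, x i = 1 / 2 := hx.1
  constructor
  · by_contra! h
    rw [Finset.sum_eq_zero fun i hi => hx.2 i fun hB => h i hB hi] at h1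
    norm_num at h1
  · by_contra! h
    have h2 := sum_add_sum_compl x A
    rw [h1, Finset.sum_eq_zero fun i hi =>
      hx.2 i fun hB => (Finset.mem_compl.1 hi) (h i hB)] at h2
    norm_num at h2

/-- The midpoint of an edge of the 3-simplex. -/
def midpoint3 (i j : Fin 4) (h : i ≠ j) : Simplex3 :=
  ⟨fun k => if k = i ∨ k = j then 1 / 2 else 0, fun k => by beta_reduce; split_ifs <;> norm_num, by
    rw [← Finset.sum_filter]
    have : (Finset.univ.filter fun k => k = i ∨ k = j) = {i, j} := by ext k; simp
    rw [this, Finset.sum_pair h]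
    norm_num⟩

theorem midpoint3_apply {i j : Fin 4} (h : i ≠ j) (k : Fin 4) :
    midpoint3 i j h k = if k = i ∨ k = j then 1 / 2 else 0 := rfl

theorem standardDisk_inter_simplexFace_pair {A : Finset (Fin 4)} {i j : Fin 4} (hij : i ≠ j)
    (h : ¬ (i ∈ A ↔ j ∈ A)) : standardDisk A ∩ simplexFace {i, j} = {midpoint3 i j hij} := by
  wlog hi : i ∈ A generalizing i j with H
  · have hj : j ∈ A := by tauto
    have := H hij.symm (by tauto) hj
    rw [Finset.pair_comm, this]
    congr 1
    ext k
    simp only [midpoint3_apply, or_comm]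
  have hj : j ∉ A := by tauto
  have hsum : ∀ x ∈ simplexFace {i, j}, ∑ k ∈ A, x k = x i := fun x hx =>
    Finset.sum_eq_single_of_mem i hi fun k hk hki => hx k fun hk' => by
      rcases Finset.mem_insert.1 hk' with h | h
      · exact hki h
      · rw [Finset.mem_singleton.1 h] at hk
        exact hj hk
  ext x
  rw [Set.mem_singleton_iff]
  constructor
  · rintro ⟨h1, h2⟩
    have h3 : x i = 1 / 2 := (hsum x h2).symm.trans h1
    have h4 := sum_eq_of_mem_simplexFace h2
    rw [Finset.sum_pair hij, h3] at h4
    ext k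
    rw [midpoint3_apply]
    split_ifs with hk
    · rcases hk with rfl | rfl
      · exact h3
      · linarith
    · exact h2 k (by simpa using hk)
  · rintro rfl
    have hm : midpoint3 i j hij ∈ simplexFace {i, j} := fun k hk => by
      rw [midpoint3_apply, if_neg (by simpa using hk)]
    refine ⟨?_, hm⟩
    rw [standardDisk, Set.mem_ofPred_eq, hsum _ hm, midpoint3_apply, if_pos (Or.inl rfl)]

/-- A standard disk has a point in the interior of the simplex. -/
theorem exists_mem_standardDisk_pos {A : Finset (Fin 4)} (hA : A.Nonempty) (h0 : 0 ∉ A) :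
    ∃ x ∈ standardDisk A, ∀ i, x i ≠ 0 := by
  have hA' : (Aᶜ).Nonempty := ⟨0, by simpa using h0⟩
  have c1 : (0 : ℝ) < A.card := by exact_mod_cast hA.card_pos
  have c2 : (0 : ℝ) < (Aᶜ).card := by exact_mod_cast hA'.card_pos
  have hs1 : ∑ i ∈ A, (if i ∈ A then 1 / (2 * (A.card : ℝ)) else 1 / (2 * ((Aᶜ).card : ℝ))) =
      1 / 2 := by
    rw [Finset.sum_congr rfl fun i hi => if_pos hi, Finset.sum_const, nsmul_eq_mul]
    field_simp
  have hs2 : ∑ i ∈ Aᶜ, (if i ∈ A then 1 / (2 * (A.card : ℝ)) else 1 / (2 * ((Aᶜ).card : ℝ))) =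
      1 / 2 := by
    rw [Finset.sum_congr rfl fun i hi => if_neg (Finset.mem_compl.1 hi), Finset.sum_const,
      nsmul_eq_mul]
    field_simp
  refine ⟨⟨fun i => if i ∈ A then 1 / (2 * (A.card : ℝ)) else 1 / (2 * ((Aᶜ).card : ℝ)),
    fun i => by beta_reduce; split_ifs <;> positivity, ?_⟩, hs1, fun i => ?_⟩
  · rw [← Finset.sum_add_sum_compl A, hs1, hs2]
    norm_num
  · change (if i ∈ A then 1 / (2 * (A.card : ℝ)) else 1 / (2 * ((Aᶜ).card : ℝ))) ≠ 0
    split_ifs <;> positivity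

theorem isPreconnected_standardDisk_inter (A B : Finset (Fin 4)) :
    IsPreconnected (standardDisk A ∩ simplexFace B) := by
  rw [← Topology.IsInducing.subtypeVal.isPreconnected_image]
  refine Convex.isPreconnected ?_
  rintro _ ⟨x, ⟨hx1, hx2⟩, rfl⟩ _ ⟨y, ⟨hy1, hy2⟩, rfl⟩ a b ha hb hab
  refine ⟨⟨a • x.1 + b • y.1, convex_stdSimplex ℝ (Fin 4) x.2 y.2 ha hb hab⟩, ⟨?_, ?_⟩, rfl⟩
  · change ∑ i ∈ A, (a * x i + b * y i) = 1 / 2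
    have h1 : ∑ i ∈ A, x i = 1 / 2 := hx1
    have h2 : ∑ i ∈ A, y i = 1 / 2 := hy1
    rw [Finset.sum_add_distrib, ← Finset.mul_sum, ← Finset.mul_sum, h1, h2, ← add_mul, hab, one_mul]
  · intro i hi
    change a * x i + b * y i = 0
    rw [hx2 i hi, hy2 i hi, mul_zero, mul_zero, add_zero]

end

noncomputable section

/-! ### Normal surfaces from partitions of the vertices -/

open AngleStructures3 (IsCutEdge IsCutFace)

theorem exists_tetEdge {i j : Fin 4} (h : i ≠ j) :
    ∃ e : TetEdge, s(e.1.1, e.1.2) = s(i, j) := by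
  rcases lt_or_gt_of_ne h with h | h
  · exact ⟨⟨(i, j), h⟩, rfl⟩
  · exact ⟨⟨(j, i), h⟩, Sym2.eq_swap⟩

theorem isCutEdge_iff_of_eq {A : Finset (Fin 4)} {e : TetEdge} {i j : Fin 4}
    (h : s(e.1.1, e.1.2) = s(i, j)) : IsCutEdge A e ↔ ¬ (i ∈ A ↔ j ∈ A) := by
  rw [IsCutEdge]
  rcases Sym2.eq_iff.1 h with ⟨h1, h2⟩ | ⟨h1, h2⟩ <;> rw [h1, h2]
  rw [iff_comm (a := i ∈ A)]

namespace FaceGluing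

variable {ι : Type*} {G : FaceGluing ι} {A : ι → Finset (Fin 4)}

/-- A family of partitions of the vertices of the simplices that separates the end points of glued
edges in the same way. -/
def IsCutSystem (G : FaceGluing ι) (A : ι → Finset (Fin 4)) : Prop :=
  ∀ a b, G.EdgeGlued a b → (IsCutEdge (A a.1) a.2 ↔ IsCutEdge (A b.1) b.2)

theorem IsCutSystem.mem_iff_mem (hA : G.IsCutSystem A) {σ : ι} {f i j : Fin 4} (hi : i ≠ f)
    (hj : j ≠ f) : (i ∈ A σ ↔ j ∈ A σ) ↔
      (G.perm σ f i ∈ A (G.nbr σ f) ↔ G.perm σ f j ∈ A (G.nbr σ f)) := by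
  rcases eq_or_ne i j with rfl | hij
  · simp
  obtain ⟨e, he⟩ := exists_tetEdge hij
  obtain ⟨e', he'⟩ := exists_tetEdge ((G.perm σ f).injective.ne hij)
  have hg : G.EdgeGlued (σ, e) (G.nbr σ f, e') := by
    refine ⟨f, ?_, ?_, rfl, ?_⟩
    · rcases Sym2.eq_iff.1 he with ⟨h1, h2⟩ | ⟨h1, h2⟩ <;> simp only [h1, hi.symm, hj.symm, ne_eq,
        not_false_eq_true]
    · rcases Sym2.eq_iff.1 he with ⟨h1, h2⟩ | ⟨h1, h2⟩ <;> simp only [h2, hi.symm, hj.symm, ne_eq,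
        not_false_eq_true]
    · exact he'.trans (congrArg (Sym2.map (G.perm σ f)) he).symm
  have h := hA _ _ hg
  rw [isCutEdge_iff_of_eq he, isCutEdge_iff_of_eq he'] at h
  exact not_iff_not.1 h

theorem Glued.symm {a b : Σ _ : ι, Simplex3} (h : G.Glued a b) : G.Glued b a := by
  obtain ⟨σ, x⟩ := a
  obtain ⟨τ, y⟩ := b
  obtain ⟨f, hf, rfl, h⟩ := h
  refine ⟨G.perm σ f f, (h f).trans hf, (G.nbr_nbr σ f).symm, fun i => ?_⟩
  have h1 := h ((G.perm σ f)⁻¹ i)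
  rw [Equiv.Perm.coe_inv, Equiv.apply_symm_apply] at h1
  change x (G.perm (G.nbr σ f) (G.perm σ f f) i) = y i
  rw [G.perm_perm]
  exact h1.symm

/-- Matching partitions of a common face may still have their sides exchanged. Then the two sums are
equal or add up to `1`, and the value `1 / 2` is preserved in both cases. -/
theorem Glued.sum_eq_half_iff (hA : G.IsCutSystem A) {a b : Σ _ : ι, Simplex3}
    (h : G.Glued a b) :
    (∑ i ∈ A a.1, a.2 i = 1 / 2) ↔ ∑ i ∈ A b.1, b.2 i = 1 / 2 := by
  obtain ⟨σ, x⟩ := a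
  obtain ⟨τ, y⟩ := b
  obtain ⟨f, hf, rfl, h⟩ := h
  change (∑ i ∈ A σ, x i = 1 / 2) ↔ ∑ i ∈ A (G.nbr σ f), y i = 1 / 2
  have hf' : x f = 0 := hf
  have h' : ∀ i, y (G.perm σ f i) = x i := h
  have hx : ∑ i ∈ A σ, x i = ∑ i, if i ∈ A σ then x i else 0 := by
    rw [Finset.sum_ite_mem, Finset.univ_inter]
  have hy : ∑ i ∈ A (G.nbr σ f), y i =
      ∑ i, if G.perm σ f i ∈ A (G.nbr σ f) then x i else 0 := by
    rw [← Finset.univ_inter (A (G.nbr σ f)), ← Finset.sum_ite_mem,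
      ← Equiv.sum_comp (G.perm σ f)]
    simp only [h', Finset.univ_inter]
  have h1 := stdSimplex.sum_eq_one x
  obtain ⟨k, hk⟩ : ∃ k, k ≠ f := exists_ne f
  by_cases hc : k ∈ A σ ↔ G.perm σ f k ∈ A (G.nbr σ f)
  · have : ∑ i ∈ A σ, x i = ∑ i ∈ A (G.nbr σ f), y i := by
      rw [hx, hy]
      refine Finset.sum_congr rfl fun i _ => ?_
      rcases eq_or_ne i f with rfl | hi
      · rw [hf', ite_self, ite_self]
      · have := hA.mem_iff_mem (σ := σ) hi hk
        have : i ∈ A σ ↔ G.perm σ f i ∈ A (G.nbr σ f) := by tauto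
        simp only [this]
    rw [this]
  · have : ∑ i ∈ A σ, x i + ∑ i ∈ A (G.nbr σ f), y i = 1 := by
      rw [← h1, hx, hy, ← Finset.sum_add_distrib]
      refine Finset.sum_congr rfl fun i _ => ?_
      rcases eq_or_ne i f with rfl | hi
      · rw [hf', ite_self, ite_self, add_zero]
      · have := hA.mem_iff_mem (σ := σ) hi hk
        have : i ∈ A σ ↔ ¬ G.perm σ f i ∈ A (G.nbr σ f) := by tauto
        by_cases hi : G.perm σ f i ∈ A (G.nbr σ f)
        · rw [if_pos hi, if_neg (by tauto), zero_add]
        · rw [if_neg hi, if_pos (by tauto), add_zero]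
    constructor <;> intro <;> linarith

/-- The edges of the gluing whose interior contains a given point. -/
def edgesAt (G : FaceGluing ι) (a : Σ _ : ι, Simplex3) : Set G.Edge :=
  {ε | ∃ e : TetEdge, Quot.mk _ (a.1, e) = ε ∧ ∀ i, a.2 i ≠ 0 ↔ i = e.1.1 ∨ i = e.1.2}

theorem Glued.edgesAt_subset {a b : Σ _ : ι, Simplex3} (h : G.Glued a b) :
    G.edgesAt a ⊆ G.edgesAt b := by
  obtain ⟨σ, x⟩ := a
  obtain ⟨τ, y⟩ := b
  obtain ⟨f, hf, rfl, h⟩ := h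
  rintro _ ⟨e, rfl, he⟩
  have hf' : x f = 0 := hf
  have h' : ∀ i, y (G.perm σ f i) = x i := h
  have he' : ∀ i, x i ≠ 0 ↔ i = e.1.1 ∨ i = e.1.2 := he
  have hfe := mt (he' f).2 (not_not.2 hf')
  rw [not_or] at hfe
  obtain ⟨e', hee⟩ := exists_tetEdge ((G.perm σ f).injective.ne e.2.ne)
  refine ⟨e', (Quot.sound ⟨f, hfe.1, hfe.2, rfl, hee⟩).symm, fun i => ?_⟩
  obtain ⟨k, rfl⟩ := (G.perm σ f).surjective i
  change y (G.perm σ f k) ≠ 0 ↔ _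
  rw [h', he', ← Sym2.mem_iff, ← Sym2.mem_iff, hee, Sym2.mem_iff, Sym2.mem_iff,
    (G.perm σ f).injective.eq_iff, (G.perm σ f).injective.eq_iff]

theorem Glued.edgesAt_eq {a b : Σ _ : ι, Simplex3} (h : G.Glued a b) :
    G.edgesAt a = G.edgesAt b :=
  h.edgesAt_subset.antisymm h.symm.edgesAt_subset

theorem edgesAt_midpoint3 (G : FaceGluing ι) (a : ι × TetEdge) :
    G.edgesAt ⟨a.1, midpoint3 a.2.1.1 a.2.1.2 a.2.2.ne⟩ = {Quot.mk _ a} := by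
  have hm : ∀ i, midpoint3 a.2.1.1 a.2.1.2 a.2.2.ne i ≠ 0 ↔ i = a.2.1.1 ∨ i = a.2.1.2 := by
    intro i
    rw [midpoint3_apply]
    split_ifs with h <;> simp [h]
  ext ε
  constructor
  · rintro ⟨e, rfl, he⟩
    have h : ∀ i, i ∈ s(e.1.1, e.1.2) ↔ i ∈ s(a.2.1.1, a.2.1.2) := fun i => by
      rw [Sym2.mem_iff, Sym2.mem_iff, ← hm]
      exact (he i).symm
    have h2 : e = a.2 := by
      have e2 := e.2
      have a2 := a.2.2
      rcases Sym2.eq_iff.1 (Sym2.ext h) with ⟨h1, h2⟩ | ⟨h1, h2⟩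
      · exact Subtype.ext (Prod.ext h1 h2)
      · rw [h1, h2] at e2
        exact absurd e2 a2.asymm
    rw [h2]
    rfl
  · rintro rfl
    exact ⟨a.2, rfl, hm⟩

/-- The simplex that contains a given point in its interior. -/
def simplexAt (a : Σ _ : ι, Simplex3) : Set ι := {σ | a.1 = σ ∧ ∀ i, a.2 i ≠ 0}

theorem Glued.simplexAt_eq {a b : Σ _ : ι, Simplex3} (h : G.Glued a b) :
    simplexAt a = simplexAt b := by
  obtain ⟨f, hf, -, h⟩ := h
  ext σ
  exact ⟨fun h1 => absurd hf (h1.2 f), fun h1 => absurd ((h f).trans hf) (h1.2 _)⟩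

/-- The other side of a face. -/
def flip (G : FaceGluing ι) (a : ι × Fin 4) : ι × Fin 4 := (G.nbr a.1 a.2, G.perm a.1 a.2 a.2)

theorem flip_flip (G : FaceGluing ι) (a : ι × Fin 4) : G.flip (G.flip a) = a := by
  simp only [flip, G.nbr_nbr, G.perm_perm, Equiv.Perm.coe_inv, Equiv.symm_apply_apply]

theorem flip_ne (G : FaceGluing ι) (a : ι × Fin 4) : G.flip a ≠ a := fun h =>
  G.not_self a.1 a.2 ⟨congrArg Prod.fst h, congrArg Prod.snd h⟩

theorem exists_glued (G : FaceGluing ι) {a : ι × Fin 4} {x : Simplex3} (hx : x a.2 = 0) :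
    ∃ y : Simplex3, y (G.flip a).2 = 0 ∧ G.Glued ⟨a.1, x⟩ ⟨(G.flip a).1, y⟩ := by
  have h : ∀ i, x ((G.perm a.1 a.2)⁻¹ (G.perm a.1 a.2 i)) = x i := fun i => by
    rw [Equiv.Perm.coe_inv, Equiv.symm_apply_apply]
  refine ⟨⟨fun i => x ((G.perm a.1 a.2)⁻¹ i), fun i => stdSimplex.zero_le x _, ?_⟩,
    (h a.2).trans hx, a.2, hx, rfl, h⟩
  rw [Equiv.sum_comp (G.perm a.1 a.2)⁻¹ x]
  exact stdSimplex.sum_eq_one x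

end FaceGluing

end

/-! ### The cells of the surface and the Gauss–Bonnet count -/

noncomputable section

open AngleStructures3 (IsCutEdge IsCutFace)

namespace Triangulation

variable {ι : Type*} {M : Type*} [TopologicalSpace M] {T : Triangulation ι M}
  {A : ι → Finset (Fin 4)}

theorem charMap_eq_of_glued {σ τ : ι} {x y : Simplex3}
    (h : T.toFaceGluing.Glued ⟨σ, x⟩ ⟨τ, y⟩) : T.charMap σ x = T.charMap τ y :=
  congrArg T.homeo (Quot.sound h)

/-- A gluing-invariant function descends to `M`, so points are told apart by invariants, without
analysing chains of identifications. -/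
theorem eq_of_charMap_eq {α : Sort*} (P : (Σ _ : ι, Simplex3) → α)
    (hP : ∀ a b, T.toFaceGluing.Glued a b → P a = P b) {σ τ : ι} {x y : Simplex3}
    (h : T.charMap σ x = T.charMap τ y) : P ⟨σ, x⟩ = P ⟨τ, y⟩ :=
  congrArg (Quot.lift P hP) (T.homeo.injective h)

/-- The surface that meets each simplex `σ` in the standard disk of `A σ`. -/
def cutSurface (T : Triangulation ι M) (A : ι → Finset (Fin 4)) : Set M :=
  ⋃ σ, T.charMap σ '' standardDisk (A σ)

theorem slice_cutSurface (hA : T.toFaceGluing.IsCutSystem A) (σ : ι) :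
    T.slice (T.cutSurface A) σ = standardDisk (A σ) := by
  ext x
  simp only [slice, cutSurface, Set.mem_preimage, Set.mem_iUnion]
  constructor
  · rintro ⟨τ, y, hy, h⟩
    have := eq_of_charMap_eq (fun a => ∑ i ∈ A a.1, a.2 i = 1 / 2)
      (fun a b hab => propext (hab.sum_eq_half_iff hA)) h
    exact this.mp hy
  · exact fun hx => ⟨σ, x, hx, rfl⟩

theorem isNormalSurface_of_slice {S : Set M} (hS : ∀ σ, T.slice S σ = ∅ ∨ IsNormalDisk (T.slice S σ)) :
    T.IsNormalSurface S := by
  intro σ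
  rcases hS σ with h | h
  · exact ⟨∅, Set.finite_empty, Set.pairwise_empty _, by simp, by simpa using h⟩
  · exact ⟨{T.slice S σ}, Set.finite_singleton _, Set.pairwise_singleton _ _, by simpa using h,
      by simp⟩

/-- A standard disk meets each face in a convex set, which is its own connected component. -/
theorem cells_eq {S : Set M} (hS : ∀ σ, T.slice S σ = standardDisk (A σ)) (k : ℕ) :
    T.cells S k = {c | ∃ (σ : ι) (B : Finset (Fin 4)), B.card = k + 2 ∧
      (standardDisk (A σ) ∩ simplexFace B).Nonempty ∧
      c = T.charMap σ '' (standardDisk (A σ) ∩ simplexFace B)} := by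
  ext c
  constructor
  · rintro ⟨σ, B, hB, x, hx, rfl⟩
    rw [hS] at hx ⊢
    exact ⟨σ, B, hB, ⟨x, hx⟩, by
      rw [(isPreconnected_standardDisk_inter _ _).connectedComponentIn hx]⟩
  · rintro ⟨σ, B, hB, ⟨x, hx⟩, rfl⟩
    refine ⟨σ, B, hB, x, by rwa [hS], ?_⟩
    rw [hS, (isPreconnected_standardDisk_inter _ _).connectedComponentIn hx]

theorem finite_cells [Finite ι] {S : Set M} (hS : ∀ σ, T.slice S σ = standardDisk (A σ)) (k : ℕ) :
    (T.cells S k).Finite := by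
  rw [cells_eq hS]
  refine (Set.finite_range fun a : ι × Finset (Fin 4) =>
    T.charMap a.1 '' (standardDisk (A a.1) ∩ simplexFace a.2)).subset ?_
  rintro _ ⟨σ, B, -, -, rfl⟩
  exact ⟨(σ, B), rfl⟩

/-- The edges of the triangulation that are cut by a family of partitions. -/
def cutEdges (T : Triangulation ι M) (A : ι → Finset (Fin 4)) : Set T.toFaceGluing.Edge :=
  {ε | ∃ a : ι × TetEdge, Quot.mk _ a = ε ∧ IsCutEdge (A a.1) a.2}

theorem mem_cutEdges_iff (hA : T.toFaceGluing.IsCutSystem A) {a : ι × TetEdge}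
    {ε : T.toFaceGluing.Edge} (ha : Quot.mk _ a = ε) : ε ∈ T.cutEdges A ↔ IsCutEdge (A a.1) a.2 := by
  refine ⟨?_, fun h => ⟨a, ha, h⟩⟩
  rintro ⟨b, hb, h⟩
  have : IsCutEdge (A b.1) b.2 = IsCutEdge (A a.1) a.2 :=
    congrArg (Quot.lift (fun a : ι × TetEdge => IsCutEdge (A a.1) a.2)
      fun a b hab => propext (hA a b hab)) (hb.trans ha.symm)
  exact this.mp h

/-- The midpoint of a cut edge is a 0-cell, and the invariant `edgesAt` recovers the edge from it.
-/
theorem ncard_cutEdges_le [Finite ι] {S : Set M} (hA : T.toFaceGluing.IsCutSystem A)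
    (hS : ∀ σ, T.slice S σ = standardDisk (A σ)) :
    (T.cutEdges A).ncard ≤ (T.cells S 0).ncard := by
  have hrep : ∀ ε : T.toFaceGluing.Edge, ∃ a : ι × TetEdge, Quot.mk _ a = ε := Quot.exists_rep
  choose g hg using hrep
  refine Set.ncard_le_ncard_of_injOn (fun ε => {T.charMap (g ε).1
    (midpoint3 (g ε).2.1.1 (g ε).2.1.2 (g ε).2.2.ne)}) ?_ ?_ (finite_cells hS 0)
  · intro ε hε
    rw [cells_eq hS]
    refine ⟨(g ε).1, {(g ε).2.1.1, (g ε).2.1.2}, Finset.card_pair (g ε).2.2.ne, ?_⟩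
    rw [standardDisk_inter_simplexFace_pair (g ε).2.2.ne ((mem_cutEdges_iff hA (hg ε)).1 hε),
      Set.image_singleton]
    exact ⟨Set.singleton_nonempty _, rfl⟩
  · intro ε _ ε' _ h
    have := eq_of_charMap_eq T.toFaceGluing.edgesAt (fun a b hab => hab.edgesAt_eq)
      (Set.singleton_injective h)
    rw [FaceGluing.edgesAt_midpoint3, FaceGluing.edgesAt_midpoint3] at this
    rw [← hg ε, ← hg ε']
    exact Set.singleton_injective this

theorem image_subset_image_flip (hA : T.toFaceGluing.IsCutSystem A) (a : ι × Fin 4) :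
    T.charMap a.1 '' (standardDisk (A a.1) ∩ simplexFace {a.2}ᶜ) ⊆
      T.charMap (T.flip a).1 '' (standardDisk (A (T.flip a).1) ∩ simplexFace {(T.flip a).2}ᶜ) := by
  rintro _ ⟨x, ⟨hx1, hx2⟩, rfl⟩
  obtain ⟨y, hy, hg⟩ := T.exists_glued (hx2 a.2 (by simp))
  refine ⟨y, ⟨(hg.sum_eq_half_iff hA).1 hx1, fun i hi => ?_⟩, (charMap_eq_of_glued hg).symm⟩
  rw [Finset.mem_compl, not_not, Finset.mem_singleton] at hi
  rw [hi, hy]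

/-- Each arc is seen from both sides of its face, and `flip` has no fixed points, so at least two
cut faces of simplices yield the same 1-cell. -/
theorem two_mul_ncard_cells_one_le [Fintype ι] {S : Set M} (hA : T.toFaceGluing.IsCutSystem A)
    (hS : ∀ σ, T.slice S σ = standardDisk (A σ)) :
    2 * (T.cells S 1).ncard ≤ ∑ σ, (Finset.univ.filter (IsCutFace (A σ))).card := by
  classical
  set Φ : ι × Fin 4 → Set M := fun a =>
    T.charMap a.1 '' (standardDisk (A a.1) ∩ simplexFace {a.2}ᶜ) with hΦ
  have hflip : ∀ a, Φ (T.flip a) = Φ a := fun a => by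
    refine Set.Subset.antisymm ?_ (image_subset_image_flip hA a)
    have := image_subset_image_flip hA (T.flip a)
    rwa [T.flip_flip] at this
  set s : Finset (ι × Fin 4) := Finset.univ.filter fun a => (Φ a).Nonempty with hs
  have hcells : T.cells S 1 = (s.image Φ : Finset (Set M)) := by
    rw [cells_eq hS]
    ext c
    simp only [Finset.coe_image, Set.mem_image, hs, Finset.coe_filter, Finset.mem_univ, true_and,
      Set.mem_ofPred_eq]
    constructor
    · rintro ⟨σ, B, hB, hne, rfl⟩
      have hc : Bᶜ.card = 1 := by rw [Finset.card_compl, hB, Fintype.card_fin]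
      obtain ⟨f, hf⟩ := Finset.card_eq_one.1 hc
      obtain rfl : B = {f}ᶜ := by rw [← hf, compl_compl]
      exact ⟨(σ, f), hne.image _, rfl⟩
    · rintro ⟨a, hne, rfl⟩
      refine ⟨a.1, {a.2}ᶜ, ?_, Set.image_nonempty.1 hne, rfl⟩
      rw [Finset.card_compl, Finset.card_singleton, Fintype.card_fin]
  have h1 : 2 * (s.image Φ).card ≤ s.card := by
    refine Finset.mul_card_image_le_card_of_maps_to (fun a ha => Finset.mem_image_of_mem Φ ha) 2
      fun b hb => ?_
    obtain ⟨a, ha, rfl⟩ := Finset.mem_image.1 hb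
    rw [← Finset.card_pair (T.flip_ne a)]
    refine Finset.card_le_card fun c hc => ?_
    rw [hs, Finset.mem_filter] at ha
    rcases Finset.mem_insert.1 hc with rfl | hc
    · simp [hs, hflip, ha.2]
    · rw [Finset.mem_singleton.1 hc]
      simp [hs, ha.2]
  have h2 : s.card ≤ ∑ σ, (Finset.univ.filter (IsCutFace (A σ))).card := by
    rw [← Finset.card_sigma]
    refine Finset.card_le_card_of_injOn (fun a => ⟨a.1, a.2⟩) ?_ ?_
    · intro a ha
      rw [hs, Finset.mem_coe, Finset.mem_filter] at ha
      obtain ⟨_, x, hx, -⟩ := ha.2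
      obtain ⟨⟨i, hi, hi'⟩, j, hj, hj'⟩ := exists_mem_notMem_of_mem_standardDisk hx
      have : IsCutFace (A a.1) a.2 := ⟨i, j, by simpa using hi, by simpa using hj, hi', hj'⟩
      simpa using this
    · rintro ⟨σ, f⟩ _ ⟨τ, g⟩ _ h
      simp only [Sigma.mk.injEq, heq_eq_eq] at h
      exact Prod.ext h.1 h.2
  rw [hcells, Set.ncard_coe_finset]
  exact h1.trans h2

/-- Each disk has a point in the interior of its simplex, which determines the simplex by the
invariant `simplexAt`. -/
theorem card_le_ncard_cells_two [Fintype ι] {S : Set M}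
    (hS : ∀ σ, T.slice S σ = standardDisk (A σ)) (h0 : ∀ σ, 0 ∉ A σ) :
    (Finset.univ.filter fun σ => (A σ).Nonempty).card ≤ (T.cells S 2).ncard := by
  have huniv : ∀ σ, standardDisk (A σ) ∩ simplexFace Finset.univ = standardDisk (A σ) :=
    fun σ => Set.inter_eq_left.2 fun x _ i hi => absurd (Finset.mem_univ i) hi
  rw [← Set.ncard_coe_finset]
  refine Set.ncard_le_ncard_of_injOn (fun σ => T.charMap σ '' standardDisk (A σ)) ?_ ?_
    (finite_cells hS 2)
  · intro σ hσ
    obtain ⟨x, hx, -⟩ := exists_mem_standardDisk_pos (Finset.mem_filter.1 hσ).2 (h0 σ)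
    rw [cells_eq hS]
    refine ⟨σ, Finset.univ, by simp, ?_⟩
    rw [huniv]
    exact ⟨⟨x, hx⟩, rfl⟩
  · intro σ hσ τ _ h
    obtain ⟨x, hx, hpos⟩ := exists_mem_standardDisk_pos (Finset.mem_filter.1 hσ).2 (h0 σ)
    obtain ⟨y, -, hy⟩ : T.charMap σ x ∈ T.charMap τ '' standardDisk (A τ) :=
      (show T.charMap σ '' standardDisk (A σ) = T.charMap τ '' standardDisk (A τ) from h) ▸ ⟨x, hx, rfl⟩
    have h1 := eq_of_charMap_eq FaceGluing.simplexAt (fun a b hab => hab.simplexAt_eq) hy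
    have h2 : σ ∈ FaceGluing.simplexAt (⟨σ, x⟩ : Σ _ : ι, Simplex3) := ⟨rfl, hpos⟩
    rw [← h1] at h2
    exact h2.1.symm

/-- The corners are grouped by edge class. A class is cut as a whole or not at all, and a cut one
contributes `2π`. -/
theorem sum_cut_angles [Fintype ι] {p : ι → Fin 4 → Fin 4 → ℝ} (hp : p ∈ T.angleStructures)
    (hA : T.toFaceGluing.IsCutSystem A) :
    ∑ σ, ∑ e : TetEdge, (if IsCutEdge (A σ) e then p σ e.1.1 e.1.2 else 0) =
      2 * Real.pi * (T.cutEdges A).ncard := by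
  classical
  have : Finite T.toFaceGluing.Edge := Quot.finite _
  have := Fintype.ofFinite T.toFaceGluing.Edge
  have h1 : ∀ ε : T.toFaceGluing.Edge, (if ε ∈ T.cutEdges A then 2 * Real.pi else 0) =
      ∑ a : ι × TetEdge, if (Quot.mk _ a : T.toFaceGluing.Edge) = ε then
        (if IsCutEdge (A a.1) a.2 then p a.1 a.2.1.1 a.2.1.2 else 0) else 0 := by
    intro ε
    have h2 : ∀ a : ι × TetEdge, (Quot.mk _ a : T.toFaceGluing.Edge) = ε →
        (IsCutEdge (A a.1) a.2 ↔ ε ∈ T.cutEdges A) := fun a ha =>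
      (mem_cutEdges_iff hA ha).symm
    split_ifs with hε
    · rw [← hp.2 ε]
      refine Finset.sum_congr rfl fun a _ => ?_
      by_cases ha : (Quot.mk _ a : T.toFaceGluing.Edge) = ε
      · rw [if_pos ha, if_pos ha, if_pos ((h2 a ha).2 hε)]
      · rw [if_neg ha, if_neg ha]
    · refine (Finset.sum_eq_zero fun a _ => ?_).symm
      by_cases ha : (Quot.mk _ a : T.toFaceGluing.Edge) = ε
      · rw [if_pos ha, if_neg (mt (h2 a ha).1 hε)]
      · rw [if_neg ha]
  have h3 : ∑ ε : T.toFaceGluing.Edge, (if ε ∈ T.cutEdges A then 2 * Real.pi else 0) =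
      2 * Real.pi * (T.cutEdges A).ncard := by
    rw [← Finset.sum_filter, Finset.sum_const, nsmul_eq_mul, mul_comm, Set.ncard_eq_toFinset_card']
    congr 3
    ext ε
    simp
  have h4 : ∀ a : ι × TetEdge, (∑ ε : T.toFaceGluing.Edge,
      if (Quot.mk _ a : T.toFaceGluing.Edge) = ε then
        (if IsCutEdge (A a.1) a.2 then p a.1 a.2.1.1 a.2.1.2 else 0) else 0) =
      if IsCutEdge (A a.1) a.2 then p a.1 a.2.1.1 a.2.1.2 else 0 := fun a =>
    (Finset.sum_eq_single_of_mem (ι := T.toFaceGluing.Edge) (Quot.mk _ a) (Finset.mem_univ _)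
      fun ε _ h => if_neg h.symm).trans (if_pos rfl)
  rw [← h3, Finset.sum_congr rfl fun ε _ => h1 ε, Finset.sum_comm (s := Finset.univ (α := T.Edge)),
    Finset.sum_congr rfl fun a _ => h4 a, Fintype.sum_prod_type]

/-- The combinatorial Gauss-Bonnet inequality. -/
theorem eulerChar_pos [Fintype ι] {p : ι → Fin 4 → Fin 4 → ℝ} (hp : p ∈ T.angleStructures)
    (hA : T.toFaceGluing.IsCutSystem A) {S : Set M}
    (hS : ∀ σ, T.slice S σ = standardDisk (A σ)) (h0 : ∀ σ, 0 ∉ A σ)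
    (hcut : ∀ σ, (A σ).Nonempty →
      (((Finset.univ.filter (IsCutFace (A σ))).card : ℝ) - 2) * Real.pi <
        ∑ e : TetEdge, if IsCutEdge (A σ) e then p σ e.1.1 e.1.2 else 0)
    (hne : ∃ σ, (A σ).Nonempty) : 0 < T.eulerChar S := by
  have hV := ncard_cutEdges_le hA hS
  have hE := two_mul_ncard_cells_one_le hA hS
  have hF := card_le_ncard_cells_two hS h0
  have hsum := sum_cut_angles hp hA
  -- The summand is the angle excess of the disk in `σ`: positive if there is a disk, and zero
  -- otherwise.
  have hpos : 0 < ∑ σ, ((∑ e : TetEdge, if IsCutEdge (A σ) e then p σ e.1.1 e.1.2 else 0) -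
      Real.pi * ((Finset.univ.filter (IsCutFace (A σ))).card : ℝ) +
      2 * Real.pi * if (A σ).Nonempty then 1 else 0) := by
    have hle : ∀ σ, (A σ).Nonempty →
        0 < (∑ e : TetEdge, if IsCutEdge (A σ) e then p σ e.1.1 e.1.2 else 0) -
      Real.pi * ((Finset.univ.filter (IsCutFace (A σ))).card : ℝ) +
      2 * Real.pi * if (A σ).Nonempty then 1 else 0 := fun σ h => by
      rw [if_pos h]
      linarith [hcut σ h]
    obtain ⟨τ, hτ⟩ := hne
    refine Finset.sum_pos' (fun σ _ => ?_) ⟨τ, Finset.mem_univ τ, hle τ hτ⟩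
    by_cases h : (A σ).Nonempty
    · exact (hle σ h).le
    · have hf : Finset.univ.filter (IsCutFace ∅) = ∅ := Finset.filter_eq_empty_iff.2 (by
        rintro f - ⟨i, _, _, _, hi, _⟩
        exact Finset.notMem_empty i hi)
      rw [Finset.not_nonempty_iff_eq_empty.1 h, hf]
      simp [IsCutEdge]
  rw [Finset.sum_add_distrib, Finset.sum_sub_distrib, hsum, ← Finset.mul_sum, ← Finset.mul_sum,
    Finset.sum_boole] at hpos
  have hE' : 2 * ((T.cells S 1).ncard : ℝ) ≤
      ∑ σ, ((Finset.univ.filter (IsCutFace (A σ))).card : ℝ) := by exact_mod_cast hE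
  have hV' : ((T.cutEdges A).ncard : ℝ) ≤ (T.cells S 0).ncard := by exact_mod_cast hV
  have hF' : ((Finset.univ.filter fun σ => (A σ).Nonempty).card : ℝ) ≤ (T.cells S 2).ncard := by
    exact_mod_cast hF
  have hπ := Real.pi_pos
  -- The three cell counts are only known as inequalities, but each of them goes in the direction
  -- that increases the Euler characteristic.
  have h2 : 0 < 2 * Real.pi * (((T.cells S 0).ncard : ℝ) - (T.cells S 1).ncard +
      (T.cells S 2).ncard) := by
    nlinarith [mul_le_mul_of_nonneg_left hE' hπ.le, mul_le_mul_of_nonneg_left hV' hπ.le,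
      mul_le_mul_of_nonneg_left hF' hπ.le]
  have h3 := (pos_iff_pos_of_mul_pos h2).1 (by positivity)
  rw [eulerChar]
  exact_mod_cast h3

/-- Being cut means having length at least `π`, and at a critical point the length depends only on
the edge class. -/
theorem isCutSystem_cutSet [Fintype ι] {p : ι → Fin 4 → Fin 4 → ℝ} (hp : T.IsCriticalPoint p) :
    T.toFaceGluing.IsCutSystem fun σ => AngleStructures3.cutSet (p σ) := by
  intro a b hab
  have h : ∀ c : ι × TetEdge, IsCutEdge (AngleStructures3.cutSet (p c.1)) c.2 ↔
      Real.pi ≤ edgeLength (p c.1) c.2.1.1 c.2.1.2 := fun c =>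
    (AngleStructures3.pi_le_edgeLength_iff_cutSet (hp.1.1 c.1) c.2.2.ne).symm
  rw [h, h, T.edgeLength_eq_of_mk_eq hp (Quot.sound hab)]

end Triangulation

end

/-! ### The normal surface of the long edges -/

theorem proposition7p1 {M : Type*} [TopologicalSpace M] [T2Space M] [CompactSpace M]
    [ChartedSpace (EuclideanSpace ℝ (Fin 3)) M] {ι : Type*} [Fintype ι]
    (T : Triangulation ι M) (p : ι → Fin 4 → Fin 4 → ℝ) (hp : T.IsCriticalPoint p)
    (hnc : ∃ σ, ¬ IsClassicalTetrahedron (p σ)) :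
    ∃ S : Set M, T.IsNormalSurface S ∧
      (∀ σ, T.slice S σ = ∅ ∨ IsNormalDisk (T.slice S σ)) ∧
      (∀ σ i j, i ≠ j →
        (Real.pi ≤ edgeLength (p σ) i j → ∃! x, x ∈ T.slice S σ ∩ simplexFace {i, j}) ∧
        (edgeLength (p σ) i j < Real.pi → T.slice S σ ∩ simplexFace {i, j} = ∅)) ∧
      0 < T.eulerChar S := by
  have hA := Triangulation.isCutSystem_cutSet hp
  set A : ι → Finset (Fin 4) := fun σ => AngleStructures3.cutSet (p σ) with hAdef
  have hS := Triangulation.slice_cutSurface hA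
  have hcut : ∀ σ i j, i ≠ j → (Real.pi ≤ edgeLength (p σ) i j ↔ ¬ (i ∈ A σ ↔ j ∈ A σ)) :=
    fun σ i j hij => AngleStructures3.pi_le_edgeLength_iff_cutSet (hp.1.1 σ) hij
  have h0 : ∀ σ, 0 ∉ A σ := fun σ => AngleStructures3.zero_notMem_cutSet (p σ)
  have hdisk : ∀ σ, T.slice (T.cutSurface A) σ = ∅ ∨ IsNormalDisk (T.slice (T.cutSurface A) σ) := by
    intro σ
    rw [hS]
    rcases (A σ).eq_empty_or_nonempty with h | h
    · exact Or.inl (h ▸ standardDisk_empty)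
    · exact Or.inr (isNormalDisk_standardDisk h (h0 σ))
  refine ⟨T.cutSurface A, Triangulation.isNormalSurface_of_slice hdisk, hdisk, fun σ i j hij => ⟨fun h => ?_,
    fun h => ?_⟩, Triangulation.eulerChar_pos hp.1 hA hS h0
      (fun σ h => AngleStructures3.angle_sum_of_isCut (hp.1.1 σ) h (h0 σ) (hcut σ)) ?_⟩
  · rw [hS, standardDisk_inter_simplexFace_pair hij ((hcut σ i j hij).1 h)]
    exact ⟨_, rfl, fun y hy => hy⟩
  · rw [hS, Set.eq_empty_iff_forall_notMem]
    intro x hx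
    obtain ⟨⟨a, ha, ha'⟩, b, hb, hb'⟩ := exists_mem_notMem_of_mem_standardDisk hx
    have hn := mt (hcut σ i j hij).2 h.not_ge
    rw [Finset.mem_insert, Finset.mem_singleton] at ha hb
    rcases ha with rfl | rfl <;> rcases hb with rfl | rfl <;> tauto
  · obtain ⟨σ, hσ⟩ := hnc
    exact ⟨σ, AngleStructures3.cutSet_nonempty_of_not_isClassical (hp.1.1 σ) hσ⟩
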